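/- For $N\ge 1$ let $W_N$ be a random real symmetric $N\times N$ matrix whose entries $(W_N)_{jk}$, $1\le j\le k\le N$, are independent, with $\mathbb E (W_N)_{jk}=0$ for all $j\le k$, $\mathbb V (W_N)_{jk}=\sigma^2$ for $j<k$, and $$m_4:=\sup_{j\ne k,\,N}\mathbb E (W_N)_{jk}^4<\infty ,\qquad \sigma_1^2:=\sup_{i,N}\mathbb E (W_N)_{ii}^2<\infty .$$ Let $m\ge 1$ be a fixed integer and suppose that, for every $1\le i\le m$ and every $\epsilon>0$, $$\frac1N\sum_{j:\,j\ne i}\mathbb E\left(|(W_N)_{ij}|^4\,\mathbf 1_{\{|(W_N)_{ij}|\ge \epsilon N^{1/4}\}}\right)\to 0\qquad (N\to\infty).$$ Then, after an extension of the probability space if necessary (with $W_N$ lifted to it), there are random real symmetric matrices $T_N$ of size $N\times N$ satisfying the assumptions made on $W_N$ in the first sentence (independence, centering, the same $\sigma^2$, and finite suprema of the fourth moments off the diagonal and of the second moments on it), and non-random $\epsilon_N>0$ with $\epsilon_N\to 0$, such that: 1. $(T_N)_{jk}=(W_N)_{jk}$ for $m+1\le j,k\le N$; 2. $\mathbb P\left((T_N)_{ik}=(W_N)_{ik}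 \text{ for all } 1\le i\le m,\ 1\le k\le N\right)\to 1$ as $N\to\infty$; 3. $\mathbb E (T_N)_{ik}=0$ for $1\le i\le m$, $1\le k\le N$; 4. $\mathbb V (T_N)_{ik}=\sigma^2$ for $1\le i\le m$, $1\le k\le N$, $i\ne k$, and $\sup_{1\le i\le m,\,N}\mathbb V (T_N)_{ii}<\infty$; 5. $\sup\{\mathbb E (T_N)_{ik}^4:\ N\ge 1,\ 1\le i\le m,\ 1\le k\le N,\ i\neq k\}<\infty$; 6. $\sup_{1\le i\le m,\,1\le k\le N}|(T_N)_{ik}|\le \epsilon_N N^{1/4}$. (If $N<m$, indices $i\le m$ are to be read as $i\le \min(m,N)$.) In addition, for every $s>3$ there is a constant $\mathrm{const}_s$, depending only on $s,\sigma,\sigma_1,m_4$, such that for every $f\in\mathcal H_s$ the random variables $f(T_N/\sqrt N)_{ij}$ have finite second moments and $$\mathbb V\left[f(T_N/\sqrt N)_{ij}\right]\le \mathrm{const}_s\,\frac{\|f\|_s^2}{N},\qquad N\ge 1,\ 1\le i\le \min(m,N),\ 1\le j\le N .$$ Here $f(A)$ is the functional calculus of a real symmetric matrix $A$, and $\mathcal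 H_s$ is the space of functions $f:\mathbb R\to\mathbb R$ in $L^2(\mathbb R)$ with $$\|f\|_s^2:=\int_{\mathbb R}(1+2|k|)^{2s}|\hat f(k)|^2\,dk<\infty,\qquad \hat f(k)=\frac1{\sqrt{2\pi}}\int_{\mathbb R}e^{-ikx}f(x)\,dx$$ (Plancherel transform), each $f$ being taken to be the continuous function in its class, which exists since $s>1/2$. The matrices $T_N$ and the numbers $\epsilon_N$ do not depend on $s$ or $f$. -/

import Mathlib

open MeasureTheory ProbabilityTheory Filter Topology FourierTransform

universe u

/-- A sequence of real symmetric Wigner matrices `W N` of size `N × N`, `N = 0, 1, 2, …`, on a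
probability space `(Ω, P)`: for each `N` the entries on and above the diagonal are independent; the
off-diagonal entries have mean `0`, variance `σ ^ 2` and fourth moments at most `m₄`; the diagonal
entries have mean `0` and second moments at most `σ₁ ^ 2`. -/
structure IsRealWigner {Ω : Type u} [MeasurableSpace Ω] (P : Measure Ω)
    (W : (N : ℕ) → Ω → Matrix (Fin N) (Fin N) ℝ) (σ σ₁ m₄ : ℝ) : Prop where
  measurable : ∀ (N : ℕ) (j k : Fin N), Measurable fun ω => W N ω j k
  symm : ∀ (N : ℕ) (ω : Ω), (W N ω).IsSymm
  indep : ∀ N : ℕ,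
    iIndepFun (fun (p : {p : Fin N × Fin N // p.1 ≤ p.2}) (ω : Ω) => W N ω p.1.1 p.1.2) P
  memLp_offDiag : ∀ (N : ℕ) (j k : Fin N), j ≠ k → MemLp (fun ω => W N ω j k) 4 P
  mean_offDiag : ∀ (N : ℕ) (j k : Fin N), j ≠ k → ∫ ω, W N ω j k ∂P = 0
  variance_offDiag : ∀ (N : ℕ) (j k : Fin N), j ≠ k →
    variance (fun ω => W N ω j k) P = σ ^ 2
  fourth_moment_le : ∀ (N : ℕ) (j k : Fin N), j ≠ k → ∫ ω, (W N ω j k) ^ 4 ∂P ≤ m₄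
  memLp_diag : ∀ (N : ℕ) (i : Fin N), MemLp (fun ω => W N ω i i) 2 P
  mean_diag : ∀ (N : ℕ) (i : Fin N), ∫ ω, W N ω i i ∂P = 0
  second_moment_le : ∀ (N : ℕ) (i : Fin N), ∫ ω, (W N ω i i) ^ 2 ∂P ≤ σ₁ ^ 2

/-- The truncated fourth moments of row `i` (rows are numbered from `0`),
`(1/N) ∑_{j ≠ i} 𝔼 (|W_{ij}|⁴ ; |W_{ij}| ≥ ε N^{1/4})`; the value is `0` for the finitely many `N`
for which there is no row `i`. -/
noncomputable def lindebergRow {Ω : Type u} [MeasurableSpace Ω] (P : Measure Ω)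
    (W : (N : ℕ) → Ω → Matrix (Fin N) (Fin N) ℝ) (i : ℕ) (ε : ℝ) (N : ℕ) : ℝ :=
  if h : i < N then
    (1 / (N : ℝ)) * ∑ j ∈ Finset.univ.erase (⟨i, h⟩ : Fin N),
      ∫ ω in {ω | ε * (N : ℝ) ^ (1 / 4 : ℝ) ≤ |W N ω ⟨i, h⟩ j|}, |W N ω ⟨i, h⟩ j| ^ 4 ∂P
  else 0

open Classical in
/-- The (Plancherel) Fourier transform `(2π)^{-1/2} ∫ exp (-i k x) f x dx` of a square integrable
function `f : ℝ → ℝ`, a function of `k` that is determined up to a null set. Mathlib's transform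
`𝓕` has the kernel `exp (-2 π i ξ x)`, whence the rescaling. -/
noncomputable def fourierHat (f : ℝ → ℝ) (k : ℝ) : ℂ :=
  if hf : MemLp (fun x => (f x : ℂ)) 2 (volume : Measure ℝ) then
    ((√(2 * Real.pi))⁻¹ : ℝ) * (𝓕 hf.toLp : Lp ℂ 2 (volume : Measure ℝ)) (k / (2 * Real.pi))
  else 0

/-- The integrand `(1 + 2|k|)^{2s} |f̂ k|²` of the squared Sobolev norm. -/
noncomputable def sobolevDensity (s : ℝ) (f : ℝ → ℝ) (k : ℝ) : ℝ :=
  (1 + 2 * |k|) ^ (2 * s) * ‖fourierHat f k‖ ^ 2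

/-- `f` belongs to `𝓗_s`: it is square integrable, with finite squared Sobolev norm. -/
def MemSobolevH (s : ℝ) (f : ℝ → ℝ) : Prop :=
  MemLp (fun x => (f x : ℂ)) 2 (volume : Measure ℝ) ∧ Integrable (sobolevDensity s f)

/-- `‖f‖_s² = ∫ (1 + 2|k|)^{2s} |f̂ k|² dk`. -/
noncomputable def sobolevNormSq (s : ℝ) (f : ℝ → ℝ) : ℝ :=
  ∫ k, sobolevDensity s f k

/-- The entry `(i, j)` of `f (A / √N)`, for a real symmetric `N × N` matrix `A`, where `f` acts by
the functional calculus (on the eigenvalues). -/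
noncomputable def matrixFunEntry (f : ℝ → ℝ) {N : ℕ} (A : Matrix (Fin N) (Fin N) ℝ)
    (i j : Fin N) : ℝ :=
  (cfc f ((√(N : ℝ))⁻¹ • A) : Matrix (Fin N) (Fin N) ℝ) i j

/-!
Proof idea. For the variance bound, Fourier inversion writes `f (A)` as a superposition of the
unitary matrices `exp (i k A)`. The entries of the matrix are grouped into blocks, one for each row,
and by the Efron–Stein inequality the variance of `exp (i k A) i j` is at most the sum over `a` of
the mean square of its change when row and column `a` of `A` are set to `0`. By Duhamel's formula
this change is at most a product of two integrals of linear forms in the entries of column `a`,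
whose coefficients, entries of a unitary matrix independent of that column, have squares that sum
to at most `1`. The fourth moments of such forms are of order `N ^ (-2)`, so that the blocks add
up to a bound of order `(1 + |k|) ^ 4 / N`. It is integrated in `k` against `𝓗_s` by the
Cauchy–Schwarz inequality.

For the truncation, an entry `X` is set to `0` where `|X| > K`, with `K = δ N * N ^ (1 / 4)`. This
shifts the mean and lowers the second moment by little, and both are restored by an independent
three-valued variable, bounded by `K`, that is nonzero with probability of order
`𝔼 (X ^ 2 ; |X| > K) / K ^ 2`. The Lindeberg condition makes the sum of these probabilities over a
row tend to `0`, also for some `δ N` that tends to `0`.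
-/

section FourierInversion

variable {V E : Type*} [NormedAddCommGroup V] [InnerProductSpace ℝ V] [FiniteDimensional ℝ V]
  [MeasurableSpace V] [BorelSpace V]

theorem continuous_fourierInv_of_integrable [NormedAddCommGroup E] [NormedSpace ℂ E] {g : V → E}
    (hg : Integrable g) : Continuous (𝓕⁻ g) := by
  have h : Continuous (𝓕 g) :=
    VectorFourier.fourierIntegral_continuous Real.continuous_fourierChar continuous_inner hg
  exact (h.comp continuous_neg).congr fun x => (Real.fourierInv_eq_fourier_neg g x).symm

theorem integral_fourierInv_smul_eq_integral_smul_fourierInv [NormedAddCommGroup E]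
    [NormedSpace ℂ E] [CompleteSpace E] {φ : V → ℂ} {g : V → E} (hφ : Integrable φ)
    (hg : Integrable g) : ∫ x, 𝓕⁻ φ x • g x = ∫ x, φ x • 𝓕⁻ g x := by
  have hflip : (-innerₗ V).flip = -innerₗ V := by ext; simp [real_inner_comm]
  have h := VectorFourier.integral_fourierIntegral_smul_eq_flip (L := -innerₗ V) (μ := volume)
    (ν := volume) Real.continuous_fourierChar (by exact continuous_inner.neg) hφ hg
  rwa [hflip] at h

variable [NormedAddCommGroup E] [InnerProductSpace ℂ E] [CompleteSpace E]

theorem coeFn_fourierInv_ae_eq {g : Lp E 2 (volume : Measure V)} (hg : Integrable g) :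
    (𝓕⁻ g : Lp E 2 (volume : Measure V)) =ᵐ[volume] 𝓕⁻ (g : V → E) := by
  refine ae_eq_of_integral_contDiff_smul_eq
    ((Lp.memLp (𝓕⁻ g)).locallyIntegrable one_le_two)
    (continuous_fourierInv_of_integrable hg).locallyIntegrable fun φ hφ hφs => ?_
  let Φ : SchwartzMap V ℂ :=
    (hφs.comp_left (g := fun r : ℝ => (r : ℂ)) Complex.ofReal_zero).toSchwartzMap
      (Complex.ofRealCLM.contDiff.comp hφ)
  have hΦ : ∀ (x : V) (v : E), Φ x • v = φ x • v := fun x v => Complex.coe_smul (φ x) v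
  have hdual := congrArg (fun T => T Φ) (Lp.fourierInv_toTemperedDistribution_eq g)
  simp only [TemperedDistribution.fourierInv_apply, Lp.toTemperedDistribution_apply, hΦ,
    SchwartzMap.fourierInv_coe] at hdual
  rw [← hdual, integral_fourierInv_smul_eq_integral_smul_fourierInv Φ.integrable hg]
  simp only [hΦ]

theorem eq_fourierInv_fourier_toLp {f : V → E} (hf : Continuous f)
    (hf2 : MemLp f 2 (volume : Measure V))
    (hg : Integrable (𝓕 hf2.toLp : Lp E 2 (volume : Measure V))) :
    f = 𝓕⁻ ((𝓕 hf2.toLp : Lp E 2 (volume : Measure V)) : V → E) := by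
  have hinv : 𝓕⁻ (𝓕 hf2.toLp : Lp E 2 (volume : Measure V)) = hf2.toLp := fourierInv_fourier_eq _
  have hae := coeFn_fourierInv_ae_eq hg
  rw [hinv] at hae
  exact (hf.ae_eq_iff_eq volume (continuous_fourierInv_of_integrable hg)).1
    (hf2.coeFn_toLp.symm.trans hae)

end FourierInversion

section SobolevSpace

variable {f : ℝ → ℝ} {s : ℝ}

theorem fourierHat_of_memLp (hf : MemLp (fun x => (f x : ℂ)) 2 (volume : Measure ℝ)) (k : ℝ) :
    fourierHat f k = ((√(2 * Real.pi))⁻¹ : ℝ) *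
      (𝓕 hf.toLp : Lp ℂ 2 (volume : Measure ℝ)) (k / (2 * Real.pi)) := by
  rw [fourierHat, dif_pos hf]

theorem aestronglyMeasurable_fourierHat (f : ℝ → ℝ) : AEStronglyMeasurable (fourierHat f) := by
  by_cases hf : MemLp (fun x => (f x : ℂ)) 2 (volume : Measure ℝ)
  · have hscale : Measure.QuasiMeasurePreserving (fun k : ℝ => k / (2 * Real.pi)) := by
      refine ⟨by fun_prop, ?_⟩
      simp only [div_eq_mul_inv]
      rw [Real.map_volume_mul_right (by positivity)]
      exact Measure.smul_absolutelyContinuous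
    simp only [funext (fourierHat_of_memLp hf)]
    exact ((Lp.aestronglyMeasurable _).comp_quasiMeasurePreserving hscale).const_mul _
  · exact aestronglyMeasurable_const.congr (.of_forall fun k => by rw [fourierHat, dif_neg hf])

theorem integrable_one_add_two_mul_abs_rpow_neg {r : ℝ} (hr : 1 < r) :
    Integrable fun k : ℝ => (1 + 2 * |k|) ^ (-r) := by
  have h := (integrable_one_add_norm (E := ℝ) (μ := volume) (r := r) (by simpa using hr))
  simpa using h.comp_mul_left' (R := 2) two_ne_zero

theorem sobolevDensity_nonneg (s : ℝ) (f : ℝ → ℝ) (k : ℝ) : 0 ≤ sobolevDensity s f k := by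
  unfold sobolevDensity
  positivity

theorem MemSobolevH.integrable_fourierHat (hs : 1 / 2 < s) (hf : MemSobolevH s f) :
    Integrable (fourierHat f) := by
  have hsum := hf.2.add (integrable_one_add_two_mul_abs_rpow_neg (r := 2 * s) (by linarith))
  refine hsum.mono' (aestronglyMeasurable_fourierHat f) (.of_forall fun k => ?_)
  have hbase : (0 : ℝ) < 1 + 2 * |k| := by positivity
  simp only [Pi.add_apply, sobolevDensity, Real.rpow_neg hbase.le]
  set w := (1 + 2 * |k|) ^ (2 * s)
  set a := ‖fourierHat f k‖
  have hw : 0 < w := Real.rpow_pos_of_pos hbase _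
  have hsq : w * a ^ 2 + w⁻¹ - 2 * a = w⁻¹ * (w * a - 1) ^ 2 := by field_simp; ring
  have hsq_nonneg : 0 ≤ w⁻¹ * (w * a - 1) ^ 2 := by positivity
  have ha : 0 ≤ a := norm_nonneg _
  linarith

theorem MemSobolevH.eq_integral (hs : 1 / 2 < s) (hc : Continuous f) (hf : MemSobolevH s f)
    (x : ℝ) :
    (f x : ℂ) = ((√(2 * Real.pi))⁻¹ : ℝ) *
      ∫ k, fourierHat f k * Complex.exp (Complex.I * (k * x)) := by
  have hpi : (0 : ℝ) < 2 * Real.pi := by positivity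
  have hsqrt : (√(2 * Real.pi) : ℂ) ≠ 0 := by exact_mod_cast (Real.sqrt_pos.2 hpi).ne'
  set g : ℝ → ℂ := ((𝓕 hf.1.toLp : Lp ℂ 2 (volume : Measure ℝ)) : ℝ → ℂ)
  have hg : ∀ ξ, g ξ = √(2 * Real.pi) * fourierHat f (2 * Real.pi * ξ) := fun ξ => by
    rw [fourierHat_of_memLp hf.1, mul_div_cancel_left₀ _ hpi.ne', Complex.ofReal_inv,
      mul_inv_cancel_left₀ hsqrt]
  have hgi : Integrable g := by
    rw [funext hg]
    exact ((hf.integrable_fourierHat hs).comp_mul_left' hpi.ne').const_mul _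
  have hinv := congrFun
    (eq_fourierInv_fourier_toLp (Complex.continuous_ofReal.comp hc) hf.1 hgi) x
  have hsubst := Measure.integral_comp_mul_left
    (fun k : ℝ => fourierHat f k * Complex.exp (Complex.I * (k * x))) (2 * Real.pi)
  rw [abs_of_pos (inv_pos.2 hpi)] at hsubst
  calc (f x : ℂ) = ∫ ξ : ℝ, √(2 * Real.pi) * (fourierHat f (2 * Real.pi * ξ) *
        Complex.exp (Complex.I * (((2 * Real.pi * ξ : ℝ) : ℂ) * x))) := by
        refine hinv.trans ((Real.fourierInv_eq' _ _).trans (integral_congr_ae (.of_forall ?_)))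
        intro ξ
        change _ • g ξ = _
        rw [hg, smul_eq_mul, mul_comm, mul_assoc]
        congr 3
        simp only [RCLike.inner_apply, conj_trivial, Complex.ofReal_mul]
        push_cast
        ring
    _ = _ := by
        rw [integral_const_mul, hsubst, Complex.real_smul, ← mul_assoc]
        congr 1
        rw [eq_comm, Complex.ofReal_inv, inv_eq_iff_eq_inv, mul_inv, Complex.ofReal_inv, inv_inv]
        field_simp
        rw [← Complex.ofReal_pow, Real.sq_sqrt hpi.le]

end SobolevSpace

section EfronStein

variable {ι : Type*} {X : ι → Type*} [∀ i, MeasurableSpace (X i)]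
  {H : Type*} [NormedAddCommGroup H]

section Probability

variable {α : Type*} [MeasurableSpace α] {ν : Measure α} [IsProbabilityMeasure ν]
  [InnerProductSpace ℝ H] [CompleteSpace H] {F : α → H}

theorem integral_norm_sub_const_sq (hF : MemLp F 2 ν) (c : H) :
    ∫ x, ‖F x - c‖ ^ 2 ∂ν = ∫ x, ‖F x‖ ^ 2 ∂ν - 2 * inner ℝ (∫ x, F x ∂ν) c + ‖c‖ ^ 2 := by
  have hFi : Integrable F ν := hF.integrable one_le_two
  have hsq : Integrable (fun x => ‖F x‖ ^ 2) ν := hF.integrable_norm_pow'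
  have hinner : Integrable (fun x => 2 * inner ℝ (F x) c) ν := (hFi.inner_const c).const_mul 2
  have hdiff : Integrable (fun x => ‖F x‖ ^ 2 - 2 * inner ℝ (F x) c) ν := hsq.sub hinner
  simp only [norm_sub_sq_real]
  rw [integral_add hdiff (integrable_const _), integral_sub hsq hinner, integral_const_mul]
  simp only [real_inner_comm c, integral_inner hFi, integral_const, probReal_univ, one_smul]

theorem norm_integral_sq_le (hF : MemLp F 2 ν) :
    ‖∫ x, F x ∂ν‖ ^ 2 ≤ ∫ x, ‖F x‖ ^ 2 ∂ν := by
  have h := integral_norm_sub_const_sq hF (∫ x, F x ∂ν)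
  rw [real_inner_self_eq_norm_sq] at h
  have : 0 ≤ ∫ x, ‖F x - ∫ x, F x ∂ν‖ ^ 2 ∂ν := integral_nonneg fun x => sq_nonneg _
  linarith

theorem integral_norm_sq_sub_norm_integral_sq_le (hF : MemLp F 2 ν) (c : H) :
    ∫ x, ‖F x‖ ^ 2 ∂ν - ‖∫ x, F x ∂ν‖ ^ 2 ≤ ∫ x, ‖F x - c‖ ^ 2 ∂ν := by
  rw [integral_norm_sub_const_sq hF]
  have := sq_nonneg ‖(∫ x, F x ∂ν) - c‖
  rw [norm_sub_sq_real] at this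
  linarith

end Probability

variable [Fintype ι] [DecidableEq ι] {μ : ∀ i, Measure (X i)} [∀ i, IsProbabilityMeasure (μ i)]

variable (μ) in
theorem measurePreserving_piecewise (S : Finset ι) :
    MeasurePreserving (fun z : (∀ i, X i) × (∀ i, X i) => S.piecewise z.2 z.1)
      ((Measure.pi μ).prod (Measure.pi μ)) (Measure.pi μ) := by
  have hmeas : Measurable fun z : (∀ i, X i) × (∀ i, X i) => S.piecewise z.2 z.1 := by
    refine measurable_pi_lambda _ fun i => ?_
    by_cases hi : i ∈ S <;> simp only [Finset.piecewise, hi, if_true, if_false] <;> fun_prop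
  refine ⟨hmeas, (Measure.pi_eq fun s hs => ?_).symm⟩
  have hpre : (fun z : (∀ i, X i) × (∀ i, X i) => S.piecewise z.2 z.1) ⁻¹' Set.univ.pi s =
      (Set.univ.pi fun i => if i ∈ S then Set.univ else s i) ×ˢ
        (Set.univ.pi fun i => if i ∈ S then s i else Set.univ) := by
    ext z
    simp only [Set.mem_preimage, Set.mem_univ_pi, Set.mem_prod, ← forall_and]
    refine forall_congr' fun i => ?_
    by_cases hi : i ∈ S <;> simp [hi]
  rw [Measure.map_apply hmeas (MeasurableSet.univ_pi hs), hpre, Measure.prod_prod,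
    Measure.pi_pi, Measure.pi_pi, ← Finset.prod_mul_distrib]
  refine Finset.prod_congr rfl fun i _ => ?_
  by_cases hi : i ∈ S <;> simp [hi]

theorem lintegral_eq_lintegral_piecewise {F : (∀ i, X i) → ENNReal} (hF : Measurable F)
    (S : Finset ι) :
    ∫⁻ x, F x ∂(Measure.pi μ) =
      ∫⁻ x, ∫⁻ y, F (S.piecewise y x) ∂(Measure.pi μ) ∂(Measure.pi μ) := by
  have h := measurePreserving_piecewise μ S
  rw [← h.lintegral_comp hF, lintegral_prod]
  exact (hF.comp h.measurable).aemeasurable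

theorem ae_integrable_piecewise {F : (∀ i, X i) → H} (hF : Integrable F (Measure.pi μ))
    (S : Finset ι) :
    ∀ᵐ x ∂(Measure.pi μ), Integrable (fun y => F (S.piecewise y x)) (Measure.pi μ) :=
  ((measurePreserving_piecewise μ S).integrable_comp_of_integrable hF).prod_right_ae

theorem ae_memLp_two_piecewise {F : (∀ i, X i) → H} (hF : MemLp F 2 (Measure.pi μ))
    (S : Finset ι) :
    ∀ᵐ x ∂(Measure.pi μ), MemLp (fun y => F (S.piecewise y x)) 2 (Measure.pi μ) := by
  filter_upwards [ae_integrable_piecewise (hF.integrable one_le_two) S,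
    ae_integrable_piecewise hF.integrable_norm_pow' S] with x hx hx2
  exact (memLp_two_iff_integrable_sq_norm hx.aestronglyMeasurable).2 hx2

section NormedSpace

variable [NormedSpace ℝ H]

variable (μ) in
/-- The function obtained from `F` by integrating out the coordinates in `S`, that is, the
conditional expectation of `F` given the other coordinates; as a function on the whole product it
does not depend on the coordinates in `S`. -/
noncomputable def margOn (S : Finset ι) (F : (∀ i, X i) → H) (x : ∀ i, X i) : H :=
  ∫ y, F (S.piecewise y x) ∂(Measure.pi μ)

theorem margOn_empty [CompleteSpace H] (F : (∀ i, X i) → H) : margOn μ ∅ F = F := by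
  ext x
  simp [margOn]

omit [∀ i, IsProbabilityMeasure (μ i)] in
theorem margOn_univ (F : (∀ i, X i) → H) (x : ∀ i, X i) :
    margOn μ Finset.univ F x = ∫ y, F y ∂(Measure.pi μ) := by
  simp [margOn]

theorem integrable_margOn {F : (∀ i, X i) → H} (hF : Integrable F (Measure.pi μ))
    (S : Finset ι) : Integrable (margOn μ S F) (Measure.pi μ) :=
  ((measurePreserving_piecewise μ S).integrable_comp_of_integrable hF).integral_prod_left

theorem integral_margOn {F : (∀ i, X i) → H} (hF : Integrable F (Measure.pi μ))
    (S : Finset ι) : ∫ x, margOn μ S F x ∂(Measure.pi μ) = ∫ x, F x ∂(Measure.pi μ) := by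
  have h := measurePreserving_piecewise μ S
  have hFm : AEStronglyMeasurable F
      (((Measure.pi μ).prod (Measure.pi μ)).map fun z => S.piecewise z.2 z.1) := by
    rw [h.map_eq]
    exact hF.aestronglyMeasurable
  calc ∫ x, margOn μ S F x ∂(Measure.pi μ)
      = ∫ z, F (S.piecewise z.2 z.1) ∂((Measure.pi μ).prod (Measure.pi μ)) :=
        (integral_prod _ (h.integrable_comp_of_integrable hF)).symm
    _ = ∫ x, F x ∂(((Measure.pi μ).prod (Measure.pi μ)).map fun z => S.piecewise z.2 z.1) :=
        (integral_map h.aemeasurable hFm).symm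
    _ = ∫ x, F x ∂(Measure.pi μ) := by rw [h.map_eq]

theorem margOn_margOn_ae_eq {F : (∀ i, X i) → H} (hF : Integrable F (Measure.pi μ))
    (S T : Finset ι) : margOn μ T (margOn μ S F) =ᵐ[Measure.pi μ] margOn μ (S ∪ T) F := by
  filter_upwards [ae_integrable_piecewise hF (S ∪ T)] with x hx
  rw [margOn, margOn, ← integral_margOn hx S]
  refine integral_congr_ae (Eventually.of_forall fun z => integral_congr_ae
    (Eventually.of_forall fun y => congrArg F (funext fun i => ?_)))
  by_cases hS : i ∈ S <;> by_cases hT : i ∈ T <;> simp [Finset.piecewise, hS, hT]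

end NormedSpace

section InnerProductSpace

variable [InnerProductSpace ℝ H] [CompleteSpace H] {F : (∀ i, X i) → H}

theorem ae_norm_margOn_sq_le (hF : MemLp F 2 (Measure.pi μ)) (S : Finset ι) :
    ∀ᵐ x ∂(Measure.pi μ), ‖margOn μ S F x‖ ^ 2 ≤ margOn μ S (fun x => ‖F x‖ ^ 2) x := by
  filter_upwards [ae_memLp_two_piecewise hF S] with x hx
  exact norm_integral_sq_le hx

theorem memLp_two_margOn (hF : MemLp F 2 (Measure.pi μ)) (S : Finset ι) :
    MemLp (margOn μ S F) 2 (Measure.pi μ) := by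
  have hmeas := (integrable_margOn (hF.integrable one_le_two) S).aestronglyMeasurable
  refine (memLp_two_iff_integrable_sq_norm hmeas).2
    ((integrable_margOn hF.integrable_norm_pow' S).mono' (hmeas.norm.pow 2) ?_)
  filter_upwards [ae_norm_margOn_sq_le hF S] with x hx
  rwa [Real.norm_of_nonneg (sq_nonneg _)]

theorem integral_norm_margOn_sq_le (hF : MemLp F 2 (Measure.pi μ)) (S : Finset ι) :
    ∫ x, ‖margOn μ S F x‖ ^ 2 ∂(Measure.pi μ) ≤ ∫ x, ‖F x‖ ^ 2 ∂(Measure.pi μ) := by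
  rw [← integral_margOn hF.integrable_norm_pow' S]
  exact integral_mono_ae (memLp_two_margOn hF S).integrable_norm_pow'
    (integrable_margOn hF.integrable_norm_pow' S) (ae_norm_margOn_sq_le hF S)

theorem integral_norm_sq_sub_margOn_le {K : (∀ i, X i) → H} (hF : MemLp F 2 (Measure.pi μ))
    (hK : MemLp K 2 (Measure.pi μ)) (S : Finset ι) (hKS : ∀ x y, K (S.piecewise y x) = K x) :
    ∫ x, ‖F x‖ ^ 2 ∂(Measure.pi μ) - ∫ x, ‖margOn μ S F x‖ ^ 2 ∂(Measure.pi μ) ≤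
      ∫ x, ‖F x - K x‖ ^ 2 ∂(Measure.pi μ) := by
  have hF2 : Integrable (fun x => ‖F x‖ ^ 2) (Measure.pi μ) := hF.integrable_norm_pow'
  have hFK : Integrable (fun x => ‖F x - K x‖ ^ 2) (Measure.pi μ) :=
    (hF.sub hK).integrable_norm_pow'
  have hmarg : Integrable (fun x => ‖margOn μ S F x‖ ^ 2) (Measure.pi μ) :=
    (memLp_two_margOn hF S).integrable_norm_pow'
  rw [← integral_margOn hF2 S, ← integral_margOn hFK S,
    ← integral_sub (integrable_margOn hF2 S) hmarg]
  refine integral_mono_ae ((integrable_margOn hF2 S).sub hmarg) (integrable_margOn hFK S) ?_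
  filter_upwards [ae_memLp_two_piecewise hF S] with x hx
  simp only [margOn, hKS]
  exact integral_norm_sq_sub_norm_integral_sq_le hx (K x)

theorem integral_norm_margOn_sq_sub_union_le {G : (∀ i, X i) → H}
    (hF : MemLp F 2 (Measure.pi μ)) (hG : MemLp G 2 (Measure.pi μ)) (S T : Finset ι)
    (hGT : DependsOn G (T : Set ι)ᶜ) :
    ∫ x, ‖margOn μ S F x‖ ^ 2 ∂(Measure.pi μ) - ∫ x, ‖margOn μ (S ∪ T) F x‖ ^ 2 ∂(Measure.pi μ) ≤
      ∫ x, ‖F x - G x‖ ^ 2 ∂(Measure.pi μ) := by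
  have hunion : ∫ x, ‖margOn μ T (margOn μ S F) x‖ ^ 2 ∂(Measure.pi μ) =
      ∫ x, ‖margOn μ (S ∪ T) F x‖ ^ 2 ∂(Measure.pi μ) :=
    integral_congr_ae
      ((margOn_margOn_ae_eq (hF.integrable one_le_two) S T).fun_comp fun v => ‖v‖ ^ 2)
  have hsub : ∫ x, ‖margOn μ S F x - margOn μ S G x‖ ^ 2 ∂(Measure.pi μ) =
      ∫ x, ‖margOn μ S (F - G) x‖ ^ 2 ∂(Measure.pi μ) := by
    refine integral_congr_ae ?_
    filter_upwards [ae_integrable_piecewise (hF.integrable one_le_two) S,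
      ae_integrable_piecewise (hG.integrable one_le_two) S] with x hFx hGx
    simp only [margOn, Pi.sub_apply, integral_sub hFx hGx]
  have hmargT : ∀ x y, margOn μ S G (T.piecewise y x) = margOn μ S G x := fun x y =>
    integral_congr_ae (Eventually.of_forall fun z => hGT fun i hi => by
      simp only [Set.mem_compl_iff, Finset.mem_coe] at hi
      simp [Finset.piecewise, hi])
  calc _ ≤ ∫ x, ‖margOn μ S F x - margOn μ S G x‖ ^ 2 ∂(Measure.pi μ) := by
        rw [← hunion]
        exact integral_norm_sq_sub_margOn_le (memLp_two_margOn hF S) (memLp_two_margOn hG S) T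
          hmargT
    _ ≤ _ := hsub.trans_le (integral_norm_margOn_sq_le (hF.sub hG) S)

omit [DecidableEq ι] in
/-- The Efron–Stein inequality for blocks of coordinates, the blocks being the fibres of `β`. -/
theorem integral_norm_sub_integral_sq_le_sum {κ : Type*} [Fintype κ] (β : ι → κ)
    {G : κ → (∀ i, X i) → H} (hF : MemLp F 2 (Measure.pi μ))
    (hG : ∀ c, MemLp (G c) 2 (Measure.pi μ)) (hGβ : ∀ c, DependsOn (G c) {i | β i ≠ c}) :
    ∫ x, ‖F x - ∫ y, F y ∂(Measure.pi μ)‖ ^ 2 ∂(Measure.pi μ) ≤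
      ∑ c, ∫ x, ‖F x - G c x‖ ^ 2 ∂(Measure.pi μ) := by
  classical
  have htel : ∀ s : Finset κ, ∫ x, ‖F x‖ ^ 2 ∂(Measure.pi μ) -
      ∫ x, ‖margOn μ {i | β i ∈ s} F x‖ ^ 2 ∂(Measure.pi μ) ≤
      ∑ c ∈ s, ∫ x, ‖F x - G c x‖ ^ 2 ∂(Measure.pi μ) := by
    intro s
    induction s using Finset.induction_on with
    | empty => simp [margOn_empty]
    | insert c s hc ih =>
      have hunion : ({i | β i ∈ insert c s} : Finset ι) =
          ({i | β i ∈ s} : Finset ι) ∪ ({i | β i = c} : Finset ι) := by ext; simp [or_comm]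
      rw [Finset.sum_insert hc, hunion]
      linarith [integral_norm_margOn_sq_sub_union_le hF (hG c) {i | β i ∈ s} {i | β i = c}
        (by simpa [Set.compl_ofPred] using hGβ c)]
  have h := htel Finset.univ
  rw [integral_norm_sub_const_sq hF, real_inner_self_eq_norm_sq]
  have huniv : ({i | β i ∈ (Finset.univ : Finset κ)} : Finset ι) = Finset.univ := by simp
  simp only [huniv, margOn_univ, integral_const, probReal_univ, one_smul] at h
  linarith

end InnerProductSpace

end EfronStein

section LinearForm

variable {Ω ι : Type*} [MeasurableSpace Ω] {P : Measure Ω}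
  {H : Type*} [NormedAddCommGroup H]

theorem integrable_norm_pow_of_memLp_four [IsFiniteMeasure P] {f : Ω → H} (hf : MemLp f 4 P)
    {k : ℕ} (hk : k ≤ 4) : Integrable (fun ω => ‖f ω‖ ^ k) P :=
  (hf.mono_exponent (p := (k : ENNReal)) (by exact_mod_cast hk)).integrable_norm_pow'

theorem integrable_pow_of_memLp_four [IsFiniteMeasure P] {f : Ω → ℝ} (hf : MemLp f 4 P)
    {k : ℕ} (hk : k ≤ 4) : Integrable (fun ω => f ω ^ k) P :=
  (integrable_norm_iff (hf.1.pow k)).1 (by simpa using integrable_norm_pow_of_memLp_four hf hk)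

theorem integrable_and_integral_mul_of_indepFun {Y Z : Type*} [MeasurableSpace Y]
    [MeasurableSpace Z] {A : Ω → Y} {B : Ω → Z} (hAB : IndepFun A B P) {φ : Y → ℝ} {ψ : Z → ℝ}
    (hφ : Measurable φ) (hψ : Measurable ψ) (hφA : Integrable (fun ω => φ (A ω)) P)
    (hψB : Integrable (fun ω => ψ (B ω)) P) :
    Integrable (fun ω => φ (A ω) * ψ (B ω)) P ∧
      ∫ ω, φ (A ω) * ψ (B ω) ∂P = (∫ ω, φ (A ω) ∂P) * ∫ ω, ψ (B ω) ∂P :=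
  ⟨(hAB.comp hφ hψ).integrable_mul hφA hψB,
    (hAB.comp hφ hψ).integral_fun_mul_eq_mul_integral hφA.1 hψB.1⟩

variable [InnerProductSpace ℝ H]

theorem norm_add_smul_pow_four_le (A a : H) (y : ℝ) :
    ‖A + y • a‖ ^ 4 ≤ ‖A‖ ^ 4 + 6 * ‖a‖ ^ 2 * (‖A‖ ^ 2 * y ^ 2) + ‖a‖ ^ 4 * y ^ 4 +
      4 * (‖A‖ ^ 2 * inner ℝ A a * y) + 4 * ‖a‖ ^ 2 * (inner ℝ A a * y ^ 3) := by
  have hsq : ‖A + y • a‖ ^ 2 = ‖A‖ ^ 2 + 2 * y * inner ℝ A a + y ^ 2 * ‖a‖ ^ 2 := by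
    rw [norm_add_sq_real, inner_smul_right, norm_smul, mul_pow, Real.norm_eq_abs, sq_abs]
    ring
  have hcs : inner ℝ A a ^ 2 ≤ ‖A‖ ^ 2 * ‖a‖ ^ 2 := by
    rw [← mul_pow, ← sq_abs]
    gcongr
    exact abs_real_inner_le_norm A a
  calc ‖A + y • a‖ ^ 4 = (‖A‖ ^ 2 + 2 * y * inner ℝ A a + y ^ 2 * ‖a‖ ^ 2) ^ 2 := by
        rw [← hsq]; ring
    _ ≤ _ := by nlinarith [mul_le_mul_of_nonneg_left hcs (sq_nonneg y)]

theorem integrable_norm_sq_mul_inner [IsFiniteMeasure P] {A : Ω → H} (hA : MemLp A 4 P) (a : H) :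
    Integrable (fun ω => ‖A ω‖ ^ 2 * inner ℝ (A ω) a) P := by
  refine ((integrable_norm_pow_of_memLp_four hA (k := 3) (by norm_num)).mul_const ‖a‖).mono'
    ((hA.1.norm.pow 2).mul (hA.inner_const a).1) (Eventually.of_forall fun ω => ?_)
  rw [norm_mul, norm_pow, norm_norm, Real.norm_eq_abs]
  calc _ ≤ ‖A ω‖ ^ 2 * (‖A ω‖ * ‖a‖) := by gcongr; exact abs_real_inner_le_norm _ _
    _ = ‖A ω‖ ^ 3 * ‖a‖ := by ring

section Step

variable [IsProbabilityMeasure P] [MeasurableSpace H] [BorelSpace H] {A : Ω → H} {y : Ω → ℝ}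

theorem integral_norm_add_smul_sq_of_indepFun (hA : MemLp A 2 P) (hy : MemLp y 2 P)
    (hAy : IndepFun A y P) (hy0 : ∫ ω, y ω ∂P = 0) (a : H) :
    ∫ ω, ‖A ω + y ω • a‖ ^ 2 ∂P =
      ∫ ω, ‖A ω‖ ^ 2 ∂P + ‖a‖ ^ 2 * ∫ ω, y ω ^ 2 ∂P := by
  have hinner : MemLp (fun ω => inner ℝ (A ω) a) 2 P := hA.inner_const a
  obtain ⟨hint, hcross⟩ := integrable_and_integral_mul_of_indepFun hAy
    (φ := fun v => inner ℝ v a) (continuous_id.inner continuous_const).measurable measurable_id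
    (hinner.integrable one_le_two) (hy.integrable one_le_two)
  simp only [id_eq, hy0, mul_zero] at hint hcross
  have hexp : ∀ ω, ‖A ω + y ω • a‖ ^ 2 =
      ‖A ω‖ ^ 2 + 2 * (inner ℝ (A ω) a * y ω) + ‖a‖ ^ 2 * y ω ^ 2 := fun ω => by
    rw [norm_add_sq_real, inner_smul_right, norm_smul, mul_pow, Real.norm_eq_abs, sq_abs]
    ring
  have hA2 : Integrable (fun ω => ‖A ω‖ ^ 2) P := hA.integrable_norm_pow'
  have hsum : Integrable (fun ω => ‖A ω‖ ^ 2 + 2 * (inner ℝ (A ω) a * y ω)) P := 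
    hA2.add (hint.const_mul 2)
  simp only [hexp]
  rw [integral_add hsum (hy.integrable_sq.const_mul _), integral_add hA2 (hint.const_mul 2),
    integral_const_mul, integral_const_mul, hcross]
  ring

theorem integral_norm_add_smul_pow_four_le_of_indepFun [CompleteSpace H] (hA : MemLp A 4 P)
    (hy : MemLp y 4 P) (hAy : IndepFun A y P) (hA0 : ∫ ω, A ω ∂P = 0) (hy0 : ∫ ω, y ω ∂P = 0)
    (a : H) :
    ∫ ω, ‖A ω + y ω • a‖ ^ 4 ∂P ≤ ∫ ω, ‖A ω‖ ^ 4 ∂P +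
      6 * ‖a‖ ^ 2 * ((∫ ω, ‖A ω‖ ^ 2 ∂P) * ∫ ω, y ω ^ 2 ∂P) + ‖a‖ ^ 4 * ∫ ω, y ω ^ 4 ∂P := by
  have hinner : Integrable (fun ω => inner ℝ (A ω) a) P :=
    (hA.inner_const a).integrable (by norm_num)
  have hinner0 : ∫ ω, inner ℝ (A ω) a ∂P = 0 := by
    simp only [real_inner_comm a, integral_inner (hA.integrable (by norm_num)), hA0,
      inner_zero_right]
  have hmeas : Measurable fun v : H => inner ℝ v a :=
    (continuous_id.inner continuous_const).measurable
  have hmeas2 : Measurable fun v : H => ‖v‖ ^ 2 := (continuous_norm.pow 2).measurable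
  obtain ⟨i22, h22⟩ := integrable_and_integral_mul_of_indepFun hAy (ψ := fun r => r ^ 2) hmeas2
    (by fun_prop) (integrable_norm_pow_of_memLp_four hA (by norm_num))
    (integrable_pow_of_memLp_four hy (by norm_num))
  obtain ⟨i31, h31⟩ := integrable_and_integral_mul_of_indepFun hAy (ψ := fun r => r)
    (hmeas2.mul hmeas) measurable_id (integrable_norm_sq_mul_inner hA a)
    (hy.integrable (by norm_num))
  obtain ⟨i13, h13⟩ := integrable_and_integral_mul_of_indepFun hAy (ψ := fun r => r ^ 3) hmeas
    (by fun_prop) hinner (integrable_pow_of_memLp_four hy (by norm_num))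
  simp only [hy0, hinner0, mul_zero, zero_mul, Pi.mul_apply] at i31 h31 h13
  have i40 : Integrable (fun ω => ‖A ω‖ ^ 4) P := integrable_norm_pow_of_memLp_four hA le_rfl
  have i04 : Integrable (fun ω => ‖a‖ ^ 4 * y ω ^ 4) P :=
    (integrable_pow_of_memLp_four hy le_rfl).const_mul _
  have i1 := i40.add (i22.const_mul (6 * ‖a‖ ^ 2))
  have i2 := (i1.add i04).add (i31.const_mul 4)
  refine (integral_mono_of_nonneg (Eventually.of_forall fun ω => by positivity)
    (i2.add (i13.const_mul (4 * ‖a‖ ^ 2)))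
    (Eventually.of_forall fun ω => norm_add_smul_pow_four_le (A ω) a (y ω))).trans_eq ?_
  rw [integral_add' i2 (i13.const_mul _), integral_add' (i1.add i04) (i31.const_mul 4),
    integral_add' i1 i04, integral_add' i40 (i22.const_mul _)]
  simp only [integral_const_mul, h31, h13, h22, mul_zero, add_zero]

end Step

section Sum

variable {Y : ι → Ω → ℝ} {T : Finset ι} (c : ι → H)

theorem memLp_sum_smul {q : ENNReal} (hY : ∀ i ∈ T, MemLp (Y i) q P) :
    MemLp (fun ω => ∑ i ∈ T, Y i ω • c i) q P :=
  memLp_finsetSum T fun i hi =>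
    (ContinuousLinearMap.toSpanSingleton ℝ (c i)).comp_memLp' (hY i hi)

theorem integral_sum_smul_eq_zero [CompleteSpace H] (hY : ∀ i ∈ T, Integrable (Y i) P)
    (h0 : ∀ i ∈ T, ∫ ω, Y i ω ∂P = 0) : ∫ ω, ∑ i ∈ T, Y i ω • c i ∂P = 0 := by
  rw [integral_finsetSum T fun i hi => (hY i hi).smul_const (c i)]
  exact Finset.sum_eq_zero fun i hi => by rw [integral_smul_const, h0 i hi, zero_smul]

theorem indepFun_sum_smul [MeasurableSpace H] [BorelSpace H] (hm : ∀ i, Measurable (Y i))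
    (hind : iIndepFun Y P) {p : ι} (hp : p ∉ T) :
    IndepFun (fun ω => ∑ i ∈ T, Y i ω • c i) (Y p) P := by
  classical
  have hpair := hind.indepFun_finset T {p} (Finset.disjoint_singleton_right.2 hp) hm
  have hcont : Continuous fun z : T → ℝ => ∑ i, z i • c i := by fun_prop
  have h := hpair.comp hcont.measurable
    (measurable_pi_apply (⟨p, Finset.mem_singleton_self p⟩ : ({p} : Finset ι)))
  convert! h using 1
  ext ω
  exact (Finset.sum_coe_sort T fun i => Y i ω • c i).symm

theorem integral_norm_sum_smul_sq [IsProbabilityMeasure P] (hm : ∀ i, Measurable (Y i))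
    (hind : iIndepFun Y P) (hY : ∀ i ∈ T, MemLp (Y i) 2 P)
    (h0 : ∀ i ∈ T, ∫ ω, Y i ω ∂P = 0) :
    ∫ ω, ‖∑ i ∈ T, Y i ω • c i‖ ^ 2 ∂P = ∑ i ∈ T, ‖c i‖ ^ 2 * ∫ ω, Y i ω ^ 2 ∂P := by
  borelize H
  induction T using Finset.cons_induction with
  | empty => simp
  | cons p T hp ih =>
    rw [Finset.forall_mem_cons] at hY h0
    simp only [Finset.sum_cons, add_comm (_ • c p), add_comm (‖c p‖ ^ 2 * _)]
    rw [integral_norm_add_smul_sq_of_indepFun (memLp_sum_smul c hY.2) hY.1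
      (indepFun_sum_smul c hm hind hp) h0.1, ih hY.2 h0.2]

theorem integral_norm_sum_smul_pow_four_le [IsProbabilityMeasure P] [CompleteSpace H]
    (hm : ∀ i, Measurable (Y i)) (hind : iIndepFun Y P) {s M : ℝ} (hY : ∀ i ∈ T, MemLp (Y i) 4 P)
    (h0 : ∀ i ∈ T, ∫ ω, Y i ω ∂P = 0) (h2 : ∀ i ∈ T, ∫ ω, Y i ω ^ 2 ∂P ≤ s)
    (h4 : ∀ i ∈ T, ∫ ω, Y i ω ^ 4 ∂P ≤ M) :
    ∫ ω, ‖∑ i ∈ T, Y i ω • c i‖ ^ 4 ∂P ≤ (3 * s ^ 2 + M) * (∑ i ∈ T, ‖c i‖ ^ 2) ^ 2 := by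
  borelize H
  induction T using Finset.cons_induction with
  | empty => simp
  | cons p T hp ih =>
    rw [Finset.forall_mem_cons] at hY h0 h2 h4
    have hs : 0 ≤ s := (integral_nonneg fun ω => sq_nonneg (Y p ω)).trans h2.1
    have hM : 0 ≤ M := (integral_nonneg fun ω => by positivity).trans h4.1
    set τ := ∑ i ∈ T, ‖c i‖ ^ 2
    have hτ : 0 ≤ τ := by positivity
    have hsecond : ∫ ω, ‖∑ i ∈ T, Y i ω • c i‖ ^ 2 ∂P ≤ s * τ := by
      rw [integral_norm_sum_smul_sq c hm hind
        (fun i hi => (hY.2 i hi).mono_exponent (by norm_num)) h0.2, Finset.mul_sum]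
      exact Finset.sum_le_sum fun i hi => by
        rw [mul_comm]
        gcongr
        exact h2.2 i hi
    simp only [Finset.sum_cons, add_comm (_ • c p)]
    calc _ ≤ ∫ ω, ‖∑ i ∈ T, Y i ω • c i‖ ^ 4 ∂P + 6 * ‖c p‖ ^ 2 *
          ((∫ ω, ‖∑ i ∈ T, Y i ω • c i‖ ^ 2 ∂P) * ∫ ω, Y p ω ^ 2 ∂P) +
          ‖c p‖ ^ 4 * ∫ ω, Y p ω ^ 4 ∂P :=
          integral_norm_add_smul_pow_four_le_of_indepFun (memLp_sum_smul c hY.2) hY.1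
            (indepFun_sum_smul c hm hind hp)
            (integral_sum_smul_eq_zero c (fun i hi => (hY.2 i hi).integrable (by norm_num)) h0.2)
            h0.1 (c p)
      _ ≤ (3 * s ^ 2 + M) * τ ^ 2 + 6 * ‖c p‖ ^ 2 * (s * τ * s) + ‖c p‖ ^ 4 * M := by
          gcongr
          exacts [ih hY.2 h0.2 h2.2 h4.2, h2.1, h4.1]
      _ ≤ (3 * s ^ 2 + M) * (‖c p‖ ^ 2 + τ) ^ 2 := by
          have h1 : 0 ≤ s ^ 2 * ‖c p‖ ^ 4 := by positivity
          have h2 : 0 ≤ M * (τ * ‖c p‖ ^ 2) := mul_nonneg hM (mul_nonneg hτ (sq_nonneg _))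
          nlinarith

end Sum

section Product

variable [Fintype ι] {μ : ι → Measure ℝ}
  [∀ i, IsProbabilityMeasure (μ i)]

theorem integral_eval_pi {E : Type*} [NormedAddCommGroup E] [NormedSpace ℝ E] (p : ι) {g : ℝ → E}
    (hg : AEStronglyMeasurable g (μ p)) :
    ∫ x, g (x p) ∂(Measure.pi μ) = ∫ r, g r ∂(μ p) := by
  have hev := measurePreserving_eval μ p
  rw [← hev.map_eq] at hg ⊢
  exact (integral_map hev.aemeasurable hg).symm

/-- The coefficients depend only on the coordinates outside `S`, which contains those in the linear
form: conditionally on the former, this is `integral_norm_sum_smul_pow_four_le`. -/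
theorem lintegral_norm_sum_smul_pow_four_le [CompleteSpace H] {κ : Type*} {e : κ → ι}
    (he : Function.Injective e)
    (T : Finset κ) (S : Finset ι) (hS : ∀ k ∈ T, e k ∈ S) {c : κ → (ι → ℝ) → H}
    (hcm : ∀ k, StronglyMeasurable (c k)) (hc : ∀ k ∈ T, DependsOn (c k) (S : Set ι)ᶜ)
    (hc1 : ∀ x, ∑ k ∈ T, ‖c k x‖ ^ 2 ≤ 1) {s M : ℝ} (hM : 0 ≤ M)
    (hL : ∀ k ∈ T, MemLp id 4 (μ (e k))) (h0 : ∀ k ∈ T, ∫ r, r ∂(μ (e k)) = 0)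
    (h2 : ∀ k ∈ T, ∫ r, r ^ 2 ∂(μ (e k)) ≤ s) (h4 : ∀ k ∈ T, ∫ r, r ^ 4 ∂(μ (e k)) ≤ M) :
    ∫⁻ x, ENNReal.ofReal (‖∑ k ∈ T, x (e k) • c k x‖ ^ 4) ∂(Measure.pi μ) ≤
      ENNReal.ofReal (3 * s ^ 2 + M) := by
  classical
  have hmeas : Measurable fun x => ENNReal.ofReal (‖∑ k ∈ T, x (e k) • c k x‖ ^ 4) :=
    (((Finset.stronglyMeasurable_fun_sum T fun k _ => StronglyMeasurable.smul
      (measurable_pi_apply (e k)).stronglyMeasurable (hcm k)).norm.measurable).pow_const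
        4).ennreal_ofReal
  rw [lintegral_eq_lintegral_piecewise hmeas S]
  have hsection : ∀ x : ι → ℝ, ∫⁻ y, ENNReal.ofReal (‖∑ k ∈ T, S.piecewise y x (e k) •
      c k (S.piecewise y x)‖ ^ 4) ∂(Measure.pi μ) ≤ ENNReal.ofReal (3 * s ^ 2 + M) := by
    intro x
    have hsum : ∀ y : ι → ℝ, ∑ k ∈ T, S.piecewise y x (e k) • c k (S.piecewise y x) =
        ∑ k ∈ T, y (e k) • c k x := fun y => Finset.sum_congr rfl fun k hk => by
      rw [Finset.piecewise_eq_of_mem _ _ _ (hS k hk), hc k hk fun i hi =>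
        Finset.piecewise_eq_of_notMem _ _ _ (by simpa using hi)]
    have hLy : ∀ k ∈ T, MemLp (fun y : ι → ℝ => y (e k)) 4 (Measure.pi μ) := fun k hk =>
      (hL k hk).comp_measurePreserving (measurePreserving_eval μ (e k))
    have hind : iIndepFun (fun k (y : ι → ℝ) => y (e k)) (Measure.pi μ) :=
      (iIndepFun_pi (X := fun _ => id) (μ := μ) fun _ => aemeasurable_id).precomp he
    have hmoment : ∫ y, ‖∑ k ∈ T, y (e k) • c k x‖ ^ 4 ∂(Measure.pi μ) ≤
        (3 * s ^ 2 + M) * (∑ k ∈ T, ‖c k x‖ ^ 2) ^ 2 :=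
      integral_norm_sum_smul_pow_four_le (fun k => c k x) (fun k => measurable_pi_apply (e k)) hind
        hLy (fun k hk => (integral_eval_pi (e k) (g := id) (by fun_prop)).trans (h0 k hk))
        (fun k hk => (integral_eval_pi (e k) (g := (· ^ 2)) (by fun_prop)).trans_le (h2 k hk))
        (fun k hk => (integral_eval_pi (e k) (g := (· ^ 4)) (by fun_prop)).trans_le (h4 k hk))
    simp only [hsum]
    rw [← ofReal_integral_eq_lintegral_ofReal
      (integrable_norm_pow_of_memLp_four (memLp_sum_smul _ hLy) le_rfl)
      (Eventually.of_forall fun y => by positivity)]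
    exact ENNReal.ofReal_le_ofReal (hmoment.trans (mul_le_of_le_one_right (by positivity)
      (pow_le_one₀ (by positivity) (hc1 x))))
  exact (lintegral_mono hsection).trans_eq (by simp)

end Product

end LinearForm

section UnitaryGroup

variable {n : Type*}

/-- The matrix `i X`, which generates the unitary group `expI X` of a real symmetric `X`. -/
noncomputable def genI (X : Matrix n n ℝ) : Matrix n n ℂ :=
  Complex.I • X.map Complex.ofReal

theorem genI_apply (X : Matrix n n ℝ) (i j : n) : genI X i j = Complex.I * X i j :=
  rfl

theorem genI_sub (X Y : Matrix n n ℝ) :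
    genI X - genI Y = Complex.I • (X - Y).map Complex.ofReal := by
  ext i j
  simp [genI_apply, mul_sub]

variable [Fintype n] [DecidableEq n]

/-- The unitary group `exp (i t X)` of a real symmetric matrix `X`. -/
noncomputable def expI (X : Matrix n n ℝ) (t : ℝ) : Matrix n n ℂ :=
  NormedSpace.exp (t • genI X)

theorem expI_zero (X : Matrix n n ℝ) : expI X 0 = 1 := by
  simp [expI, NormedSpace.exp_zero]

open scoped Matrix.Norms.Operator in
theorem hasDerivAt_expI_apply (X : Matrix n n ℝ) (t : ℝ) (i j : n) :
    HasDerivAt (fun t => expI X t i j) ((genI X * expI X t) i j) t :=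
  hasDerivAt_pi.1 (hasDerivAt_pi.1 (hasDerivAt_exp_smul_const' (𝕂 := ℝ) (genI X) t) i) j

open scoped Matrix.Norms.Operator in
theorem hasDerivAt_expI_sub_mul_expI_apply (X Y : Matrix n n ℝ) (t u : ℝ) (i j : n) :
    HasDerivAt (fun u => (expI Y (t - u) * expI X u) i j)
      (Complex.I * (expI Y (t - u) * (X - Y).map Complex.ofReal * expI X u) i j) u := by
  have hY : HasDerivAt (fun u => expI Y (t - u)) (-(expI Y (t - u) * genI Y)) u :=
    (hasDerivAt_exp_smul_const (𝕂 := ℝ) (genI Y) (t - u)).comp_const_sub t u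
  have hX : HasDerivAt (expI X) (genI X * expI X u) u :=
    hasDerivAt_exp_smul_const' (𝕂 := ℝ) (genI X) u
  have hderiv : -(expI Y (t - u) * genI Y) * expI X u + expI Y (t - u) * (genI X * expI X u) =
      Complex.I • (expI Y (t - u) * (X - Y).map Complex.ofReal * expI X u) := by
    rw [← Matrix.smul_mul, ← Matrix.mul_smul, ← genI_sub]
    noncomm_ring
  have h := hasDerivAt_pi.1 (hasDerivAt_pi.1 (hY.mul hX) i) j
  rw [hderiv] at h
  exact h

open scoped Matrix.Norms.Operator in
theorem continuous_expI : Continuous fun z : Matrix n n ℝ × ℝ => expI z.1 z.2 := by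
  have hexp : Continuous (NormedSpace.exp : Matrix n n ℂ → Matrix n n ℂ) :=
    NormedSpace.exp_continuous
  refine hexp.comp (continuous_pi fun i => continuous_pi fun j => ?_)
  simp only [Matrix.smul_apply, genI_apply]
  fun_prop

theorem continuous_expI_apply_comp {α : Type*} [TopologicalSpace α] {X : α → Matrix n n ℝ}
    {t : α → ℝ} (hX : Continuous X) (ht : Continuous t) (i j : n) :
    Continuous fun a => expI (X a) (t a) i j :=
  (continuous_expI.comp (hX.prodMk ht)).matrix_elem i j

theorem continuous_expI_apply (X : Matrix n n ℝ) (i j : n) : Continuous fun t => expI X t i j :=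
  continuous_expI_apply_comp continuous_const continuous_id i j

theorem expI_apply_comm {X : Matrix n n ℝ} (hX : X.IsSymm) (t : ℝ) (i j : n) :
    expI X t i j = expI X t j i := by
  have htranspose : (expI X t).transpose = expI X t := by
    rw [expI, ← Matrix.exp_transpose]
    congr 1
    ext a b
    simp [genI_apply, hX.apply a b]
  rw [← Matrix.transpose_apply (expI X t), htranspose]

theorem expI_conjTranspose {X : Matrix n n ℝ} (hX : X.IsSymm) (t : ℝ) :
    (expI X t).conjTranspose = expI X (-t) := by
  rw [expI, ← Matrix.exp_conjTranspose, expI]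
  congr 1
  ext i j
  simp [genI_apply, Matrix.conjTranspose_apply, hX.apply i j]

theorem expI_neg_apply {X : Matrix n n ℝ} (hX : X.IsSymm) (t : ℝ) (i j : n) :
    expI X (-t) i j = star (expI X t i j) := by
  rw [← expI_conjTranspose hX, Matrix.conjTranspose_apply, expI_apply_comm hX]

theorem expI_mul_conjTranspose {X : Matrix n n ℝ} (hX : X.IsSymm) (t : ℝ) :
    expI X t * (expI X t).conjTranspose = 1 := by
  rw [expI_conjTranspose hX, expI, expI,
    ← Matrix.exp_add_of_commute _ _ (((Commute.refl _).smul_left t).smul_right (-t))]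
  simp [NormedSpace.exp_zero]

theorem sum_norm_sq_expI {X : Matrix n n ℝ} (hX : X.IsSymm) (t : ℝ) (i : n) :
    ∑ k, ‖expI X t i k‖ ^ 2 = 1 := by
  have h := congrFun (congrFun (expI_mul_conjTranspose hX t) i) i
  simp only [Matrix.mul_apply, Matrix.conjTranspose_apply, Matrix.one_apply_eq, Complex.star_def,
    Complex.mul_conj'] at h
  exact_mod_cast h

theorem norm_expI_le_one {X : Matrix n n ℝ} (hX : X.IsSymm) (t : ℝ) (i j : n) :
    ‖expI X t i j‖ ≤ 1 := by
  have h : ‖expI X t i j‖ ^ 2 ≤ ∑ k, ‖expI X t i k‖ ^ 2 :=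
    Finset.single_le_sum (f := fun k => ‖expI X t i k‖ ^ 2) (fun k _ => by positivity)
      (Finset.mem_univ j)
  rw [sum_norm_sq_expI hX] at h
  exact (sq_le_one_iff₀ (norm_nonneg _)).1 h

/-- Duhamel's formula `exp (itX) - exp (itY) = i ∫₀ᵗ exp (i(t-u)Y) (X - Y) exp (iuX) du`,
estimated under the integral sign. -/
theorem norm_expI_sub_expI_le {X Y : Matrix n n ℝ} {t : ℝ} (ht : 0 ≤ t) (i j : n) {g : ℝ → ℝ}
    (hg : Continuous g)
    (hb : ∀ u ∈ Set.Icc 0 t, ‖(expI Y (t - u) * (X - Y).map Complex.ofReal * expI X u) i j‖ ≤ g u) :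
    ‖expI X t i j - expI Y t i j‖ ≤ ∫ u in (0 : ℝ)..t, g u := by
  have hcont : Continuous fun u =>
      Complex.I * (expI Y (t - u) * (X - Y).map Complex.ofReal * expI X u) i j := by
    simp only [Matrix.mul_apply]
    refine continuous_const.mul (continuous_finsetSum _ fun k _ =>
      (continuous_finsetSum _ fun l _ => ?_).mul (continuous_expI_apply X k j))
    exact ((continuous_expI_apply Y i l).comp (by fun_prop)).mul continuous_const
  have hduhamel := intervalIntegral.integral_eq_sub_of_hasDerivAt
    (fun u _ => hasDerivAt_expI_sub_mul_expI_apply X Y t u i j) (hcont.intervalIntegrable 0 t)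
  simp only [sub_self, expI_zero, one_mul, sub_zero, mul_one] at hduhamel
  rw [← hduhamel]
  refine intervalIntegral.norm_integral_le_of_norm_le ht ?_ (hg.intervalIntegrable 0 t)
  refine Eventually.of_forall fun u hu => ?_
  rw [norm_mul, Complex.norm_I, one_mul]
  exact hb u ⟨hu.1.le, hu.2⟩

end UnitaryGroup

section ZeroedEntries

variable {n : Type*} [DecidableEq n]

/-- The matrix with row and column `a` replaced by zero. -/
def zeroRow (a : n) (X : Matrix n n ℝ) : Matrix n n ℝ :=
  Matrix.of fun j k => if j = a ∨ k = a then 0 else X j k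

/-- The matrix with the entries `(i, k)` and `(k, i)` replaced by zero. -/
def zeroEntry (i k : n) (X : Matrix n n ℝ) : Matrix n n ℝ :=
  Matrix.of fun a b => if (a = i ∧ b = k) ∨ (a = k ∧ b = i) then 0 else X a b

theorem zeroRow_apply (a : n) (X : Matrix n n ℝ) (j k : n) :
    zeroRow a X j k = if j = a ∨ k = a then 0 else X j k :=
  rfl

theorem zeroEntry_apply (i k : n) (X : Matrix n n ℝ) (a b : n) :
    zeroEntry i k X a b = if (a = i ∧ b = k) ∨ (a = k ∧ b = i) then 0 else X a b :=
  rfl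

theorem zeroRow_isSymm {X : Matrix n n ℝ} (hX : X.IsSymm) (a : n) : (zeroRow a X).IsSymm := by
  ext j k
  simp [zeroRow_apply, or_comm, hX.apply j k]

theorem zeroEntry_isSymm {X : Matrix n n ℝ} (hX : X.IsSymm) (i k : n) :
    (zeroEntry i k X).IsSymm := by
  ext a b
  simp only [zeroEntry_apply, Matrix.transpose_apply, hX.apply a b]
  grind

theorem zeroRow_zeroEntry (i k : n) (X : Matrix n n ℝ) :
    zeroRow i (zeroEntry i k X) = zeroRow i X := by
  ext a b
  simp only [zeroRow_apply, zeroEntry_apply]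
  grind

theorem continuous_zeroRow (a : n) : Continuous (zeroRow a : Matrix n n ℝ → Matrix n n ℝ) := by
  refine continuous_matrix fun j k => ?_
  simp only [zeroRow_apply]
  split_ifs <;> fun_prop

theorem continuous_zeroEntry (i k : n) :
    Continuous (zeroEntry i k : Matrix n n ℝ → Matrix n n ℝ) := by
  refine continuous_matrix fun a b => ?_
  simp only [zeroEntry_apply]
  split_ifs <;> fun_prop

theorem map_sub_zeroEntry_self (X : Matrix n n ℝ) (i : n) :
    (X - zeroEntry i i X).map Complex.ofReal = Matrix.single i i (X i i : ℂ) := by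
  ext a b
  simp only [Matrix.map_apply, Matrix.sub_apply, zeroEntry_apply, Matrix.single_apply,
    Complex.ofReal_sub, apply_ite Complex.ofReal, Complex.ofReal_zero]
  grind

theorem map_sub_zeroEntry {X : Matrix n n ℝ} (hX : X.IsSymm) {i k : n} (hk : k ≠ i) :
    (X - zeroEntry i k X).map Complex.ofReal =
      Matrix.single k i (X k i : ℂ) + Matrix.single i k (X k i : ℂ) := by
  ext a b
  have := hX.apply i k
  simp only [Matrix.map_apply, Matrix.sub_apply, zeroEntry_apply, Matrix.add_apply,
    Matrix.single_apply, Complex.ofReal_sub, apply_ite Complex.ofReal, Complex.ofReal_zero]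
  grind

variable [Fintype n]

theorem expI_zeroRow_self {X : Matrix n n ℝ} (a : n) (t : ℝ) (j : n) :
    expI (zeroRow a X) t a j = if a = j then 1 else 0 := by
  have hderiv : ∀ t, HasDerivAt (fun t => expI (zeroRow a X) t a j) 0 t := fun t => by
    convert hasDerivAt_expI_apply (zeroRow a X) t a j using 1
    simp [Matrix.mul_apply, genI_apply, zeroRow_apply]
  have hconst : expI (zeroRow a X) t a j = expI (zeroRow a X) 0 a j :=
    is_const_of_deriv_eq_zero (fun t => (hderiv t).differentiableAt) (fun t => (hderiv t).deriv) t 0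
  rw [hconst, expI_zero, Matrix.one_apply]

theorem expI_zeroRow_of_ne {X : Matrix n n ℝ} (hX : X.IsSymm) {a i : n} (hi : i ≠ a) (t : ℝ) :
    expI (zeroRow a X) t i a = 0 := by
  rw [expI_apply_comm (zeroRow_isSymm hX a), expI_zeroRow_self, if_neg hi.symm]

/-- The linear form in the entries of column `a` of `X` whose coefficients are the entries of row
`i` of the unitary group of `zeroRow a X`, a matrix that does not involve column `a`. -/
noncomputable def rowForm (a : n) (X : Matrix n n ℝ) (i : n) (v : ℝ) : ℂ :=
  ∑ k, X k a • expI (zeroRow a X) v i k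

/-- The time integral of `‖rowForm a X i ·‖` over `[0, t]`. -/
noncomputable def rowIntegral (a : n) (X : Matrix n n ℝ) (i : n) (t : ℝ) : ℝ :=
  ∫ v in (0 : ℝ)..t, ‖rowForm a X i v‖

theorem continuous_rowForm_comp {α : Type*} [TopologicalSpace α] {X : α → Matrix n n ℝ}
    {v : α → ℝ} (hX : Continuous X) (hv : Continuous v) (a i : n) :
    Continuous fun z => rowForm a (X z) i (v z) :=
  continuous_finsetSum _ fun k _ => (hX.matrix_elem k a).smul
    (continuous_expI_apply_comp ((continuous_zeroRow a).comp hX) hv i k)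

theorem continuous_rowForm (a : n) (X : Matrix n n ℝ) (i : n) : Continuous (rowForm a X i) :=
  continuous_rowForm_comp continuous_const continuous_id a i

theorem rowIntegral_mono (a : n) (X : Matrix n n ℝ) (i : n) {u t : ℝ} (hu : 0 ≤ u) (hut : u ≤ t) :
    rowIntegral a X i u ≤ rowIntegral a X i t :=
  intervalIntegral.integral_mono_interval le_rfl hu hut
    (Eventually.of_forall fun _ => norm_nonneg _)
    ((continuous_rowForm a X i).norm.intervalIntegrable _ _)

theorem integral_norm_rowForm_sub (a : n) (X : Matrix n n ℝ) (i : n) (t : ℝ) :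
    ∫ u in (0 : ℝ)..t, ‖rowForm a X i (t - u)‖ = rowIntegral a X i t := by
  rw [intervalIntegral.integral_comp_sub_left (fun v => ‖rowForm a X i v‖), sub_self, sub_zero,
    rowIntegral]

theorem expI_zeroRow_mul_sub {X : Matrix n n ℝ} (hX : X.IsSymm) {a i : n} (hi : i ≠ a) (j : n)
    (w u : ℝ) :
    (expI (zeroRow a X) w * (X - zeroRow a X).map Complex.ofReal * expI X u) i j =
      rowForm a X i w * expI X u a j := by
  rw [Matrix.mul_apply, Finset.sum_eq_single a _ (by simp)]
  · congr 1
    simp [Matrix.mul_apply, rowForm, zeroRow_apply, mul_comm]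
  · intro l _ hl
    rw [Matrix.mul_apply, Finset.sum_eq_single a _ (by simp), expI_zeroRow_of_ne hX hi]
    · simp
    · intro k _ hk
      simp [zeroRow_apply, hk, hl]

theorem norm_expI_apply_le_rowIntegral {X : Matrix n n ℝ} (hX : X.IsSymm) {a i : n} (hi : i ≠ a)
    {t : ℝ} (ht : 0 ≤ t) : ‖expI X t i a‖ ≤ rowIntegral a X i t := by
  have h := norm_expI_sub_expI_le (X := X) (Y := zeroRow a X) ht i a
    (g := fun u => ‖rowForm a X i (t - u)‖)
    ((continuous_rowForm a X i).norm.comp (by fun_prop)) (fun u _ => by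
      rw [expI_zeroRow_mul_sub hX hi, norm_mul]
      exact mul_le_of_le_one_right (norm_nonneg _) (norm_expI_le_one hX u a a))
  rwa [expI_zeroRow_of_ne hX hi, sub_zero, integral_norm_rowForm_sub] at h

theorem norm_expI_apply_le_rowIntegral_of_le {X : Matrix n n ℝ} (hX : X.IsSymm) {a i : n}
    (hi : i ≠ a) {u t : ℝ} (hu : 0 ≤ u) (hut : u ≤ t) :
    ‖expI X u i a‖ ≤ rowIntegral a X i t :=
  (norm_expI_apply_le_rowIntegral hX hi hu).trans (rowIntegral_mono a X i hu hut)

theorem norm_expI_sub_zeroRow_le {X : Matrix n n ℝ} (hX : X.IsSymm) {a i j : n} (hi : i ≠ a)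
    (hj : j ≠ a) {t : ℝ} (ht : 0 ≤ t) :
    ‖expI X t i j - expI (zeroRow a X) t i j‖ ≤ rowIntegral a X i t * rowIntegral a X j t := by
  have h := norm_expI_sub_expI_le (X := X) (Y := zeroRow a X) ht i j
    (g := fun u => ‖rowForm a X i (t - u)‖ * rowIntegral a X j t)
    (((continuous_rowForm a X i).norm.comp (by fun_prop)).mul continuous_const) (fun u hu => by
      rw [expI_zeroRow_mul_sub hX hi, norm_mul, expI_apply_comm hX]
      gcongr
      exact norm_expI_apply_le_rowIntegral_of_le hX hj hu.1 hu.2)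
  rwa [intervalIntegral.integral_mul_const, integral_norm_rowForm_sub] at h

theorem mul_single_mul_apply {R : Type*} [NonUnitalSemiring R] (A B : Matrix n n R) (a b : n)
    (c : R) (i j : n) : (A * Matrix.single a b c * B) i j = A i a * c * B b j := by
  rw [Matrix.mul_apply, Finset.sum_eq_single b _ (by simp), Matrix.mul_single_apply_same]
  intro l _ hl
  rw [Matrix.mul_single_apply_of_ne _ _ _ _ _ hl, zero_mul]

theorem norm_expI_sub_zeroEntry_self_le {X : Matrix n n ℝ} (hX : X.IsSymm) (i : n) {t : ℝ}
    (ht : 0 ≤ t) : ‖expI X t i i - expI (zeroEntry i i X) t i i‖ ≤ t * |X i i| := by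
  have h := norm_expI_sub_expI_le (X := X) (Y := zeroEntry i i X) ht i i
    (g := fun _ => |X i i|) continuous_const (fun u _ => by
      rw [map_sub_zeroEntry_self, mul_single_mul_apply, norm_mul, norm_mul, Complex.norm_real,
        Real.norm_eq_abs]
      calc _ ≤ 1 * |X i i| * 1 := by
            gcongr
            · exact norm_expI_le_one (zeroEntry_isSymm hX i i) _ i i
            · exact norm_expI_le_one hX u i i
        _ = |X i i| := by ring)
  simpa using h

/-- Each of the two terms of the Duhamel integrand contains an off-diagonal entry of one of the
unitary groups, which `norm_expI_apply_le_rowIntegral` makes small. -/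
theorem norm_expI_sub_zeroEntry_le {X : Matrix n n ℝ} (hX : X.IsSymm) {i k : n} (hk : k ≠ i)
    {t : ℝ} (ht : 0 ≤ t) :
    ‖expI X t i i - expI (zeroEntry i k X) t i i‖ ≤
      t * (|X k i| * (rowIntegral i (zeroEntry i k X) k t + rowIntegral i X k t)) := by
  have hY : (zeroEntry i k X).IsSymm := zeroEntry_isSymm hX i k
  have h := norm_expI_sub_expI_le (X := X) (Y := zeroEntry i k X) ht i i
    (g := fun _ => |X k i| * (rowIntegral i (zeroEntry i k X) k t + rowIntegral i X k t))
    continuous_const (fun u hu => by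
      have hleft : ‖expI (zeroEntry i k X) (t - u) k i‖ ≤ rowIntegral i (zeroEntry i k X) k t :=
        norm_expI_apply_le_rowIntegral_of_le hY hk (by linarith [hu.2]) (by linarith [hu.1])
      have hright : ‖expI X u k i‖ ≤ rowIntegral i X k t :=
        norm_expI_apply_le_rowIntegral_of_le hX hk hu.1 hu.2
      rw [map_sub_zeroEntry hX hk, mul_add, add_mul, Matrix.add_apply, mul_single_mul_apply,
        mul_single_mul_apply, expI_apply_comm hY _ i k]
      calc _ ≤ ‖expI (zeroEntry i k X) (t - u) k i‖ * |X k i| * ‖expI X u i i‖ +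
            ‖expI (zeroEntry i k X) (t - u) i i‖ * |X k i| * ‖expI X u k i‖ := by
            refine (norm_add_le _ _).trans_eq ?_
            simp only [norm_mul, Complex.norm_real, Real.norm_eq_abs]
        _ ≤ rowIntegral i (zeroEntry i k X) k t * |X k i| * 1 +
            1 * |X k i| * rowIntegral i X k t := by
            have := (norm_nonneg _).trans hleft
            gcongr
            · exact norm_expI_le_one hX u i i
            · exact norm_expI_le_one hY _ i i
        _ = _ := by ring)
  rwa [intervalIntegral.integral_const, sub_zero, smul_eq_mul] at h

end ZeroedEntries

section FunctionalCalculus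

variable {n : Type*} [Fintype n] [DecidableEq n]

theorem exists_cfc_apply_eq_sum {X : Matrix n n ℝ} (hX : X.IsSymm) :
    ∃ (V : Matrix n n ℝ) (l : n → ℝ), V * V.transpose = 1 ∧
      ∀ (f : ℝ → ℝ) (i j : n), (cfc f X : Matrix n n ℝ) i j = ∑ k, V i k * V j k * f (l k) := by
  have hA : X.IsHermitian := by
    rwa [Matrix.IsHermitian, Matrix.conjTranspose_eq_transpose_of_trivial]
  refine ⟨(hA.eigenvectorUnitary : Matrix n n ℝ), hA.eigenvalues, ?_, fun f i j => ?_⟩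
  · have h := Unitary.coe_mul_star_self hA.eigenvectorUnitary
    rwa [Unitary.coe_star, Matrix.star_eq_conjTranspose,
      Matrix.conjTranspose_eq_transpose_of_trivial] at h
  · rw [hA.cfc_eq, Matrix.IsHermitian.cfc, Unitary.conjStarAlgAut_apply, Matrix.mul_apply]
    refine Finset.sum_congr rfl fun k _ => ?_
    rw [Matrix.mul_diagonal, Matrix.star_apply]
    simp only [Function.comp_apply, RCLike.ofReal_real_eq_id, id_eq, star_trivial]
    ring

theorem expI_apply_eq_sum {X V : Matrix n n ℝ} {l : n → ℝ} (hV : V * V.transpose = 1)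
    (hX : ∀ i j, X i j = ∑ k, V i k * V j k * l k) (t : ℝ) (i j : n) :
    expI X t i j = ∑ k, (V i k * V j k : ℂ) * Complex.exp (Complex.I * (t * l k)) := by
  set W : Matrix n n ℂ := V.map Complex.ofReal with hW
  have hWW : W * W.transpose = 1 := by
    have h := congrArg (fun M : Matrix n n ℝ => M.map Complex.ofRealHom) hV
    simp only [Matrix.map_mul, Matrix.map_one Complex.ofRealHom (map_zero _) (map_one _)] at h
    exact h
  have hinv : W⁻¹ = W.transpose := Matrix.inv_eq_right_inv hWW
  have hunit : IsUnit W := by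
    rw [Matrix.isUnit_iff_isUnit_det]
    exact Matrix.isUnit_det_of_right_inverse hWW
  have hgen : t • genI X = W * Matrix.diagonal (fun k => Complex.I * (t * l k : ℂ)) * W⁻¹ := by
    ext a b
    rw [hinv, Matrix.mul_apply, Matrix.smul_apply, genI_apply, hX a b]
    push_cast
    rw [Finset.mul_sum, Finset.smul_sum]
    refine Finset.sum_congr rfl fun k _ => ?_
    rw [Matrix.mul_diagonal, Matrix.transpose_apply]
    simp only [hW, Matrix.map_apply, Complex.real_smul]
    ring
  rw [expI, hgen, Matrix.exp_conj _ _ hunit, Matrix.exp_diagonal, hinv, Matrix.mul_apply]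
  refine Finset.sum_congr rfl fun k _ => ?_
  rw [Matrix.mul_diagonal, Matrix.transpose_apply, Pi.coe_exp, ← Complex.exp_eq_exp_ℂ]
  simp only [hW, Matrix.map_apply]
  ring

theorem MemSobolevH.cfc_apply {s : ℝ} (hs : 1 / 2 < s) {f : ℝ → ℝ} (hc : Continuous f)
    (hf : MemSobolevH s f) {X : Matrix n n ℝ} (hX : X.IsSymm) (i j : n) :
    (((cfc f X : Matrix n n ℝ) i j : ℝ) : ℂ) = ((√(2 * Real.pi))⁻¹ : ℝ) *
      ∫ k, fourierHat f k * expI X k i j := by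
  obtain ⟨V, l, hV, hcfc⟩ := exists_cfc_apply_eq_sum hX
  have hsum : ∀ i j, X i j = ∑ k, V i k * V j k * l k := fun i j => by
    have hA : IsSelfAdjoint X := by
      rwa [isSelfAdjoint_iff, Matrix.star_eq_conjTranspose,
        Matrix.conjTranspose_eq_transpose_of_trivial]
    simpa only [cfc_id ℝ X hA, id_eq] using hcfc id i j
  have hint : ∀ x : ℝ, Integrable fun k : ℝ =>
      fourierHat f k * Complex.exp (Complex.I * (k * x)) := fun x => by
    refine (hf.integrable_fourierHat hs).mul_bdd (c := 1) (by fun_prop)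
      (Eventually.of_forall fun k => ?_)
    rw [← Complex.ofReal_mul, mul_comm, Complex.norm_exp_ofReal_mul_I]
  calc (((cfc f X : Matrix n n ℝ) i j : ℝ) : ℂ)
      = ∑ m, (V i m * V j m : ℂ) * (((√(2 * Real.pi))⁻¹ : ℝ) *
          ∫ k, fourierHat f k * Complex.exp (Complex.I * (k * l m))) := by
        rw [hcfc]
        push_cast
        simp only [hf.eq_integral hs hc, Complex.ofReal_inv]
    _ = ((√(2 * Real.pi))⁻¹ : ℝ) * ∫ k, ∑ m, (V i m * V j m : ℂ) *
          (fourierHat f k * Complex.exp (Complex.I * (k * l m))) := by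
        rw [integral_finsetSum _ fun m _ => (hint _).const_mul _, Finset.mul_sum]
        simp only [integral_const_mul]
        exact Finset.sum_congr rfl fun m _ => by ring
    _ = ((√(2 * Real.pi))⁻¹ : ℝ) * ∫ k, fourierHat f k * expI X k i j := by
        simp only [expI_apply_eq_sum hV hsum, Finset.mul_sum, mul_left_comm]

end FunctionalCalculus

section TimeIntegral

theorem pow_succ_intervalIntegral_le {k : ℕ} (hk : Even (k + 1)) {t : ℝ} (ht : 0 ≤ t) {f : ℝ → ℝ}
    (hf : Continuous f) :
    (∫ v in (0 : ℝ)..t, f v) ^ (k + 1) ≤ t ^ k * ∫ v in (0 : ℝ)..t, f v ^ (k + 1) := by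
  rcases ht.eq_or_lt with rfl | ht
  · simp
  have hjensen : (⨍ v in (0 : ℝ)..t, f v) ^ (k + 1) ≤ ⨍ v in (0 : ℝ)..t, f v ^ (k + 1) := by
    rw [Set.uIoc_of_le ht.le]
    exact (hk.convexOn_pow (𝕜 := ℝ)).map_set_average_le (by fun_prop) isClosed_univ
      (by simpa using ht) (by simp) (Eventually.of_forall fun _ => Set.mem_univ _)
      (hf.intervalIntegrable 0 t).1 ((hf.pow (k + 1)).intervalIntegrable 0 t).1
  rw [interval_average_eq_div, interval_average_eq_div, sub_zero, div_pow, div_le_div_iff₀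
    (by positivity) ht] at hjensen
  refine le_of_mul_le_mul_right (hjensen.trans_eq ?_) ht
  ring

theorem lintegral_intervalIntegral_pow_succ_le {α : Type*} [TopologicalSpace α]
    [MeasurableSpace α] [BorelSpace α] [SecondCountableTopology α] {ν : Measure α} [SFinite ν]
    {q : α → ℝ → ℝ} (hq : Continuous fun z : α × ℝ => q z.1 z.2) {k : ℕ} (hk : Even (k + 1))
    {C : ℝ} (hb : ∀ v, ∫⁻ x, ENNReal.ofReal (q x v ^ (k + 1)) ∂ν ≤ ENNReal.ofReal C) {t : ℝ}
    (ht : 0 ≤ t) :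
    ∫⁻ x, ENNReal.ofReal ((∫ v in (0 : ℝ)..t, q x v) ^ (k + 1)) ∂ν ≤
      ENNReal.ofReal (t ^ (k + 1) * C) := by
  have hqx : ∀ x, Continuous (q x) := fun x => hq.comp (by fun_prop : Continuous fun v => (x, v))
  calc ∫⁻ x, ENNReal.ofReal ((∫ v in (0 : ℝ)..t, q x v) ^ (k + 1)) ∂ν
      ≤ ∫⁻ x, (ENNReal.ofReal (t ^ k) *
          ∫⁻ v in Set.Ioc 0 t, ENNReal.ofReal (q x v ^ (k + 1))) ∂ν := by
        refine lintegral_mono fun x => ?_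
        refine (ENNReal.ofReal_le_ofReal (pow_succ_intervalIntegral_le hk ht (hqx x))).trans_eq ?_
        rw [ENNReal.ofReal_mul (by positivity), intervalIntegral.integral_of_le ht,
          ← ofReal_integral_eq_lintegral_ofReal (f := fun v => q x v ^ (k + 1))
            (((hqx x).pow (k + 1)).intervalIntegrable 0 t).1
            (Eventually.of_forall fun v => hk.pow_nonneg _)]
    _ = ENNReal.ofReal (t ^ k) *
          ∫⁻ v in Set.Ioc 0 t, ∫⁻ x, ENNReal.ofReal (q x v ^ (k + 1)) ∂ν := by
        rw [lintegral_const_mul' _ _ ENNReal.ofReal_ne_top, lintegral_lintegral_swap]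
        exact (ENNReal.continuous_ofReal.comp (hq.pow (k + 1))).measurable.aemeasurable
    _ ≤ ENNReal.ofReal (t ^ k) * ∫⁻ _ in Set.Ioc 0 t, ENNReal.ofReal C := by
        gcongr with v
        exact hb v
    _ = ENNReal.ofReal (t ^ (k + 1) * C) := by
        rw [lintegral_const, Measure.restrict_apply_univ, Real.volume_Ioc, sub_zero, mul_comm _
          (ENNReal.ofReal t), ← mul_assoc, ← ENNReal.ofReal_mul (by positivity),
          ← ENNReal.ofReal_mul (by positivity), pow_succ]

theorem integrable_and_integral_le_of_lintegral_le {α : Type*} [MeasurableSpace α] {ν : Measure α}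
    {f : α → ℝ} (hf : AEStronglyMeasurable f ν) (hf0 : 0 ≤ f) {C : ℝ} (hC : 0 ≤ C)
    (h : ∫⁻ x, ENNReal.ofReal (f x) ∂ν ≤ ENNReal.ofReal C) :
    Integrable f ν ∧ ∫ x, f x ∂ν ≤ C := by
  have hint : Integrable f ν := by
    refine ⟨hf, ?_⟩
    rw [hasFiniteIntegral_iff_ofReal (Eventually.of_forall hf0)]
    exact h.trans_lt ENNReal.ofReal_lt_top
  refine ⟨hint, ?_⟩
  rwa [← ENNReal.ofReal_le_ofReal_iff hC,
    ofReal_integral_eq_lintegral_ofReal hint (Eventually.of_forall hf0)]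

end TimeIntegral

section SymmetricMatrix

variable {n : Type*}

/-- The symmetric matrix with given entries, which are indexed by the unordered pairs of indices. -/
def symMat (x : Sym2 n → ℝ) : Matrix n n ℝ :=
  Matrix.of fun j k => x s(j, k)

theorem symMat_apply (x : Sym2 n → ℝ) (j k : n) : symMat x j k = x s(j, k) :=
  rfl

theorem symMat_isSymm (x : Sym2 n → ℝ) : (symMat x).IsSymm := by
  ext j k
  rw [Matrix.transpose_apply, symMat_apply, symMat_apply, Sym2.eq_swap]

theorem continuous_symMat : Continuous (symMat : (Sym2 n → ℝ) → Matrix n n ℝ) :=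
  continuous_matrix fun _ _ => continuous_apply _

variable [DecidableEq n]

theorem dependsOn_zeroRow_symMat (a : n) :
    DependsOn (fun x => zeroRow a (symMat x)) {p : Sym2 n | a ∉ p} := by
  intro x y hxy
  ext j k
  simp only [zeroRow_apply, symMat_apply]
  split_ifs with h
  · rfl
  · exact hxy _ (by simpa [eq_comm] using h)

theorem dependsOn_zeroEntry_symMat (i k : n) :
    DependsOn (fun x => zeroEntry i k (symMat x)) {p : Sym2 n | p ≠ s(i, k)} := by
  intro x y hxy
  ext a b
  simp only [zeroEntry_apply, symMat_apply]
  split_ifs with h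
  · rfl
  · exact hxy _ (by simpa [Sym2.eq_iff] using h)

variable [Fintype n]

theorem rowForm_symMat {a i : n} (hi : i ≠ a) (x : Sym2 n → ℝ) (v : ℝ) :
    rowForm a (symMat x) i v =
      ∑ k ∈ Finset.univ.erase a, x s(k, a) • expI (zeroRow a (symMat x)) v i k := by
  rw [rowForm, ← Finset.sum_erase_add _ _ (Finset.mem_univ a),
    expI_zeroRow_of_ne (symMat_isSymm x) hi, smul_zero, add_zero]
  rfl

theorem rowForm_zeroEntry_symMat {a i : n} (hi : i ≠ a) (x : Sym2 n → ℝ) (v : ℝ) :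
    rowForm a (zeroEntry a i (symMat x)) i v = ∑ k ∈ (Finset.univ.erase a).erase i,
      x s(k, a) • expI (zeroRow a (symMat x)) v i k := by
  rw [rowForm, zeroRow_zeroEntry, ← Finset.sum_erase_add _ _ (Finset.mem_univ a),
    expI_zeroRow_of_ne (symMat_isSymm x) hi, smul_zero, add_zero,
    ← Finset.sum_erase_add _ _ (Finset.mem_erase.2 ⟨hi, Finset.mem_univ i⟩)]
  have hzero : zeroEntry a i (symMat x) i a = 0 := by simp [zeroEntry_apply]
  rw [hzero, zero_smul, add_zero]
  refine Finset.sum_congr rfl fun k hk => ?_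
  have hki : k ≠ i := Finset.ne_of_mem_erase hk
  simp [zeroEntry_apply, symMat_apply, hki, hi.symm]

end SymmetricMatrix

/-- The moment conditions on the laws `μ` of the entries of a symmetric matrix: off the diagonal
these are centred with second moments at most `s` and fourth moments at most `M`, on the diagonal
the second moments are at most `d`. -/
structure EntryLaws {n : Type*} (μ : Sym2 n → Measure ℝ) (s M d : ℝ) : Prop where
  memLp : ∀ p, ¬p.IsDiag → MemLp id 4 (μ p)
  mean : ∀ p, ¬p.IsDiag → ∫ r, r ∂(μ p) = 0
  second : ∀ p, ¬p.IsDiag → ∫ r, r ^ 2 ∂(μ p) ≤ s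
  fourth : ∀ p, ¬p.IsDiag → ∫ r, r ^ 4 ∂(μ p) ≤ M
  memLp_diag : ∀ p, p.IsDiag → MemLp id 2 (μ p)
  second_diag : ∀ p, p.IsDiag → ∫ r, r ^ 2 ∂(μ p) ≤ d
  fourth_nonneg : 0 ≤ M

namespace EntryLaws

section Moments

variable {n : Type*} [Fintype n] [DecidableEq n] {μ : Sym2 n → Measure ℝ} {s M d : ℝ}
  [∀ p, IsProbabilityMeasure (μ p)]

theorem lintegral_norm_column_pow_four_le (h : EntryLaws μ s M d) {a : n} (i : n) {T : Finset n}
    (hT : a ∉ T) (v : ℝ) :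
    ∫⁻ x, ENNReal.ofReal (‖∑ k ∈ T, x s(k, a) • expI (zeroRow a (symMat x)) v i k‖ ^ 4)
      ∂(Measure.pi μ) ≤ ENNReal.ofReal (3 * s ^ 2 + M) := by
  have hdiag : ∀ k ∈ T, ¬(s(k, a)).IsDiag := fun k hk => by
    rw [Sym2.mk_isDiag_iff]
    rintro rfl
    exact hT hk
  refine lintegral_norm_sum_smul_pow_four_le (fun _ _ hjk => Sym2.congr_left.1 hjk) T
    (Finset.univ.filter (a ∈ ·)) (by simp) (c := fun k x => expI (zeroRow a (symMat x)) v i k)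
    (fun k => (continuous_expI_apply_comp ((continuous_zeroRow a).comp continuous_symMat)
      continuous_const i k).stronglyMeasurable) (fun k _ x y hxy => ?_) (fun x => ?_)
    h.fourth_nonneg (fun k hk => h.memLp _ (hdiag k hk)) (fun k hk => h.mean _ (hdiag k hk))
    (fun k hk => h.second _ (hdiag k hk)) (fun k hk => h.fourth _ (hdiag k hk))
  · exact congrArg (fun Z => expI Z v i k)
      (dependsOn_zeroRow_symMat a fun p hp => hxy p (by simpa using hp))
  · rw [← sum_norm_sq_expI (zeroRow_isSymm (symMat_isSymm x) a) v i]
    exact Finset.sum_le_univ_sum_of_nonneg fun _ => by positivity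

theorem integral_rowIntegral_pow_four_le_of_eq_sum (h : EntryLaws μ s M d) {a i : n}
    {f : Matrix n n ℝ → Matrix n n ℝ} (hf : Continuous f) {T : Finset n} (hT : a ∉ T)
    (hsum : ∀ (x : Sym2 n → ℝ) v, rowForm a (f (symMat x)) i v =
      ∑ k ∈ T, x s(k, a) • expI (zeroRow a (symMat x)) v i k) {t : ℝ} (ht : 0 ≤ t) :
    Integrable (fun x => rowIntegral a (f (symMat x)) i t ^ 4) (Measure.pi μ) ∧
      ∫ x, rowIntegral a (f (symMat x)) i t ^ 4 ∂(Measure.pi μ) ≤ t ^ 4 * (3 * s ^ 2 + M) := by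
  have hM := h.fourth_nonneg
  have hcont : Continuous fun z : (Sym2 n → ℝ) × ℝ => ‖rowForm a (f (symMat z.1)) i z.2‖ :=
    (continuous_rowForm_comp (hf.comp (continuous_symMat.comp continuous_fst)) continuous_snd
      a i).norm
  refine integrable_and_integral_le_of_lintegral_le
    ((intervalIntegral.continuous_parametric_intervalIntegral_of_continuous' hcont 0 t).pow
      4).aestronglyMeasurable (fun x => (by decide : Even 4).pow_nonneg _) (by positivity)
    (lintegral_intervalIntegral_pow_succ_le hcont (by decide) (fun v => ?_) ht)
  simp only [hsum]
  exact h.lintegral_norm_column_pow_four_le i hT v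

theorem integral_rowIntegral_pow_four_le (h : EntryLaws μ s M d) {a i : n} (hi : i ≠ a) {t : ℝ}
    (ht : 0 ≤ t) :
    Integrable (fun x => rowIntegral a (symMat x) i t ^ 4) (Measure.pi μ) ∧
      ∫ x, rowIntegral a (symMat x) i t ^ 4 ∂(Measure.pi μ) ≤ t ^ 4 * (3 * s ^ 2 + M) :=
  h.integral_rowIntegral_pow_four_le_of_eq_sum continuous_id (by simp) (rowForm_symMat hi) ht

theorem integral_rowIntegral_zeroEntry_pow_four_le (h : EntryLaws μ s M d) {a i : n} (hi : i ≠ a)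
    {t : ℝ} (ht : 0 ≤ t) :
    Integrable (fun x => rowIntegral a (zeroEntry a i (symMat x)) i t ^ 4) (Measure.pi μ) ∧
      ∫ x, rowIntegral a (zeroEntry a i (symMat x)) i t ^ 4 ∂(Measure.pi μ) ≤
        t ^ 4 * (3 * s ^ 2 + M) :=
  h.integral_rowIntegral_pow_four_le_of_eq_sum (continuous_zeroEntry a i) (by simp)
    (rowForm_zeroEntry_symMat hi) ht

theorem integral_norm_sub_zeroRow_sq_le (h : EntryLaws μ s M d) {a i j : n} (hi : i ≠ a)
    (hj : j ≠ a) {t : ℝ} (ht : 0 ≤ t) :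
    ∫ x, ‖expI (symMat x) t i j - expI (zeroRow a (symMat x)) t i j‖ ^ 2 ∂(Measure.pi μ) ≤
      t ^ 4 * (3 * s ^ 2 + M) := by
  obtain ⟨hinti, hi_le⟩ := h.integral_rowIntegral_pow_four_le hi ht
  obtain ⟨hintj, hj_le⟩ := h.integral_rowIntegral_pow_four_le hj ht
  have hle : ∀ x : Sym2 n → ℝ,
      ‖expI (symMat x) t i j - expI (zeroRow a (symMat x)) t i j‖ ^ 2 ≤
      1 / 2 * rowIntegral a (symMat x) i t ^ 4 + 1 / 2 * rowIntegral a (symMat x) j t ^ 4 := by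
    intro x
    have hprod := norm_expI_sub_zeroRow_le (symMat_isSymm x) hi hj ht
    set A := rowIntegral a (symMat x) i t
    set B := rowIntegral a (symMat x) j t
    calc _ ≤ (A * B) ^ 2 := by gcongr
      _ ≤ _ := by nlinarith [sq_nonneg (A ^ 2 - B ^ 2)]
  refine (integral_mono_of_nonneg (Eventually.of_forall fun x => by positivity)
    ((hinti.const_mul _).add (hintj.const_mul _)) (Eventually.of_forall hle)).trans ?_
  rw [integral_add' (hinti.const_mul _) (hintj.const_mul _), integral_const_mul,
    integral_const_mul]
  linarith

/-- The weight `δ` of the inequality `2A² ≤ δ⁻¹ + δA⁴` is free. -/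
theorem integral_norm_expI_sq_le (h : EntryLaws μ s M d) {i j : n} (hij : i ≠ j) {t : ℝ}
    (ht : 0 ≤ t) {δ : ℝ} (hδ : 0 < δ) :
    ∫ x, ‖expI (symMat x) t i j‖ ^ 2 ∂(Measure.pi μ) ≤
      δ⁻¹ + δ * (t ^ 4 * (3 * s ^ 2 + M)) := by
  obtain ⟨hint, hle4⟩ := h.integral_rowIntegral_pow_four_le hij ht
  have hle : ∀ x : Sym2 n → ℝ, ‖expI (symMat x) t i j‖ ^ 2 ≤
      δ⁻¹ + δ * rowIntegral j (symMat x) i t ^ 4 := by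
    intro x
    have hA := norm_expI_apply_le_rowIntegral (symMat_isSymm x) hij ht
    set A := rowIntegral j (symMat x) i t
    have hsq : δ⁻¹ + δ * A ^ 4 - 2 * A ^ 2 = δ * (A ^ 2 - δ⁻¹) ^ 2 := by
      field_simp
      ring
    have hsq0 : 0 ≤ δ * (A ^ 2 - δ⁻¹) ^ 2 := by positivity
    calc _ ≤ A ^ 2 := by gcongr
      _ ≤ _ := by nlinarith [sq_nonneg A]
  refine (integral_mono_of_nonneg (Eventually.of_forall fun x => by positivity)
    ((integrable_const _).add (hint.const_mul _)) (Eventually.of_forall hle)).trans ?_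
  rw [integral_add' (integrable_const _) (hint.const_mul _), integral_const_mul]
  simp only [integral_const, probReal_univ, smul_eq_mul, one_mul]
  gcongr

theorem integral_norm_sub_zeroEntry_self_sq_le (h : EntryLaws μ s M d) (i : n) {t : ℝ}
    (ht : 0 ≤ t) :
    ∫ x, ‖expI (symMat x) t i i - expI (zeroEntry i i (symMat x)) t i i‖ ^ 2 ∂(Measure.pi μ) ≤
      t ^ 2 * d := by
  have hdiag : (s(i, i)).IsDiag := Sym2.mk_isDiag_iff.2 rfl
  have hint : Integrable (fun x : Sym2 n → ℝ => (x s(i, i)) ^ 2) (Measure.pi μ) :=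
    ((h.memLp_diag _ hdiag).comp_measurePreserving
      (measurePreserving_eval μ s(i, i))).integrable_sq
  have hle : ∀ x : Sym2 n → ℝ,
      ‖expI (symMat x) t i i - expI (zeroEntry i i (symMat x)) t i i‖ ^ 2 ≤
      t ^ 2 * (x s(i, i)) ^ 2 := fun x => by
    have := norm_expI_sub_zeroEntry_self_le (symMat_isSymm x) i ht
    calc _ ≤ (t * |symMat x i i|) ^ 2 := by gcongr
      _ = _ := by rw [mul_pow, sq_abs, symMat_apply]
  refine (integral_mono_of_nonneg (Eventually.of_forall fun x => by positivity)
    (hint.const_mul _) (Eventually.of_forall hle)).trans ?_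
  rw [integral_const_mul, integral_eval_pi _ (g := fun r => r ^ 2) (by fun_prop)]
  exact mul_le_mul_of_nonneg_left (h.second_diag _ hdiag) (by positivity)

theorem integral_norm_sub_zeroEntry_sq_le (h : EntryLaws μ s M d) {i k : n} (hk : k ≠ i) {t : ℝ}
    (ht : 0 ≤ t) :
    ∫ x, ‖expI (symMat x) t i i - expI (zeroEntry i k (symMat x)) t i i‖ ^ 2 ∂(Measure.pi μ) ≤
      2 * (t ^ 4 * M) + 2 * (t ^ 4 * (3 * s ^ 2 + M)) := by
  obtain ⟨hintX, hX_le⟩ := h.integral_rowIntegral_pow_four_le hk ht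
  obtain ⟨hintY, hY_le⟩ := h.integral_rowIntegral_zeroEntry_pow_four_le hk ht
  have hdiag : ¬(s(k, i)).IsDiag := by rwa [Sym2.mk_isDiag_iff]
  have hint : Integrable (fun x : Sym2 n → ℝ => (x s(k, i)) ^ 4) (Measure.pi μ) :=
    integrable_pow_of_memLp_four ((h.memLp _ hdiag).comp_measurePreserving
      (measurePreserving_eval μ s(k, i))) le_rfl
  have hle : ∀ x : Sym2 n → ℝ,
      ‖expI (symMat x) t i i - expI (zeroEntry i k (symMat x)) t i i‖ ^ 2 ≤
      2 * t ^ 4 * (x s(k, i)) ^ 4 +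
      (rowIntegral i (zeroEntry i k (symMat x)) k t ^ 4 + rowIntegral i (symMat x) k t ^ 4) := by
    intro x
    have hprod := norm_expI_sub_zeroEntry_le (symMat_isSymm x) hk ht
    rw [symMat_apply] at hprod
    set A := rowIntegral i (zeroEntry i k (symMat x)) k t
    set B := rowIntegral i (symMat x) k t
    set y := x s(k, i)
    calc _ ≤ (t * (|y| * (A + B))) ^ 2 := by gcongr
      _ = t ^ 2 * y ^ 2 * (A + B) ^ 2 := by rw [mul_pow, mul_pow, sq_abs]; ring
      _ ≤ t ^ 2 * y ^ 2 * (2 * A ^ 2 + 2 * B ^ 2) := by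
        gcongr
        nlinarith [sq_nonneg (A - B)]
      _ ≤ _ := by nlinarith [sq_nonneg (t ^ 2 * y ^ 2 - A ^ 2), sq_nonneg (t ^ 2 * y ^ 2 - B ^ 2)]
  refine (integral_mono_of_nonneg (Eventually.of_forall fun x => by positivity)
    ((hint.const_mul _).add (hintY.add hintX)) (Eventually.of_forall hle)).trans ?_
  rw [integral_add' (hint.const_mul _) (hintY.add hintX), integral_add' hintY hintX,
    integral_const_mul, integral_eval_pi _ (g := fun r => r ^ 4) (by fun_prop)]
  have := mul_le_mul_of_nonneg_left (h.fourth _ hdiag) (show 0 ≤ 2 * t ^ 4 by positivity)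
  linarith

end Moments

section Variance

variable {n : Type*} [Fintype n] [DecidableEq n] {μ : Sym2 n → Measure ℝ} {s M d : ℝ}

theorem variance_expI_neg (t : ℝ) (i j : n) :
    ∫ x, ‖expI (symMat x) (-t) i j - ∫ y, expI (symMat y) (-t) i j ∂(Measure.pi μ)‖ ^ 2
      ∂(Measure.pi μ) =
    ∫ x, ‖expI (symMat x) t i j - ∫ y, expI (symMat y) t i j ∂(Measure.pi μ)‖ ^ 2
      ∂(Measure.pi μ) := by
  have hneg : ∀ x : Sym2 n → ℝ, expI (symMat x) (-t) i j = star (expI (symMat x) t i j) :=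
    fun x => expI_neg_apply (symMat_isSymm x) t i j
  have hmean : ∫ y, star (expI (symMat y) t i j) ∂(Measure.pi μ) =
      star (∫ y, expI (symMat y) t i j ∂(Measure.pi μ)) := integral_conj
  simp only [hneg, hmean, ← star_sub, norm_star]

variable [∀ p, IsProbabilityMeasure (μ p)]

variable (μ) in
theorem memLp_expI_symMat_comp {f : Matrix n n ℝ → Matrix n n ℝ} (hf : Continuous f)
    (hsymm : ∀ X : Matrix n n ℝ, X.IsSymm → (f X).IsSymm) (t : ℝ) (i j : n) :
    MemLp (fun x => expI (f (symMat x)) t i j) 2 (Measure.pi μ) :=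
  .of_bound (continuous_expI_apply_comp (hf.comp continuous_symMat) continuous_const i
    j).aestronglyMeasurable 1
    (Eventually.of_forall fun x => norm_expI_le_one (hsymm _ (symMat_isSymm x)) t i j)

theorem variance_expI_le_sum {κ : Type*} [Fintype κ] (β : Sym2 n → κ)
    {f : κ → Matrix n n ℝ → Matrix n n ℝ} (hf : ∀ c, Continuous (f c))
    (hsymm : ∀ c (X : Matrix n n ℝ), X.IsSymm → (f c X).IsSymm)
    (hfβ : ∀ c, DependsOn (fun x => f c (symMat x)) {p | β p ≠ c}) (t : ℝ) (i j : n) :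
    ∫ x, ‖expI (symMat x) t i j - ∫ y, expI (symMat y) t i j ∂(Measure.pi μ)‖ ^ 2
      ∂(Measure.pi μ) ≤
      ∑ c, ∫ x, ‖expI (symMat x) t i j - expI (f c (symMat x)) t i j‖ ^ 2 ∂(Measure.pi μ) :=
  integral_norm_sub_integral_sq_le_sum β
    (memLp_expI_symMat_comp μ continuous_id (fun _ => id) t i j)
    (fun c => memLp_expI_symMat_comp μ (hf c) (hsymm c) t i j)
    fun c _ _ hxy => congrArg (expI · t i j) (hfβ c hxy)

/-- The entries are distributed among the rows. The rows `i` and `j` form one block, which is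
bounded by the size of `expI (symMat x) t i j` itself, as this vanishes for the zero matrix. -/
theorem variance_expI_offDiag_le (h : EntryLaws μ s M d) {i j : n} (hij : i ≠ j) {t : ℝ}
    (ht : 0 ≤ t) :
    ∫ x, ‖expI (symMat x) t i j - ∫ y, expI (symMat y) t i j ∂(Measure.pi μ)‖ ^ 2
      ∂(Measure.pi μ) ≤
      (Fintype.card n : ℝ)⁻¹ + 2 * Fintype.card n * (t ^ 4 * (3 * s ^ 2 + M)) := by
  have : Nonempty n := ⟨i⟩
  have hM := h.fourth_nonneg
  set K := t ^ 4 * (3 * s ^ 2 + M)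
  let f : Option {c // c ≠ i ∧ c ≠ j} → Matrix n n ℝ → Matrix n n ℝ := fun c =>
    c.elim (fun _ => 0) fun c => zeroRow c
  let β : Sym2 n → Option {c // c ≠ i ∧ c ≠ j} := fun p =>
    if hp : p.out.1 ≠ i ∧ p.out.1 ≠ j then some ⟨p.out.1, hp⟩ else none
  have hβ : ∀ p c, β p = some c → c.1 ∈ p := by
    intro p c hpc
    unfold β at hpc
    split_ifs at hpc with hp
    exact Option.some.inj hpc ▸ p.out_fst_mem
  have hrow : ∫ x, ‖expI (symMat x) t i j - expI (f none (symMat x)) t i j‖ ^ 2 ∂(Measure.pi μ) ≤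
      (Fintype.card n : ℝ)⁻¹ + Fintype.card n * K := by
    have hzero : expI (0 : Matrix n n ℝ) t i j = 0 := by simp [expI, genI, hij]
    simpa [f, hzero] using
      h.integral_norm_expI_sq_le hij ht (by positivity : (0 : ℝ) < Fintype.card n)
  calc _ ≤ ∑ c, ∫ x, ‖expI (symMat x) t i j - expI (f c (symMat x)) t i j‖ ^ 2
          ∂(Measure.pi μ) := by
        refine variance_expI_le_sum β ?_ ?_ ?_ t i j
        · exact Option.rec continuous_const fun c => continuous_zeroRow c.1
        · exact Option.rec (fun _ _ => Matrix.isSymm_zero) fun c _ hX => zeroRow_isSymm hX c.1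
        · exact Option.rec (fun _ _ _ => rfl) fun c => (dependsOn_zeroRow_symMat c.1).mono
            fun p (hp : c.1 ∉ p) hpc => hp (hβ p c hpc)
    _ ≤ ((Fintype.card n : ℝ)⁻¹ + Fintype.card n * K) + Fintype.card n * K := by
        rw [Fintype.sum_option]
        refine add_le_add hrow ((Finset.sum_le_card_nsmul _ _ K fun c _ =>
          h.integral_norm_sub_zeroRow_sq_le c.2.1.symm c.2.2.symm ht).trans ?_)
        rw [nsmul_eq_mul]
        gcongr
        exact Fintype.card_subtype_le _
    _ = _ := by ring

/-- Every entry of the row `i` is a block; the other entries are distributed among the rows. -/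
theorem variance_expI_diag_le (h : EntryLaws μ s M d) (i : n) {t : ℝ} (ht : 0 ≤ t) :
    ∫ x, ‖expI (symMat x) t i i - ∫ y, expI (symMat y) t i i ∂(Measure.pi μ)‖ ^ 2
      ∂(Measure.pi μ) ≤ t ^ 2 * d + Fintype.card n * (2 * (t ^ 4 * M)) +
        3 * Fintype.card n * (t ^ 4 * (3 * s ^ 2 + M)) := by
  have hM := h.fourth_nonneg
  set K := t ^ 4 * (3 * s ^ 2 + M)
  let f : n ⊕ {c // c ≠ i} → Matrix n n ℝ → Matrix n n ℝ :=
    Sum.elim (zeroEntry i) fun c => zeroRow c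
  let β : Sym2 n → n ⊕ {c // c ≠ i} := fun p =>
    if hp : i ∈ p then .inl (Sym2.Mem.other hp)
    else .inr ⟨p.out.1, ne_of_mem_of_not_mem p.out_fst_mem hp⟩
  have hβl : ∀ p k, β p = .inl k → p = s(i, k) := by
    intro p k hpk
    unfold β at hpk
    split_ifs at hpk with hp
    rw [← Sum.inl.inj hpk, Sym2.other_spec]
  have hβr : ∀ p c, β p = .inr c → c.1 ∈ p := by
    intro p c hpc
    unfold β at hpc
    split_ifs at hpc with hp
    exact Sum.inr.inj hpc ▸ p.out_fst_mem
  calc _ ≤ ∑ c, ∫ x, ‖expI (symMat x) t i i - expI (f c (symMat x)) t i i‖ ^ 2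
          ∂(Measure.pi μ) := by
        refine variance_expI_le_sum β ?_ ?_ ?_ t i i
        · exact Sum.rec (continuous_zeroEntry i) fun c => continuous_zeroRow c.1
        · exact Sum.rec (fun k _ hX => zeroEntry_isSymm hX i k) fun c _ hX => zeroRow_isSymm hX c.1
        · exact Sum.rec (fun k => (dependsOn_zeroEntry_symMat i k).mono
              fun p (hp : p ≠ s(i, k)) hpk => hp (hβl p k hpk))
            fun c => (dependsOn_zeroRow_symMat c.1).mono
              fun p (hp : c.1 ∉ p) hpc => hp (hβr p c hpc)
    _ ≤ (t ^ 2 * d + Fintype.card n * (2 * (t ^ 4 * M) + 2 * K)) + Fintype.card n * K := by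
        rw [Fintype.sum_sum_type, ← Finset.add_sum_erase _ _ (Finset.mem_univ i)]
        refine add_le_add (add_le_add (h.integral_norm_sub_zeroEntry_self_sq_le i ht)
          ((Finset.sum_le_card_nsmul _ _ (2 * (t ^ 4 * M) + 2 * K) fun k hk =>
            h.integral_norm_sub_zeroEntry_sq_le (Finset.ne_of_mem_erase hk) ht).trans ?_))
          ((Finset.sum_le_card_nsmul _ _ K fun c _ =>
            h.integral_norm_sub_zeroRow_sq_le c.2.symm c.2.symm ht).trans ?_) <;>
        rw [nsmul_eq_mul] <;> gcongr
        exacts [Finset.card_le_univ _, Fintype.card_subtype_le _]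
    _ = _ := by ring

theorem variance_expI_le {σ σ₁ m₄ : ℝ} (h : EntryLaws μ (σ ^ 2 / Fintype.card n)
      (m₄ / (Fintype.card n : ℝ) ^ 2) (σ₁ ^ 2 / Fintype.card n)) (i j : n) (t : ℝ) :
    ∫ x, ‖expI (symMat x) t i j - ∫ y, expI (symMat y) t i j ∂(Measure.pi μ)‖ ^ 2
      ∂(Measure.pi μ) ≤
      (1 + σ₁ ^ 2 + 9 * σ ^ 4 + 5 * m₄) * (1 + 2 * |t|) ^ 4 / Fintype.card n := by
  wlog ht : 0 ≤ t generalizing t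
  · rw [← abs_neg, ← variance_expI_neg]
    exact this (-t) (by linarith)
  have : Nonempty n := ⟨i⟩
  have hcard : (0 : ℝ) < Fintype.card n := by positivity
  have hm : 0 ≤ m₄ := by
    simpa using (le_div_iff₀ (by positivity)).1 h.fourth_nonneg
  rw [abs_of_nonneg ht, le_div_iff₀ hcard]
  have h0 : 1 ≤ (1 + 2 * t) ^ 4 := one_le_pow₀ (by linarith)
  have h2 : σ₁ ^ 2 * t ^ 2 ≤ σ₁ ^ 2 * (1 + 2 * t) ^ 4 := by
    gcongr
    calc t ^ 2 ≤ (1 + 2 * t) ^ 2 := by gcongr; linarith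
      _ ≤ (1 + 2 * t) ^ 4 := pow_le_pow_right₀ (by linarith) (by norm_num)
  have h4 : t ^ 4 ≤ (1 + 2 * t) ^ 4 := by gcongr; linarith
  have hσ := mul_le_mul_of_nonneg_left h4 (by positivity : 0 ≤ σ ^ 4)
  have hm₄ := mul_le_mul_of_nonneg_left h4 hm
  have hσ0 : 0 ≤ σ ^ 4 * t ^ 4 := by positivity
  have hm0 : 0 ≤ m₄ * t ^ 4 := by positivity
  by_cases hij : i = j
  · subst hij
    calc _ ≤ _ := mul_le_mul_of_nonneg_right (h.variance_expI_diag_le i ht) hcard.le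
      _ = σ₁ ^ 2 * t ^ 2 + 5 * (m₄ * t ^ 4) + 9 * (σ ^ 4 * t ^ 4) := by
        field_simp
        ring
      _ ≤ _ := by linarith
  · have : 0 ≤ σ₁ ^ 2 * t ^ 2 := by positivity
    calc _ ≤ _ := mul_le_mul_of_nonneg_right (h.variance_expI_offDiag_le hij ht) hcard.le
      _ = 1 + 2 * (m₄ * t ^ 4) + 6 * (σ ^ 4 * t ^ 4) := by
        field_simp
        ring
      _ ≤ _ := by linarith

end Variance

end EntryLaws

section CauchySchwarz

theorem sq_lintegral_mul_le {α : Type*} [MeasurableSpace α] {ν : Measure α} {f g : α → ENNReal}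
    (hf : AEMeasurable f ν) (hg : AEMeasurable g ν) :
    (∫⁻ a, f a * g a ∂ν) ^ 2 ≤ (∫⁻ a, f a ^ 2 ∂ν) * ∫⁻ a, g a ^ 2 ∂ν := by
  have h := ENNReal.lintegral_mul_le_Lp_mul_Lq ν Real.HolderConjugate.two_two hf hg
  simp only [Pi.mul_apply, ENNReal.rpow_two] at h
  calc _ ≤ ((∫⁻ a, f a ^ 2 ∂ν) ^ (1 / 2 : ℝ) * (∫⁻ a, g a ^ 2 ∂ν) ^ (1 / 2 : ℝ)) ^ 2 := by
        gcongr
    _ = _ := by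
        rw [mul_pow, ← ENNReal.rpow_two, ← ENNReal.rpow_two, ← ENNReal.rpow_mul,
          ← ENNReal.rpow_mul]
        norm_num

theorem lintegral_sq_enorm_integral_mul_le {α β : Type*} [MeasurableSpace α] [MeasurableSpace β]
    {ν : Measure α} [SFinite ν] {κ : Measure β} [SFinite κ] {φ : β → ℂ}
    (hφ : AEStronglyMeasurable φ κ) {D : α → β → ℂ} (hD : Measurable fun z : α × β => D z.1 z.2)
    {w : β → ENNReal} (hw : Measurable w) (hw0 : ∀ k, w k ≠ 0) (hwt : ∀ k, w k ≠ ⊤) :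
    ∫⁻ x, ‖∫ k, φ k * D x k ∂κ‖ₑ ^ 2 ∂ν ≤ (∫⁻ k, w k ^ 2 * ‖φ k‖ₑ ^ 2 ∂κ) *
      ∫⁻ k, (w k ^ 2)⁻¹ * ∫⁻ x, ‖D x k‖ₑ ^ 2 ∂ν ∂κ := by
  have hDw : Measurable fun z : α × β => (w z.2 ^ 2)⁻¹ * ‖D z.1 z.2‖ₑ ^ 2 :=
    ((hw.comp measurable_snd).pow_const 2).inv.mul (hD.enorm.pow_const 2)
  have hcs : ∀ x, ‖∫ k, φ k * D x k ∂κ‖ₑ ^ 2 ≤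
      (∫⁻ k, w k ^ 2 * ‖φ k‖ₑ ^ 2 ∂κ) * ∫⁻ k, (w k ^ 2)⁻¹ * ‖D x k‖ₑ ^ 2 ∂κ := by
    intro x
    have hDx : Measurable (D x) := hD.comp measurable_prodMk_left
    calc ‖∫ k, φ k * D x k ∂κ‖ₑ ^ 2
        ≤ (∫⁻ k, (w k * ‖φ k‖ₑ) * ((w k)⁻¹ * ‖D x k‖ₑ) ∂κ) ^ 2 := by
          gcongr
          refine (enorm_integral_le_lintegral_enorm _).trans_eq (lintegral_congr fun k => ?_)
          rw [mul_mul_mul_comm, ENNReal.mul_inv_cancel (hw0 k) (hwt k), one_mul, enorm_mul]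
      _ ≤ (∫⁻ k, (w k * ‖φ k‖ₑ) ^ 2 ∂κ) * ∫⁻ k, ((w k)⁻¹ * ‖D x k‖ₑ) ^ 2 ∂κ :=
          sq_lintegral_mul_le (hw.aemeasurable.mul hφ.enorm) (hw.inv.mul hDx.enorm).aemeasurable
      _ = _ := by simp only [mul_pow, ENNReal.inv_pow]
  calc _ ≤ ∫⁻ x, (∫⁻ k, w k ^ 2 * ‖φ k‖ₑ ^ 2 ∂κ) *
        ∫⁻ k, (w k ^ 2)⁻¹ * ‖D x k‖ₑ ^ 2 ∂κ ∂ν := lintegral_mono hcs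
    _ = (∫⁻ k, w k ^ 2 * ‖φ k‖ₑ ^ 2 ∂κ) *
        ∫⁻ k, ∫⁻ x, (w k ^ 2)⁻¹ * ‖D x k‖ₑ ^ 2 ∂ν ∂κ := by
        rw [lintegral_const_mul _ hDw.lintegral_prod_right', lintegral_lintegral_swap
          hDw.aemeasurable]
    _ = _ := by
        congr! 3 with k
        exact lintegral_const_mul _ ((hD.comp measurable_prodMk_right).enorm.pow_const 2)

end CauchySchwarz

section SobolevVariance

variable {s : ℝ} {f : ℝ → ℝ}

theorem MemSobolevH.lintegral_sq_enorm_integral_mul_le (hs : 5 / 2 < s) (hf : MemSobolevH s f)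
    {α : Type*} [MeasurableSpace α] {ν : Measure α} [SFinite ν] {D : α → ℝ → ℂ}
    (hD : Measurable fun z : α × ℝ => D z.1 z.2) {B : ℝ} (hB : 0 ≤ B)
    (hDB : ∀ k, ∫⁻ x, ‖D x k‖ₑ ^ 2 ∂ν ≤ ENNReal.ofReal (B * (1 + 2 * |k|) ^ 4)) :
    ∫⁻ x, ‖∫ k, fourierHat f k * D x k‖ₑ ^ 2 ∂ν ≤ ENNReal.ofReal
      (B * (∫ k : ℝ, (1 + 2 * |k|) ^ (-(2 * s - 4))) * sobolevNormSq s f) := by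
  have hpos : ∀ k : ℝ, 0 < 1 + 2 * |k| := fun k => by positivity
  have hsq : ∀ k : ℝ, ENNReal.ofReal ((1 + 2 * |k|) ^ s) ^ 2 =
      ENNReal.ofReal ((1 + 2 * |k|) ^ (2 * s)) := fun k => by
    rw [← ENNReal.ofReal_pow (by positivity), ← Real.rpow_mul_natCast (hpos k).le, mul_comm s]
    norm_cast
  have hnorm : ∫⁻ k, ENNReal.ofReal ((1 + 2 * |k|) ^ s) ^ 2 * ‖fourierHat f k‖ₑ ^ 2 =
      ENNReal.ofReal (sobolevNormSq s f) := by
    rw [sobolevNormSq, ofReal_integral_eq_lintegral_ofReal hf.2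
      (Eventually.of_forall (sobolevDensity_nonneg s f))]
    refine lintegral_congr fun k => ?_
    rw [hsq, sobolevDensity, ENNReal.ofReal_mul (by positivity),
      ENNReal.ofReal_pow (norm_nonneg _), ofReal_norm]
  have hweight : ∀ k : ℝ, (ENNReal.ofReal ((1 + 2 * |k|) ^ s) ^ 2)⁻¹ *
      ENNReal.ofReal (B * (1 + 2 * |k|) ^ 4) =
      ENNReal.ofReal (B * (1 + 2 * |k|) ^ (-(2 * s - 4))) := fun k => by
    rw [hsq, ← ENNReal.ofReal_inv_of_pos (Real.rpow_pos_of_pos (hpos k) _),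
      ← ENNReal.ofReal_mul (by positivity), ← Real.rpow_neg (hpos k).le, mul_left_comm,
      ← Real.rpow_add_natCast (hpos k).ne']
    congr 3
    push_cast
    ring
  refine (_root_.lintegral_sq_enorm_integral_mul_le (aestronglyMeasurable_fourierHat f) hD
    (w := fun k => ENNReal.ofReal ((1 + 2 * |k|) ^ s)) (by fun_prop)
    (fun k => by simpa using Real.rpow_pos_of_pos (hpos k) s) (by simp)).trans ?_
  have hint := integrable_one_add_two_mul_abs_rpow_neg (r := 2 * s - 4) (by linarith)
  rw [hnorm, mul_comm, ENNReal.ofReal_mul (by positivity), ← integral_const_mul,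
    ofReal_integral_eq_lintegral_ofReal (hint.const_mul B)
      (Eventually.of_forall fun k => by positivity)]
  gcongr with k
  exact (mul_le_mul_right (hDB k) _).trans_eq (hweight k)

theorem MemSobolevH.integrable_fourierHat_mul (hs : 1 / 2 < s) (hf : MemSobolevH s f)
    {g : ℝ → ℂ} (hg : AEStronglyMeasurable g) (hg1 : ∀ k, ‖g k‖ ≤ 1) :
    Integrable fun k => fourierHat f k * g k :=
  (hf.integrable_fourierHat hs).mul_bdd hg (Eventually.of_forall hg1)

variable {α : Type*} [MeasurableSpace α] {ν : Measure α} {U : α → ℝ → ℂ} {Y : α → ℝ}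

theorem MemSobolevH.memLp_of_eq_integral [IsFiniteMeasure ν] (hs : 1 / 2 < s)
    (hf : MemSobolevH s f) (hU : Measurable fun z : α × ℝ => U z.1 z.2)
    (hU1 : ∀ x k, ‖U x k‖ ≤ 1)
    (hY : ∀ x, (Y x : ℂ) = ((√(2 * Real.pi))⁻¹ : ℝ) * ∫ k, fourierHat f k * U x k)
    (p : ENNReal) : MemLp Y p ν := by
  have hmeas : AEStronglyMeasurable (fun x => ∫ k, fourierHat f k * U x k) ν :=
    ((aestronglyMeasurable_fourierHat f).comp_snd.mul hU.aestronglyMeasurable).integral_prod_right'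
  have hYc : MemLp (fun x => (Y x : ℂ)) p ν := by
    refine .of_bound (C := (√(2 * Real.pi))⁻¹ * ∫ k, ‖fourierHat f k‖) ?_
      (Eventually.of_forall fun x => ?_)
    · simpa only [hY] using hmeas.const_mul _
    · rw [hY, norm_mul, Complex.norm_real, Real.norm_of_nonneg (by positivity)]
      gcongr
      refine norm_integral_le_of_norm_le (hf.integrable_fourierHat hs).norm
        (Eventually.of_forall fun k => ?_)
      rw [norm_mul]
      exact mul_le_of_le_one_right (norm_nonneg _) (hU1 x k)
  simpa using hYc.re

theorem MemSobolevH.norm_sub_re_integral_le (hs : 1 / 2 < s) (hf : MemSobolevH s f)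
    {g h : ℝ → ℂ} (hg : AEStronglyMeasurable g) (hg1 : ∀ k, ‖g k‖ ≤ 1)
    (hh : AEStronglyMeasurable h) (hh1 : ∀ k, ‖h k‖ ≤ 1) {y : ℝ}
    (hy : (y : ℂ) = ((√(2 * Real.pi))⁻¹ : ℝ) * ∫ k, fourierHat f k * g k) :
    ‖y - (((√(2 * Real.pi))⁻¹ : ℝ) * ∫ k, fourierHat f k * h k : ℂ).re‖ ≤
      ‖∫ k, fourierHat f k * (g k - h k)‖ := by
  have hle_one : (√(2 * Real.pi))⁻¹ ≤ 1 := by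
    refine inv_le_one_of_one_le₀ (Real.one_le_sqrt.2 ?_)
    linarith [Real.pi_gt_three]
  have hsub : y - (((√(2 * Real.pi))⁻¹ : ℝ) * ∫ k, fourierHat f k * h k : ℂ).re =
      (((√(2 * Real.pi))⁻¹ : ℝ) * ∫ k, fourierHat f k * (g k - h k) : ℂ).re := by
    simp only [mul_sub]
    rw [integral_sub (hf.integrable_fourierHat_mul hs hg hg1)
      (hf.integrable_fourierHat_mul hs hh hh1), mul_sub, Complex.sub_re, ← hy, Complex.ofReal_re]
  rw [hsub]
  calc _ ≤ ‖(((√(2 * Real.pi))⁻¹ : ℝ) * ∫ k, fourierHat f k * (g k - h k) : ℂ)‖ :=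
        Complex.abs_re_le_norm _
    _ = (√(2 * Real.pi))⁻¹ * ‖∫ k, fourierHat f k * (g k - h k)‖ := by
        rw [norm_mul, Complex.norm_real, Real.norm_of_nonneg (by positivity)]
    _ ≤ _ := mul_le_of_le_one_left (norm_nonneg _) hle_one

theorem variance_le_of_lintegral_sq_enorm_sub_le [IsProbabilityMeasure ν] (hY : MemLp Y 2 ν)
    (y : ℝ) {C : ℝ} (hC : 0 ≤ C) (h : ∫⁻ x, ‖Y x - y‖ₑ ^ 2 ∂ν ≤ ENNReal.ofReal C) :
    variance Y ν ≤ C := by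
  have hYy : MemLp (fun x => Y x - y) 2 ν := hY.sub (memLp_const y)
  rw [← variance_sub_const hY.aestronglyMeasurable y]
  refine (variance_le_expectation_sq hYy.aestronglyMeasurable).trans ?_
  simp only [Pi.pow_apply]
  rw [← ENNReal.ofReal_le_ofReal_iff hC, ofReal_integral_eq_lintegral_ofReal hYy.integrable_sq
    (Eventually.of_forall fun x => sq_nonneg _)]
  refine (lintegral_congr fun x => ?_).trans_le h
  rw [← Real.enorm_of_nonneg (sq_nonneg _), enorm_pow]

theorem lintegral_sq_enorm_le_ofReal {g : α → ℂ} (hg : MemLp g 2 ν) {C : ℝ}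
    (h : ∫ x, ‖g x‖ ^ 2 ∂ν ≤ C) : ∫⁻ x, ‖g x‖ₑ ^ 2 ∂ν ≤ ENNReal.ofReal C := by
  refine le_trans (le_of_eq ?_) (ENNReal.ofReal_le_ofReal h)
  rw [ofReal_integral_eq_lintegral_ofReal (hg.integrable_norm_pow two_ne_zero)
    (Eventually.of_forall fun x => by positivity)]
  refine lintegral_congr fun x => ?_
  rw [ENNReal.ofReal_pow (norm_nonneg _), ofReal_norm]

theorem MemSobolevH.variance_le_of_eq_integral [IsProbabilityMeasure ν] (hs : 5 / 2 < s)
    (hf : MemSobolevH s f) (hU : Measurable fun z : α × ℝ => U z.1 z.2)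
    (hU1 : ∀ x k, ‖U x k‖ ≤ 1)
    (hY : ∀ x, (Y x : ℂ) = ((√(2 * Real.pi))⁻¹ : ℝ) * ∫ k, fourierHat f k * U x k) {B : ℝ}
    (hB : 0 ≤ B) (hUB : ∀ k, ∫ x, ‖U x k - ∫ y, U y k ∂ν‖ ^ 2 ∂ν ≤ B * (1 + 2 * |k|) ^ 4) :
    variance Y ν ≤ B * (∫ k : ℝ, (1 + 2 * |k|) ^ (-(2 * s - 4))) * sobolevNormSq s f := by
  have hs' : 1 / 2 < s := by linarith
  let u : ℝ → ℂ := fun k => ∫ y, U y k ∂ν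
  have hu : StronglyMeasurable u :=
    (hU.comp measurable_swap).stronglyMeasurable.integral_prod_right'
  have hu1 : ∀ k, ‖u k‖ ≤ 1 := fun k => by
    simpa using norm_integral_le_of_norm_le_const (μ := ν) (Eventually.of_forall fun y => hU1 y k)
  have hUx : ∀ x, Measurable (U x) := fun x => hU.comp measurable_prodMk_left
  have hUk : ∀ k, MemLp (fun x => U x k - u k) 2 ν := fun k =>
    (MemLp.of_bound (hU.comp measurable_prodMk_right).aestronglyMeasurable 1
      (Eventually.of_forall fun x => hU1 x k)).sub (memLp_const (u k))
  have hbound := hf.lintegral_sq_enorm_integral_mul_le hs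
    (hU.sub (hu.measurable.comp measurable_snd)) hB
    fun k => lintegral_sq_enorm_le_ofReal (hUk k) (hUB k)
  have hnorm : 0 ≤ sobolevNormSq s f := integral_nonneg (sobolevDensity_nonneg s f)
  refine variance_le_of_lintegral_sq_enorm_sub_le (hf.memLp_of_eq_integral hs' hU hU1 hY 2)
    (((√(2 * Real.pi))⁻¹ : ℝ) * ∫ k, fourierHat f k * u k : ℂ).re (by positivity)
    (le_trans ?_ hbound)
  gcongr with x
  exact enorm_le_iff_norm_le.2 (hf.norm_sub_re_integral_le hs' (hUx x).aestronglyMeasurable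
    (hU1 x) hu.aestronglyMeasurable hu1 (hY x))

variable {n : Type*} [Fintype n] [DecidableEq n]

theorem EntryLaws.variance_cfc_le {μ : Sym2 n → Measure ℝ} [∀ p, IsProbabilityMeasure (μ p)]
    {σ σ₁ m₄ : ℝ} (h : EntryLaws μ (σ ^ 2 / Fintype.card n) (m₄ / (Fintype.card n : ℝ) ^ 2)
      (σ₁ ^ 2 / Fintype.card n))
    (hs : 5 / 2 < s) (hc : Continuous f) (hf : MemSobolevH s f) (i j : n) :
    MemLp (fun x => (cfc f (symMat x) : Matrix n n ℝ) i j) 2 (Measure.pi μ) ∧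
      variance (fun x => (cfc f (symMat x) : Matrix n n ℝ) i j) (Measure.pi μ) ≤
        (1 + σ₁ ^ 2 + 9 * σ ^ 4 + 5 * m₄) / Fintype.card n *
          (∫ k : ℝ, (1 + 2 * |k|) ^ (-(2 * s - 4))) * sobolevNormSq s f := by
  have hU : Measurable fun z : (Sym2 n → ℝ) × ℝ => expI (symMat z.1) z.2 i j :=
    (continuous_expI_apply_comp (continuous_symMat.comp continuous_fst) continuous_snd i
      j).measurable
  have hU1 : ∀ (x : Sym2 n → ℝ) t, ‖expI (symMat x) t i j‖ ≤ 1 := fun x t =>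
    norm_expI_le_one (symMat_isSymm x) t i j
  have hY := fun x : Sym2 n → ℝ =>
    hf.cfc_apply (by linarith : 1 / 2 < s) hc (symMat_isSymm x) i j
  refine ⟨hf.memLp_of_eq_integral (by linarith) hU hU1 hY 2,
    hf.variance_le_of_eq_integral hs hU hU1 hY ?_ fun t => ?_⟩
  · have hzero := h.variance_expI_le i j 0
    simpa using (integral_nonneg fun _ => by positivity).trans hzero
  · exact (h.variance_expI_le i j t).trans_eq (by ring)

end SobolevVariance

section UpperEntry

variable {N : ℕ}

/-- The entry of a symmetric matrix `A` at an unordered pair of indices, read off on or above the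
diagonal. -/
def upperEntry (A : Matrix (Fin N) (Fin N) ℝ) (p : Sym2 (Fin N)) : ℝ :=
  A p.inf p.sup

theorem upperEntry_mk {A : Matrix (Fin N) (Fin N) ℝ} (hA : A.IsSymm) (j k : Fin N) :
    upperEntry A s(j, k) = A j k := by
  rcases le_total j k with h | h
  · simp [upperEntry, h]
  · simpa [upperEntry, h] using hA.apply j k

theorem symMat_upperEntry {A : Matrix (Fin N) (Fin N) ℝ} (hA : A.IsSymm) :
    symMat (upperEntry A) = A := by
  ext j k
  rw [symMat_apply, upperEntry_mk hA]

end UpperEntry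

namespace IsRealWigner

variable {Ω : Type u} [MeasurableSpace Ω] {P : Measure Ω}
  {W : (N : ℕ) → Ω → Matrix (Fin N) (Fin N) ℝ} {σ σ₁ m₄ : ℝ}

theorem upperEntry_mk (hW : IsRealWigner P W σ σ₁ m₄) {N : ℕ} (ω : Ω) (j k : Fin N) :
    upperEntry (W N ω) s(j, k) = W N ω j k :=
  _root_.upperEntry_mk (hW.symm N ω) j k

theorem measurable_upperEntry (hW : IsRealWigner P W σ σ₁ m₄) (N : ℕ) (p : Sym2 (Fin N)) :
    Measurable fun ω => upperEntry (W N ω) p :=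
  hW.measurable N p.inf p.sup

theorem iIndepFun_upperEntry (hW : IsRealWigner P W σ σ₁ m₄) (N : ℕ) :
    iIndepFun (fun (p : Sym2 (Fin N)) ω => upperEntry (W N ω) p) P :=
  (hW.indep N).precomp Sym2.sortEquiv.injective

theorem integral_sq_offDiag (hW : IsRealWigner P W σ σ₁ m₄) {N : ℕ} {j k : Fin N} (hjk : j ≠ k) :
    ∫ ω, W N ω j k ^ 2 ∂P = σ ^ 2 := by
  rw [← hW.variance_offDiag N j k hjk,
    variance_of_integral_eq_zero (hW.measurable N j k).aemeasurable (hW.mean_offDiag N j k hjk)]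

theorem entryLaws (hW : IsRealWigner P W σ σ₁ m₄) (N : ℕ) (c : ℝ) :
    EntryLaws (fun p : Sym2 (Fin N) => P.map fun ω => c * upperEntry (W N ω) p)
      (c ^ 2 * σ ^ 2) (c ^ 4 * |m₄|) (c ^ 2 * σ₁ ^ 2) := by
  have hmeas : ∀ p : Sym2 (Fin N), AEMeasurable (fun ω => c * upperEntry (W N ω) p) P := fun p =>
    ((hW.measurable_upperEntry N p).const_mul c).aemeasurable
  have hpow : ∀ (q : ℕ) (j k : Fin N), ∫ r, r ^ q ∂(P.map fun ω => c * upperEntry (W N ω) s(j, k))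
      = c ^ q * ∫ ω, W N ω j k ^ q ∂P := fun q j k => by
    rw [integral_map (hmeas _) (by fun_prop)]
    simp only [mul_pow, hW.upperEntry_mk, integral_const_mul]
  have hmemLp : ∀ (q : ENNReal) (j k : Fin N), MemLp (fun ω => W N ω j k) q P →
      MemLp id q (P.map fun ω => c * upperEntry (W N ω) s(j, k)) := fun q j k h => by
    rw [memLp_map_measure_iff aestronglyMeasurable_id (hmeas _)]
    simpa only [Function.comp_def, id, hW.upperEntry_mk] using h.const_mul c
  refine ⟨?_, ?_, ?_, ?_, ?_, ?_, by positivity⟩ <;> refine Sym2.ind fun j k hjk => ?_ <;>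
    rw [Sym2.mk_isDiag_iff] at hjk
  · exact hmemLp 4 j k (hW.memLp_offDiag N j k hjk)
  · simpa [hW.mean_offDiag N j k hjk] using hpow 1 j k
  · rw [hpow, hW.integral_sq_offDiag hjk]
  · rw [hpow]
    gcongr
    exact (hW.fourth_moment_le N j k hjk).trans (le_abs_self m₄)
  · exact hmemLp 2 j k (hjk ▸ hW.memLp_diag N j)
  · rw [hpow, ← hjk]
    gcongr
    exact hW.second_moment_le N j

theorem entryLaws_inv_sqrt (hW : IsRealWigner P W σ σ₁ m₄) (N : ℕ) :
    EntryLaws (fun p : Sym2 (Fin N) => P.map fun ω => (√(N : ℝ))⁻¹ * upperEntry (W N ω) p)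
      (σ ^ 2 / Fintype.card (Fin N)) (|m₄| / (Fintype.card (Fin N) : ℝ) ^ 2)
      (σ₁ ^ 2 / Fintype.card (Fin N)) := by
  have h := hW.entryLaws N (√(N : ℝ))⁻¹
  rw [Fintype.card_fin]
  rwa [show (√(N : ℝ))⁻¹ ^ 4 = ((√(N : ℝ))⁻¹ ^ 2) ^ 2 by ring, inv_pow,
    Real.sq_sqrt N.cast_nonneg, inv_pow, ← div_eq_inv_mul, ← div_eq_inv_mul, ← div_eq_inv_mul] at h

end IsRealWigner

/-- The constant of the variance bound for the matrix entries of functions in `𝓗_s` of Wigner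
matrices. -/
noncomputable def varianceConst (σ σ₁ m₄ s : ℝ) : ℝ :=
  (1 + σ₁ ^ 2 + 9 * σ ^ 4 + 5 * |m₄|) * ∫ k : ℝ, (1 + 2 * |k|) ^ (-(2 * s - 4))

theorem IsRealWigner.variance_matrixFunEntry_le {Ω : Type u} [MeasurableSpace Ω] {P : Measure Ω}
    [IsProbabilityMeasure P] {W : (N : ℕ) → Ω → Matrix (Fin N) (Fin N) ℝ} {σ σ₁ m₄ : ℝ}
    (hW : IsRealWigner P W σ σ₁ m₄) {s : ℝ} (hs : 5 / 2 < s) {f : ℝ → ℝ} (hc : Continuous f)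
    (hf : MemSobolevH s f) (N : ℕ) (i j : Fin N) :
    MemLp (fun ω => matrixFunEntry f (W N ω) i j) 2 P ∧
      variance (fun ω => matrixFunEntry f (W N ω) i j) P ≤
        varianceConst σ σ₁ m₄ s * sobolevNormSq s f / N := by
  let Z : Ω → Sym2 (Fin N) → ℝ := fun ω p => (√(N : ℝ))⁻¹ * upperEntry (W N ω) p
  have hZp : ∀ p, Measurable fun ω => Z ω p := fun p =>
    (hW.measurable_upperEntry N p).const_mul _
  have hZ : AEMeasurable Z P := (measurable_pi_lambda Z hZp).aemeasurable
  have _ : ∀ p, IsProbabilityMeasure (P.map fun ω => Z ω p) := fun p =>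
    Measure.isProbabilityMeasure_map (hZp p).aemeasurable
  have hmap : P.map Z = Measure.pi fun p => P.map fun ω => Z ω p :=
    ((hW.iIndepFun_upperEntry N).comp (fun _ r => (√(N : ℝ))⁻¹ * r)
      fun _ => by fun_prop).map_fun_eq_pi_map fun p => (hZp p).aemeasurable
  have hentry : (fun ω => matrixFunEntry f (W N ω) i j) =
      (fun x => (cfc f (symMat x) : Matrix (Fin N) (Fin N) ℝ) i j) ∘ Z := by
    ext ω
    have hsymm : ((√(N : ℝ))⁻¹ • W N ω).IsSymm := (hW.symm N ω).smul _
    rw [matrixFunEntry, ← symMat_upperEntry hsymm]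
    rfl
  obtain ⟨hmemLp, hvar⟩ := (hW.entryLaws_inv_sqrt N).variance_cfc_le hs hc hf i j
  rw [← hmap] at hmemLp hvar
  rw [variance_map hmemLp.1.aemeasurable hZ, ← hentry, Fintype.card_fin] at hvar
  rw [hentry]
  refine ⟨(memLp_map_measure_iff hmemLp.1 hZ).1 hmemLp, hentry ▸ hvar.trans_eq ?_⟩
  rw [varianceConst]
  ring

theorem integrable_pow_of_memLp {Ω : Type*} [MeasurableSpace Ω] {P : Measure Ω}
    [IsFiniteMeasure P] {X : Ω → ℝ} {n : ℕ} (hX : MemLp X n P) :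
    Integrable (fun ω => X ω ^ n) P :=
  (integrable_norm_iff (hX.1.pow n)).1 (by simpa using hX.integrable_norm_pow')

section Truncation

/-- The truncation of a real number at the level `K`: it is kept if it lies in `[-K, K]`, and
replaced by `0` otherwise. -/
noncomputable def truncAt (K x : ℝ) : ℝ :=
  if |x| ≤ K then x else 0

variable {K : ℝ}

theorem truncAt_of_abs_le {x : ℝ} (h : |x| ≤ K) : truncAt K x = x :=
  if_pos h

theorem measurable_truncAt (K : ℝ) : Measurable (truncAt K) :=
  Measurable.ite (measurableSet_le (by fun_prop) measurable_const) measurable_id measurable_const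

theorem abs_truncAt_le (hK : 0 ≤ K) (x : ℝ) : |truncAt K x| ≤ K := by
  unfold truncAt
  split_ifs with h
  · exact h
  · simpa using hK

theorem memLp_truncAt (hK : 0 ≤ K) (μ : Measure ℝ) [IsFiniteMeasure μ] (p : ENNReal) :
    MemLp (truncAt K) p μ :=
  MemLp.of_bound (measurable_truncAt K).aestronglyMeasurable K
    (Eventually.of_forall fun _ => abs_truncAt_le hK _)

theorem integrable_truncAt_pow (hK : 0 ≤ K) (μ : Measure ℝ) [IsFiniteMeasure μ] (n : ℕ) :
    Integrable (fun x => truncAt K x ^ n) μ :=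
  integrable_pow_of_memLp (memLp_truncAt hK μ n)

theorem truncAt_pow {n : ℕ} (hn : n ≠ 0) (K x : ℝ) :
    truncAt K x ^ n = {y : ℝ | K < |y|}ᶜ.indicator (fun y => y ^ n) x := by
  by_cases h : |x| ≤ K <;> simp [truncAt, h, hn]

end Truncation

section TailMoment

/-- The part of the `n`-th moment of `μ` that is removed by the truncation at the level `K`. -/
noncomputable def tailMoment (μ : Measure ℝ) (K : ℝ) (n : ℕ) : ℝ :=
  ∫ x in {y | K < |y|}, x ^ n ∂μ

theorem measurableSet_lt_abs (K : ℝ) : MeasurableSet {x : ℝ | K < |x|} :=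
  measurableSet_lt measurable_const measurable_id.abs

variable {μ : Measure ℝ} {K : ℝ} {n : ℕ}

theorem integral_truncAt_pow_add_tailMoment (hn : n ≠ 0) (hint : Integrable (fun x => x ^ n) μ) :
    ∫ x, truncAt K x ^ n ∂μ + tailMoment μ K n = ∫ x, x ^ n ∂μ := by
  simp only [truncAt_pow hn]
  rw [integral_indicator (measurableSet_lt_abs K).compl, tailMoment, add_comm,
    integral_add_compl (measurableSet_lt_abs K) hint]

theorem tailMoment_nonneg (hn : Even n) : 0 ≤ tailMoment μ K n :=
  integral_nonneg fun _ => hn.pow_nonneg _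

theorem tailMoment_le (hn : Even n) (hint : Integrable (fun x => x ^ n) μ) :
    tailMoment μ K n ≤ ∫ x, x ^ n ∂μ :=
  setIntegral_le_integral hint (Eventually.of_forall fun _ => hn.pow_nonneg _)

theorem sq_mul_tailMoment_le (hK : 0 ≤ K) (hn : Even n)
    (hint : Integrable (fun x => x ^ (n + 2)) μ) :
    K ^ 2 * tailMoment μ K n ≤ tailMoment μ K (n + 2) := by
  rw [tailMoment, ← integral_const_mul]
  refine integral_mono_of_nonneg
    (Eventually.of_forall fun x => mul_nonneg (sq_nonneg K) (hn.pow_nonneg x)) hint.integrableOn ?_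
  filter_upwards [ae_restrict_mem (measurableSet_lt_abs K)] with x hx
  rw [pow_add, mul_comm]
  exact mul_le_mul_of_nonneg_left (sq_le_sq.2 (by rw [abs_of_nonneg hK]; exact hx.le))
    (hn.pow_nonneg x)

theorem abs_tailMoment_one_mul_le (hK : 0 ≤ K) (hint : Integrable (fun x => x ^ 2) μ) :
    |tailMoment μ K 1| * K ≤ tailMoment μ K 2 := by
  simp only [tailMoment, pow_one]
  calc |∫ x in {y | K < |y|}, x ∂μ| * K ≤ (∫ x in {y | K < |y|}, |x| ∂μ) * K := by
        gcongr
        exact abs_integral_le_integral_abs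
    _ = ∫ x in {y | K < |y|}, |x| * K ∂μ := (integral_mul_const _ _).symm
    _ ≤ ∫ x in {y | K < |y|}, x ^ 2 ∂μ := by
      refine integral_mono_of_nonneg
        (Eventually.of_forall fun x => mul_nonneg (abs_nonneg x) hK) hint.integrableOn ?_
      filter_upwards [ae_restrict_mem (measurableSet_lt_abs K)] with x hx
      rw [← sq_abs, sq]
      exact mul_le_mul_of_nonneg_left (le_of_lt hx) (abs_nonneg x)

theorem tailMoment_one_sq_le [IsProbabilityMeasure μ] (h2 : MemLp id 2 μ) :
    tailMoment μ K 1 ^ 2 ≤ tailMoment μ K 2 := by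
  have htail : MemLp ({y : ℝ | K < |y|}.indicator id) 2 μ := h2.indicator (measurableSet_lt_abs K)
  have hle := norm_integral_sq_le htail
  have hsq : ∀ x, ‖{y : ℝ | K < |y|}.indicator id x‖ ^ 2 =
      {y : ℝ | K < |y|}.indicator (fun y => y ^ 2) x := fun x => by
    by_cases hx : K < |x| <;> simp [hx]
  simp only [hsq] at hle
  rw [integral_indicator (measurableSet_lt_abs K), integral_indicator (measurableSet_lt_abs K),
    Real.norm_eq_abs, sq_abs] at hle
  simpa only [tailMoment, pow_one, id] using hle

end TailMoment

/-- The law on `{-K, 0, K}` with mean `a` and second moment `q`; it is a probability measure for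
`|a| * K ≤ q ≤ K ^ 2`. -/
noncomputable def threePoint (K a q : ℝ) : Measure ℝ :=
  ENNReal.ofReal ((q / K ^ 2 + a / K) / 2) • Measure.dirac K +
    ENNReal.ofReal ((q / K ^ 2 - a / K) / 2) • Measure.dirac (-K) +
      ENNReal.ofReal (1 - q / K ^ 2) • Measure.dirac 0

section ThreePoint

variable {K a q : ℝ}

theorem threePoint_weights_nonneg (hK : 0 < K) (ha : |a| * K ≤ q) (hq : q ≤ K ^ 2) :
    0 ≤ (q / K ^ 2 + a / K) / 2 ∧ 0 ≤ (q / K ^ 2 - a / K) / 2 ∧ 0 ≤ 1 - q / K ^ 2 := by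
  have habs : |a / K| ≤ q / K ^ 2 := by
    rw [abs_div, abs_of_pos hK, div_le_div_iff₀ hK (by positivity)]
    nlinarith
  have hle : q / K ^ 2 ≤ 1 := (div_le_one (by positivity)).2 hq
  have hbounds := abs_le.1 habs
  exact ⟨by linarith, by linarith, by linarith⟩

theorem isProbabilityMeasure_threePoint (hK : 0 < K) (ha : |a| * K ≤ q) (hq : q ≤ K ^ 2) :
    IsProbabilityMeasure (threePoint K a q) := by
  obtain ⟨h₁, h₂, h₃⟩ := threePoint_weights_nonneg hK ha hq
  constructor
  simp only [threePoint, Measure.add_apply, Measure.smul_apply, measure_univ, smul_eq_mul, mul_one]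
  rw [← ENNReal.ofReal_add h₁ h₂, ← ENNReal.ofReal_add (by linarith) h₃, ← ENNReal.ofReal_one]
  congr 1
  ring

theorem integral_threePoint (hK : 0 < K) (ha : |a| * K ≤ q) (hq : q ≤ K ^ 2) (g : ℝ → ℝ) :
    ∫ x, g x ∂(threePoint K a q) = (q / K ^ 2 + a / K) / 2 * g K +
      (q / K ^ 2 - a / K) / 2 * g (-K) + (1 - q / K ^ 2) * g 0 := by
  obtain ⟨h₁, h₂, h₃⟩ := threePoint_weights_nonneg hK ha hq
  have hint : ∀ c y : ℝ, Integrable g (ENNReal.ofReal c • Measure.dirac y) := fun c y =>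
    (integrable_dirac (by simp)).smul_measure ENNReal.ofReal_ne_top
  rw [threePoint, integral_add_measure ((hint _ _).add_measure (hint _ _)) (hint _ _),
    integral_add_measure (hint _ _) (hint _ _)]
  simp only [integral_smul_measure, integral_dirac, smul_eq_mul]
  rw [ENNReal.toReal_ofReal h₁, ENNReal.toReal_ofReal h₂, ENNReal.toReal_ofReal h₃]

theorem threePoint_compl_zero (hK : 0 < K) (ha : |a| * K ≤ q) (hq : q ≤ K ^ 2) :
    threePoint K a q {0}ᶜ = ENNReal.ofReal (q / K ^ 2) := by
  obtain ⟨h₁, h₂, -⟩ := threePoint_weights_nonneg hK ha hq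
  simp only [threePoint, Measure.add_apply, Measure.smul_apply, smul_eq_mul]
  rw [Measure.dirac_apply_of_mem (by simpa using hK.ne'),
    Measure.dirac_apply_of_mem (by simpa using hK.ne'),
    Measure.dirac_apply' _ (MeasurableSet.singleton _).compl,
    Set.indicator_of_notMem (by simp), mul_zero, add_zero, mul_one, mul_one,
    ← ENNReal.ofReal_add h₁ h₂]
  congr 1
  ring

end ThreePoint

/-- The law of an independent variable which, added to the truncation at the level `K` of a centred
variable of law `μ`, restores its mean and its second moment. The term `2 * tailMoment μ K 1 ^ 2`
compensates for the product of the means of the two summands. -/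
noncomputable def correctionLaw (μ : Measure ℝ) (K : ℝ) : Measure ℝ :=
  threePoint K (tailMoment μ K 1) (tailMoment μ K 2 + 2 * tailMoment μ K 1 ^ 2)

/-- The law `μ` is centred with finite second moment, and `K` is so large that the truncation of
`μ` at the level `K` can be corrected by a variable with values in `{-K, 0, K}`. -/
structure IsTruncationLevel (μ : Measure ℝ) (K : ℝ) : Prop where
  memLp : MemLp id 2 μ
  mean_eq_zero : ∫ x, x ∂μ = 0
  pos : 0 < K
  two_mul_le : 2 * ∫ x, x ^ 2 ∂μ ≤ K ^ 2

/-- The truncation of the first coordinate, corrected by the second one; the outer truncation of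
the correction, on whose values it is the identity, makes the sum bounded everywhere. -/
noncomputable def corrected (K : ℝ) (z : ℝ × ℝ) : ℝ :=
  truncAt K z.1 + truncAt K z.2

theorem measurable_corrected (K : ℝ) : Measurable (corrected K) :=
  ((measurable_truncAt K).comp measurable_fst).add ((measurable_truncAt K).comp measurable_snd)

theorem abs_corrected_le {K : ℝ} (hK : 0 ≤ K) (z : ℝ × ℝ) : |corrected K z| ≤ 2 * K :=
  (abs_add_le _ _).trans (by linarith [abs_truncAt_le hK z.1, abs_truncAt_le hK z.2])

namespace IsTruncationLevel

variable {μ : Measure ℝ} {K : ℝ}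

theorem integral_truncAt [IsFiniteMeasure μ] (h : IsTruncationLevel μ K) :
    ∫ x, truncAt K x ∂μ = -tailMoment μ K 1 := by
  have hadd := integral_truncAt_pow_add_tailMoment (K := K) one_ne_zero
    (integrable_pow_of_memLp (X := id) (by exact_mod_cast h.memLp.mono_exponent one_le_two))
  simp only [pow_one, h.mean_eq_zero] at hadd
  linarith

theorem integral_truncAt_sq (h : IsTruncationLevel μ K) :
    ∫ x, truncAt K x ^ 2 ∂μ = ∫ x, x ^ 2 ∂μ - tailMoment μ K 2 :=
  eq_sub_of_add_eq (integral_truncAt_pow_add_tailMoment two_ne_zero h.memLp.integrable_sq)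

variable [IsProbabilityMeasure μ]

theorem correction_bounds (h : IsTruncationLevel μ K) :
    |tailMoment μ K 1| * K ≤ tailMoment μ K 2 + 2 * tailMoment μ K 1 ^ 2 ∧
      tailMoment μ K 2 + 2 * tailMoment μ K 1 ^ 2 ≤ K ^ 2 := by
  have habs := abs_tailMoment_one_mul_le h.pos.le h.memLp.integrable_sq
  have htail := tailMoment_one_sq_le (K := K) h.memLp
  have htrunc := norm_integral_sq_le (memLp_truncAt h.pos.le μ 2)
  simp only [Real.norm_eq_abs, sq_abs] at htrunc
  rw [h.integral_truncAt, h.integral_truncAt_sq, neg_sq] at htrunc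
  exact ⟨by nlinarith, by linarith [h.two_mul_le, sq_nonneg (tailMoment μ K 1)]⟩

theorem isProbabilityMeasure_correctionLaw (h : IsTruncationLevel μ K) :
    IsProbabilityMeasure (correctionLaw μ K) :=
  isProbabilityMeasure_threePoint h.pos h.correction_bounds.1 h.correction_bounds.2

theorem integral_correctionLaw (h : IsTruncationLevel μ K) (g : ℝ → ℝ) :
    ∫ y, g (truncAt K y) ∂(correctionLaw μ K) =
      ((tailMoment μ K 2 + 2 * tailMoment μ K 1 ^ 2) / K ^ 2 + tailMoment μ K 1 / K) / 2 * g K +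
      ((tailMoment μ K 2 + 2 * tailMoment μ K 1 ^ 2) / K ^ 2 - tailMoment μ K 1 / K) / 2 * g (-K) +
      (1 - (tailMoment μ K 2 + 2 * tailMoment μ K 1 ^ 2) / K ^ 2) * g 0 := by
  rw [correctionLaw, integral_threePoint h.pos h.correction_bounds.1 h.correction_bounds.2,
    truncAt_of_abs_le (abs_of_pos h.pos).le,
    truncAt_of_abs_le (by rw [abs_neg, abs_of_pos h.pos]),
    truncAt_of_abs_le (by simpa using h.pos.le)]

theorem integral_truncAt_correctionLaw (h : IsTruncationLevel μ K) :
    ∫ y, truncAt K y ∂(correctionLaw μ K) = tailMoment μ K 1 := by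
  have hK := h.pos.ne'
  rw [h.integral_correctionLaw fun y => y]
  field_simp
  ring

theorem integral_truncAt_pow_correctionLaw (h : IsTruncationLevel μ K) {n : ℕ} (hn : Even n) :
    ∫ y, truncAt K y ^ (n + 2) ∂(correctionLaw μ K) =
      K ^ n * (tailMoment μ K 2 + 2 * tailMoment μ K 1 ^ 2) := by
  have hK := h.pos.ne'
  rw [h.integral_correctionLaw fun y => y ^ (n + 2), (hn.add even_two).neg_pow]
  field_simp
  ring

theorem integral_corrected (h : IsTruncationLevel μ K) :
    ∫ z, corrected K z ∂(μ.prod (correctionLaw μ K)) = 0 := by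
  have _ := h.isProbabilityMeasure_correctionLaw
  have hfst := (integrable_truncAt_pow h.pos.le μ 1).comp_fst (correctionLaw μ K)
  have hsnd := (integrable_truncAt_pow h.pos.le (correctionLaw μ K) 1).comp_snd μ
  simp only [pow_one] at hfst hsnd
  simp only [corrected]
  rw [integral_add hfst hsnd, integral_fun_fst, integral_fun_snd, h.integral_truncAt,
    h.integral_truncAt_correctionLaw]
  simp

theorem integral_corrected_sq (h : IsTruncationLevel μ K) :
    ∫ z, corrected K z ^ 2 ∂(μ.prod (correctionLaw μ K)) = ∫ x, x ^ 2 ∂μ := by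
  have _ := h.isProbabilityMeasure_correctionLaw
  have hfst := (integrable_truncAt_pow h.pos.le μ 2).comp_fst (correctionLaw μ K)
  have hsnd := (integrable_truncAt_pow h.pos.le (correctionLaw μ K) 2).comp_snd μ
  have hmul := (integrable_truncAt_pow h.pos.le μ 1).mul_prod
    (integrable_truncAt_pow h.pos.le (correctionLaw μ K) 1)
  simp only [pow_one] at hmul
  have hexpand : ∀ z : ℝ × ℝ, corrected K z ^ 2 =
      truncAt K z.1 ^ 2 + (2 * (truncAt K z.1 * truncAt K z.2) + truncAt K z.2 ^ 2) := fun z => by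
    rw [corrected]
    ring
  simp only [hexpand]
  rw [integral_add hfst ((hmul.const_mul 2).fun_add hsnd),
    integral_add (hmul.const_mul 2) hsnd, integral_const_mul, integral_prod_mul,
    integral_fun_fst (fun x => truncAt K x ^ 2), integral_fun_snd (fun x => truncAt K x ^ 2),
    h.integral_truncAt_sq, h.integral_truncAt, h.integral_truncAt_correctionLaw,
    h.integral_truncAt_pow_correctionLaw (n := 0) Even.zero]
  simp only [probReal_univ, one_smul]
  ring

theorem integral_corrected_pow_four_le (h : IsTruncationLevel μ K)
    (h4 : Integrable (fun x => x ^ 4) μ) :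
    ∫ z, corrected K z ^ 4 ∂(μ.prod (correctionLaw μ K)) ≤ 24 * ∫ x, x ^ 4 ∂μ := by
  have _ := h.isProbabilityMeasure_correctionLaw
  have hfst := (integrable_truncAt_pow h.pos.le μ 4).comp_fst (correctionLaw μ K)
  have hsnd := (integrable_truncAt_pow h.pos.le (correctionLaw μ K) 4).comp_snd μ
  have hmoment : ∫ x, truncAt K x ^ 4 ∂μ + tailMoment μ K 4 = ∫ x, x ^ 4 ∂μ :=
    integral_truncAt_pow_add_tailMoment (by norm_num) h4
  have htail : K ^ 2 * tailMoment μ K 2 ≤ tailMoment μ K 4 :=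
    sq_mul_tailMoment_le h.pos.le even_two h4
  have hmean : K ^ 2 * tailMoment μ K 1 ^ 2 ≤ K ^ 2 * tailMoment μ K 2 :=
    mul_le_mul_of_nonneg_left (tailMoment_one_sq_le h.memLp) (sq_nonneg K)
  have hle : tailMoment μ K 4 ≤ ∫ x, x ^ 4 ∂μ := tailMoment_le (by decide) h4
  calc ∫ z, corrected K z ^ 4 ∂(μ.prod (correctionLaw μ K))
      ≤ ∫ z : ℝ × ℝ, 8 * (truncAt K z.1 ^ 4 + truncAt K z.2 ^ 4) ∂(μ.prod (correctionLaw μ K)) :=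
        integral_mono_of_nonneg (Eventually.of_forall fun z => by positivity)
          ((hfst.fun_add hsnd).const_mul 8) (Eventually.of_forall fun z =>
            (Even.add_pow_le (by decide)).trans_eq (by norm_num))
    _ = 8 * (∫ x, truncAt K x ^ 4 ∂μ +
          K ^ 2 * (tailMoment μ K 2 + 2 * tailMoment μ K 1 ^ 2)) := by
        rw [integral_const_mul, integral_add hfst hsnd, integral_fun_fst (fun x => truncAt K x ^ 4),
          integral_fun_snd (fun x => truncAt K x ^ 4),
          h.integral_truncAt_pow_correctionLaw (n := 2) even_two]
        simp
    _ ≤ 24 * ∫ x, x ^ 4 ∂μ := by linarith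

theorem measure_corrected_ne_le (h : IsTruncationLevel μ K) :
    (μ.prod (correctionLaw μ K)) {z | corrected K z ≠ z.1} ≤
      ENNReal.ofReal (4 * tailMoment μ K 2 / K ^ 2) := by
  have _ := h.isProbabilityMeasure_correctionLaw
  have hK := h.pos
  have hsub : {z : ℝ × ℝ | corrected K z ≠ z.1} ⊆
      Prod.fst ⁻¹' {x | K < |x|} ∪ Prod.snd ⁻¹' {0}ᶜ := by
    intro z hz
    contrapose! hz
    simp only [Set.mem_union, Set.mem_preimage, Set.mem_ofPred_eq, Set.mem_compl_iff,
      Set.mem_singleton_iff, not_or, not_lt, not_not] at hz ⊢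
    rw [corrected, truncAt_of_abs_le hz.1, hz.2, truncAt_of_abs_le (by simpa using hK.le),
      add_zero]
  have hfst : (μ.prod (correctionLaw μ K)) (Prod.fst ⁻¹' {x | K < |x|}) ≤
      ENNReal.ofReal (tailMoment μ K 2 / K ^ 2) := by
    rw [measurePreserving_fst.measure_preimage (measurableSet_lt_abs K).nullMeasurableSet,
      ← ofReal_measureReal]
    have hmarkov := sq_mul_tailMoment_le hK.le (n := 0) Even.zero h.memLp.integrable_sq
    rw [tailMoment] at hmarkov
    simp only [pow_zero, setIntegral_const, smul_eq_mul, mul_one] at hmarkov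
    gcongr
    rwa [le_div_iff₀' (by positivity)]
  have hsnd : (μ.prod (correctionLaw μ K)) (Prod.snd ⁻¹' {0}ᶜ) =
      ENNReal.ofReal ((tailMoment μ K 2 + 2 * tailMoment μ K 1 ^ 2) / K ^ 2) := by
    rw [measurePreserving_snd.measure_preimage (MeasurableSet.singleton _).compl.nullMeasurableSet,
      correctionLaw, threePoint_compl_zero hK h.correction_bounds.1 h.correction_bounds.2]
  have htail := tailMoment_nonneg (μ := μ) (K := K) even_two
  refine (measure_mono hsub).trans ((measure_union_le _ _).trans ?_)
  rw [hsnd]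
  refine (add_le_add_left hfst _).trans ?_
  rw [← ENNReal.ofReal_add (by positivity) (by positivity), ← add_div]
  gcongr
  linarith [tailMoment_one_sq_le (K := K) h.memLp]

end IsTruncationLevel

theorem iIndepFun_prodMk_of_prod {ι Ω Ω₂ : Type*} [Finite ι] [MeasurableSpace Ω]
    [MeasurableSpace Ω₂] {P : Measure Ω} {Q : Measure Ω₂} [IsProbabilityMeasure P]
    [IsProbabilityMeasure Q] {X : ι → Ω → ℝ} {Y : ι → Ω₂ → ℝ} (hX : ∀ i, Measurable (X i))
    (hY : ∀ i, Measurable (Y i)) (hXi : iIndepFun X P) (hYi : iIndepFun Y Q) :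
    iIndepFun (fun i (z : Ω × Ω₂) => (X i z.1, Y i z.2)) (P.prod Q) := by
  have _ := Fintype.ofFinite ι
  have _ : ∀ i, IsProbabilityMeasure (P.map (X i)) := fun i =>
    Measure.isProbabilityMeasure_map (hX i).aemeasurable
  have _ : ∀ i, IsProbabilityMeasure (Q.map (Y i)) := fun i =>
    Measure.isProbabilityMeasure_map (hY i).aemeasurable
  have hm : ∀ i, Measurable fun z : Ω × Ω₂ => (X i z.1, Y i z.2) := fun i =>
    ((hX i).comp measurable_fst).prodMk ((hY i).comp measurable_snd)
  rw [iIndepFun_iff_map_fun_eq_pi_map fun i => (hm i).aemeasurable]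
  have hprod : ∀ i, (P.prod Q).map (fun z : Ω × Ω₂ => (X i z.1, Y i z.2)) =
      (P.map (X i)).prod (Q.map (Y i)) := fun i =>
    (Measure.map_prod_map P Q (hX i) (hY i)).symm
  simp only [hprod]
  have h1 := hXi.map_fun_eq_pi_map fun i => (hX i).aemeasurable
  have h2 := hYi.map_fun_eq_pi_map fun i => (hY i).aemeasurable
  have hXm : Measurable fun ω i => X i ω := measurable_pi_lambda _ hX
  have hYm : Measurable fun ω i => Y i ω := measurable_pi_lambda _ hY
  have h3 := Measure.map_prod_map P Q hXm hYm
  rw [h1, h2] at h3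
  have h4 := (measurePreserving_arrowProdEquivProdArrow ℝ ℝ ι (fun i => P.map (X i))
    (fun i => Q.map (Y i))).symm
  rw [← h4.map_eq, h3, Measure.map_map h4.measurable (hXm.prodMap hYm)]
  rfl

section Extension

variable {Ω ι : Type*}

/-- The family `X`, on the extension of its probability space by a family of real coordinates, with
the variables whose index satisfies `p` replaced by their corrected truncations. -/
noncomputable def correctOn (X : ι → Ω → ℝ) (K : ι → ℝ) (p : ι → Prop) [DecidablePred p] (i : ι)
    (z : Ω × (ι → ℝ)) : ℝ :=
  if p i then corrected (K i) (X i z.1, z.2 i) else X i z.1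

variable {X : ι → Ω → ℝ} {K : ι → ℝ} {p : ι → Prop} [DecidablePred p]

theorem correctOn_of_pos {i : ι} (hi : p i) (z : Ω × (ι → ℝ)) :
    correctOn X K p i z = corrected (K i) (X i z.1, z.2 i) :=
  if_pos hi

theorem correctOn_of_not {i : ι} (hi : ¬p i) (z : Ω × (ι → ℝ)) :
    correctOn X K p i z = X i z.1 :=
  if_neg hi

theorem abs_correctOn_le {i : ι} (hK : 0 ≤ K i) (hi : p i) (z : Ω × (ι → ℝ)) :
    |correctOn X K p i z| ≤ 2 * K i := by
  rw [correctOn_of_pos hi]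
  exact abs_corrected_le hK _

variable [MeasurableSpace Ω] {P : Measure Ω}

theorem measurable_correctOn (hX : ∀ i, Measurable (X i)) (i : ι) :
    Measurable (correctOn X K p i) := by
  have hpair : Measurable fun z : Ω × (ι → ℝ) => (X i z.1, z.2 i) :=
    ((hX i).comp measurable_fst).prodMk ((measurable_pi_apply i).comp measurable_snd)
  unfold correctOn
  split_ifs
  · exact (measurable_corrected (K i)).comp hpair
  · exact (hX i).comp measurable_fst

/-- The extension of the probability space `(Ω, P)` by independent coordinates, independent of `Ω`:
the `i`-th one corrects the truncation of the variable `X i` at the level `K i`. -/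
noncomputable def extension (P : Measure Ω) (X : ι → Ω → ℝ) (K : ι → ℝ) : Measure (Ω × (ι → ℝ)) :=
  P.prod (Measure.infinitePi fun i => correctionLaw (P.map (X i)) (K i))

variable [IsProbabilityMeasure P] (hX : ∀ i, Measurable (X i))
  (hK : ∀ i, IsTruncationLevel (P.map (X i)) (K i))

include hX hK

theorem isProbabilityMeasure_correctionLaw_map (i : ι) :
    IsProbabilityMeasure (correctionLaw (P.map (X i)) (K i)) :=
  have _ := Measure.isProbabilityMeasure_map (μ := P) (hX i).aemeasurable
  (hK i).isProbabilityMeasure_correctionLaw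

theorem isProbabilityMeasure_extension : IsProbabilityMeasure (extension P X K) := by
  have _ := isProbabilityMeasure_correctionLaw_map hX hK
  unfold extension
  infer_instance

theorem measurePreserving_fst_extension : MeasurePreserving Prod.fst (extension P X K) P :=
  have _ := isProbabilityMeasure_correctionLaw_map hX hK
  measurePreserving_fst

theorem measurePreserving_pair_extension (i : ι) :
    MeasurePreserving (fun z : Ω × (ι → ℝ) => (X i z.1, z.2 i)) (extension P X K)
      ((P.map (X i)).prod (correctionLaw (P.map (X i)) (K i))) :=
  have _ := isProbabilityMeasure_correctionLaw_map hX hK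
  ((hX i).measurePreserving P).prod (measurePreserving_eval_infinitePi _ i)

theorem iIndepFun_correctOn {κ : Type*} [Finite κ] {g : κ → ι} (hg : Function.Injective g)
    (hind : iIndepFun (fun k => X (g k)) P) :
    iIndepFun (fun k => correctOn X K p (g k)) (extension P X K) := by
  have _ := isProbabilityMeasure_correctionLaw_map hX hK
  have hcoord : iIndepFun (fun (i : ι) (y : ι → ℝ) => y i)
      (Measure.infinitePi fun i => correctionLaw (P.map (X i)) (K i)) :=
    iIndepFun_infinitePi (X := fun _ => id) fun _ => measurable_id
  refine (iIndepFun_prodMk_of_prod (fun k => hX (g k)) (fun k => measurable_pi_apply (g k)) hind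
    (hcoord.precomp hg)).comp
    (fun k r => if p (g k) then corrected (K (g k)) r else r.1) fun k => ?_
  split_ifs
  exacts [measurable_corrected _, measurable_fst]

theorem memLp_correctOn {i : ι} {q : ENNReal} (hq : MemLp (X i) q P) :
    MemLp (correctOn X K p i) q (extension P X K) := by
  have _ := isProbabilityMeasure_extension hX hK
  by_cases hi : p i
  · exact MemLp.of_bound (measurable_correctOn hX i).aestronglyMeasurable (2 * K i)
      (Eventually.of_forall fun z => abs_correctOn_le (hK i).pos.le hi z)
  · simp only [funext (correctOn_of_not hi)]
    exact hq.comp_measurePreserving (measurePreserving_fst_extension hX hK)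

theorem integral_correctOn_pow (i : ι) (n : ℕ) :
    ∫ z, correctOn X K p i z ^ n ∂(extension P X K) =
      if p i then ∫ z, corrected (K i) z ^ n
        ∂((P.map (X i)).prod (correctionLaw (P.map (X i)) (K i))) else ∫ ω, X i ω ^ n ∂P := by
  split_ifs with hi
  · rw [← (measurePreserving_pair_extension hX hK i).map_eq, integral_map
      (measurePreserving_pair_extension hX hK i).aemeasurable
      ((measurable_corrected (K i)).pow_const n).aestronglyMeasurable]
    simp only [correctOn_of_pos hi]
  · simp only [correctOn_of_not hi]
    rw [← integral_map (φ := Prod.fst) (f := fun ω => X i ω ^ n) measurable_fst.aemeasurable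
      ((hX i).pow_const n).aestronglyMeasurable, (measurePreserving_fst_extension hX hK).map_eq]

theorem integral_correctOn (i : ι) : ∫ z, correctOn X K p i z ∂(extension P X K) = 0 := by
  have _ := Measure.isProbabilityMeasure_map (μ := P) (hX i).aemeasurable
  have hpow := integral_correctOn_pow (p := p) hX hK i 1
  simp only [pow_one, (hK i).integral_corrected] at hpow
  rw [hpow, ← integral_map (f := fun x => x) (hX i).aemeasurable (by fun_prop),
    (hK i).mean_eq_zero, ite_self]

theorem integral_correctOn_sq (i : ι) :
    ∫ z, correctOn X K p i z ^ 2 ∂(extension P X K) = ∫ ω, X i ω ^ 2 ∂P := by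
  have _ := Measure.isProbabilityMeasure_map (μ := P) (hX i).aemeasurable
  rw [integral_correctOn_pow hX hK, (hK i).integral_corrected_sq,
    integral_map (hX i).aemeasurable (by fun_prop), ite_self]

theorem integral_correctOn_pow_four_le {i : ι} (h4 : MemLp (X i) 4 P) :
    ∫ z, correctOn X K p i z ^ 4 ∂(extension P X K) ≤ 24 * ∫ ω, X i ω ^ 4 ∂P := by
  have _ := Measure.isProbabilityMeasure_map (μ := P) (hX i).aemeasurable
  have hint : Integrable (fun x => x ^ 4) (P.map (X i)) :=
    (integrable_map_measure (by fun_prop) (hX i).aemeasurable).2 (integrable_pow_of_memLp h4)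
  have hnonneg : 0 ≤ ∫ ω, X i ω ^ 4 ∂P := integral_nonneg fun ω => by positivity
  have hle := (hK i).integral_corrected_pow_four_le hint
  rw [integral_map (hX i).aemeasurable (by fun_prop)] at hle
  rw [integral_correctOn_pow hX hK]
  split_ifs <;> linarith

theorem measure_correctOn_ne_le (i : ι) :
    extension P X K {z | correctOn X K p i z ≠ X i z.1} ≤
      ENNReal.ofReal (4 * tailMoment (P.map (X i)) (K i) 2 / K i ^ 2) := by
  have _ := Measure.isProbabilityMeasure_map (μ := P) (hX i).aemeasurable
  by_cases hi : p i
  · have hset : MeasurableSet {z : ℝ × ℝ | corrected (K i) z ≠ z.1} :=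
      (measurableSet_eq_fun (measurable_corrected (K i)) measurable_fst).compl
    simp only [correctOn_of_pos hi]
    exact ((measurePreserving_pair_extension hX hK i).measure_preimage
      hset.nullMeasurableSet).trans_le (hK i).measure_corrected_ne_le
  · simp [correctOn_of_not hi]

end Extension

theorem exists_tendsto_diagonal {g : ℕ → ℕ → ℝ} (hg : ∀ n, Tendsto (g n) atTop (𝓝 0)) :
    ∃ k : ℕ → ℕ, Tendsto k atTop atTop ∧ Tendsto (fun N => g (k N) N) atTop (𝓝 0) := by
  have h : ∀ n : ℕ, ∃ M : ℕ, ∀ N ≥ M, |g n N| ≤ 1 / ((n : ℝ) + 1) := fun n => by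
    obtain ⟨M, hM⟩ := Metric.tendsto_atTop.1 (hg n) (1 / ((n : ℝ) + 1)) (by positivity)
    exact ⟨M, fun N hN => by simpa using (hM N hN).le⟩
  choose M hM using h
  let k : ℕ → ℕ := fun N => Nat.findGreatest (fun n => M n ≤ N) N
  have hk : Tendsto k atTop atTop := by
    refine tendsto_atTop.2 fun b => ?_
    filter_upwards [eventually_ge_atTop (max b (M b))] with N hN
    exact Nat.le_findGreatest ((le_max_left _ _).trans hN) ((le_max_right _ _).trans hN)
  refine ⟨k, hk, squeeze_zero_norm' ?_ (tendsto_one_div_add_atTop_nhds_zero_nat.comp hk)⟩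
  filter_upwards [eventually_ge_atTop (M 0)] with N hN
  exact hM (k N) N (Nat.findGreatest_spec (P := fun n => M n ≤ N) (Nat.zero_le N) hN)

theorem exists_tendsto_inv_pow_mul {ι : Type*} (I : Finset ι) {L : ι → ℝ → ℕ → ℝ}
    (hnonneg : ∀ i ε N, 0 ≤ L i ε N) (hanti : ∀ i N, Antitone fun ε => L i ε N)
    (hL : ∀ i ∈ I, ∀ ε, 0 < ε → Tendsto (L i ε) atTop (𝓝 0)) (p : ℕ) :
    ∃ η : ℕ → ℝ, (∀ N, 0 < η N) ∧ Tendsto η atTop (𝓝 0) ∧ ∀ δ : ℕ → ℝ, (∀ N, η N ≤ δ N) →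
      ∀ i ∈ I, Tendsto (fun N => (δ N)⁻¹ ^ p * L i (δ N) N) atTop (𝓝 0) := by
  have hsum : ∀ n : ℕ, Tendsto (fun N => ∑ i ∈ I, ((n : ℝ) + 1) ^ p * L i (1 / ((n : ℝ) + 1)) N)
      atTop (𝓝 0) := fun n => by
    simpa using tendsto_finsetSum I fun i hi =>
      (hL i hi (1 / ((n : ℝ) + 1)) (by positivity)).const_mul (((n : ℝ) + 1) ^ p)
  obtain ⟨k, hk, hdiag⟩ := exists_tendsto_diagonal hsum
  refine ⟨fun N => 1 / ((k N : ℝ) + 1), fun N => by positivity,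
    tendsto_one_div_add_atTop_nhds_zero_nat.comp hk, fun δ hδ i hi => ?_⟩
  have hδ0 : ∀ N, 0 < δ N := fun N => lt_of_lt_of_le (by positivity) (hδ N)
  have hterm : ∀ N, ∀ j ∈ I, 0 ≤ ((k N : ℝ) + 1) ^ p * L j (1 / ((k N : ℝ) + 1)) N :=
    fun N j _ => mul_nonneg (by positivity) (hnonneg _ _ _)
  refine squeeze_zero (fun N => mul_nonneg (by have := hδ0 N; positivity) (hnonneg _ _ _))
    (fun N => ?_) hdiag
  have hinv : (δ N)⁻¹ ≤ (k N : ℝ) + 1 := by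
    simpa using inv_anti₀ (by positivity) (hδ N)
  calc (δ N)⁻¹ ^ p * L i (δ N) N ≤ ((k N : ℝ) + 1) ^ p * L i (1 / ((k N : ℝ) + 1)) N :=
        mul_le_mul (pow_le_pow_left₀ (inv_nonneg.2 (hδ0 N).le) hinv p) (hanti i N (hδ N))
          (hnonneg _ _ _) (by positivity)
    _ ≤ ∑ j ∈ I, ((k N : ℝ) + 1) ^ p * L j (1 / ((k N : ℝ) + 1)) N :=
        Finset.single_le_sum (hterm N) hi

/-- The truncation level `δ N * N ^ (1 / 4)` for matrices of size `N`, where `N = 0` is read as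
`N = 1` to keep the level positive. -/
noncomputable def truncationLevel (δ : ℕ → ℝ) (N : ℕ) : ℝ :=
  δ N * ((max N 1 : ℕ) : ℝ) ^ (1 / 4 : ℝ)

theorem truncationLevel_pos {δ : ℕ → ℝ} {N : ℕ} (hδ : 0 < δ N) : 0 < truncationLevel δ N :=
  mul_pos hδ (by positivity)

theorem truncationLevel_of_pos (δ : ℕ → ℝ) {N : ℕ} (hN : 0 < N) :
    truncationLevel δ N = δ N * (N : ℝ) ^ (1 / 4 : ℝ) := by
  rw [truncationLevel, max_eq_left hN]

theorem exists_truncationLevel_ge {η : ℕ → ℝ} (hη : Tendsto η atTop (𝓝 0)) {c : ℝ} (hc : 0 ≤ c) :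
    ∃ δ : ℕ → ℝ, (∀ N, η N ≤ δ N) ∧ Tendsto δ atTop (𝓝 0) ∧ (∀ N, c ≤ truncationLevel δ N) ∧
      Tendsto (truncationLevel δ) atTop atTop := by
  have hcast : Tendsto (fun N : ℕ => ((max N 1 : ℕ) : ℝ)) atTop atTop :=
    tendsto_natCast_atTop_atTop.comp (tendsto_atTop_mono (fun N => le_max_left N 1) tendsto_id)
  let δ : ℕ → ℝ := fun N => max (η N) ((c + 1) * ((max N 1 : ℕ) : ℝ) ^ (-(1 / 8) : ℝ))
  have hlevel : ∀ N, (c + 1) * ((max N 1 : ℕ) : ℝ) ^ (1 / 8 : ℝ) ≤ truncationLevel δ N := by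
    intro N
    have hN : (0 : ℝ) < (max N 1 : ℕ) := by positivity
    calc (c + 1) * ((max N 1 : ℕ) : ℝ) ^ (1 / 8 : ℝ)
        = (c + 1) * ((max N 1 : ℕ) : ℝ) ^ (-(1 / 8) : ℝ) * ((max N 1 : ℕ) : ℝ) ^ (1 / 4 : ℝ) := by
          rw [mul_assoc, ← Real.rpow_add hN]
          norm_num
      _ ≤ truncationLevel δ N := mul_le_mul_of_nonneg_right (le_max_right _ _) (by positivity)
  refine ⟨δ, fun N => le_max_left _ _, ?_, fun N => ?_, tendsto_atTop_mono hlevel ?_⟩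
  · have hmax := hη.max
      (((tendsto_rpow_neg_atTop (y := 1 / 8) (by norm_num)).comp hcast).const_mul (c + 1))
    rwa [mul_zero, max_self] at hmax
  · have hone : (1 : ℝ) ≤ ((max N 1 : ℕ) : ℝ) ^ (1 / 8 : ℝ) :=
      Real.one_le_rpow (by exact_mod_cast le_max_right N 1) (by norm_num)
    nlinarith [hlevel N]
  · exact ((tendsto_rpow_atTop (by norm_num)).comp hcast).const_mul_atTop (by positivity)

theorem tendsto_measure_of_tendsto_compl {α Ω : Type*} [MeasurableSpace Ω] {P : Measure Ω}
    [IsProbabilityMeasure P] {l : Filter α} {S : α → Set Ω}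
    (h : Tendsto (fun a => P (S a)ᶜ) l (𝓝 0)) : Tendsto (fun a => P (S a)) l (𝓝 1) := by
  have hsub : Tendsto (fun a => 1 - P (S a)ᶜ) l (𝓝 1) := by
    simpa using ENNReal.Tendsto.sub tendsto_const_nhds h (Or.inl ENNReal.one_ne_top)
  refine tendsto_of_tendsto_of_tendsto_of_le_of_le hsub tendsto_const_nhds (fun a => ?_)
    fun a => prob_le_one
  rw [tsub_le_iff_right, ← measure_univ (μ := P), ← Set.union_compl_self (S a)]
  exact measure_union_le _ _

theorem tailMoment_map_le {Ω : Type*} [MeasurableSpace Ω] {P : Measure Ω} {X : Ω → ℝ}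
    (hX : Measurable X) {n : ℕ} (hn : Even n) (hint : Integrable (fun ω => X ω ^ n) P) (K : ℝ) :
    tailMoment (P.map X) K n ≤ ∫ ω in {ω | K ≤ |X ω|}, |X ω| ^ n ∂P := by
  rw [tailMoment, setIntegral_map (measurableSet_lt_abs K) (by fun_prop) hX.aemeasurable]
  simp only [hn.pow_abs]
  exact setIntegral_mono_set hint.integrableOn (Eventually.of_forall fun ω => hn.pow_nonneg _)
    (Eventually.of_forall fun ω hω => le_of_lt hω)

theorem lindebergRow_nonneg {Ω : Type u} [MeasurableSpace Ω] (P : Measure Ω)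
    (W : (N : ℕ) → Ω → Matrix (Fin N) (Fin N) ℝ) (i : ℕ) (ε : ℝ) (N : ℕ) :
    0 ≤ lindebergRow P W i ε N := by
  unfold lindebergRow
  split_ifs
  · exact mul_nonneg (by positivity) (Finset.sum_nonneg fun j _ =>
      integral_nonneg fun ω => by positivity)
  · exact le_rfl

/-- The places on and above the diagonal in the matrices of all sizes. -/
abbrev EntryIndex : Type := Σ N : ℕ, Sym2 (Fin N)

/-- The places in the first `m` rows or columns. -/
abbrev InFirstRows (m : ℕ) (q : EntryIndex) : Prop :=
  (q.2.inf : ℕ) < m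

/-- The entries on and above the diagonal of all matrices of a sequence, as a single family. -/
def entryFamily {Ω : Type u} (W : (N : ℕ) → Ω → Matrix (Fin N) (Fin N) ℝ)
    (q : EntryIndex) (ω : Ω) : ℝ :=
  upperEntry (W q.1 ω) q.2

/-- The symmetric matrices obtained from `W` by truncating the entries of the first `m` rows and
columns at the levels `K N` and correcting them on the extension of the probability space. -/
noncomputable def truncatedMatrix {Ω : Type u} (W : (N : ℕ) → Ω → Matrix (Fin N) (Fin N) ℝ)
    (K : ℕ → ℝ) (m N : ℕ) (z : Ω × (EntryIndex → ℝ)) : Matrix (Fin N) (Fin N) ℝ :=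
  symMat fun p => correctOn (entryFamily W) (fun q => K q.1) (InFirstRows m) ⟨N, p⟩ z

namespace IsRealWigner

variable {Ω : Type u} [MeasurableSpace Ω] {P : Measure Ω}
  {W : (N : ℕ) → Ω → Matrix (Fin N) (Fin N) ℝ} {σ σ₁ m₄ : ℝ} (hW : IsRealWigner P W σ σ₁ m₄)
include hW

theorem mean (N : ℕ) (j k : Fin N) : ∫ ω, W N ω j k ∂P = 0 := by
  obtain rfl | h := eq_or_ne j k
  exacts [hW.mean_diag N j, hW.mean_offDiag N j k h]

theorem integral_sq_le (N : ℕ) (j k : Fin N) : ∫ ω, W N ω j k ^ 2 ∂P ≤ σ ^ 2 + σ₁ ^ 2 := by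
  obtain rfl | h := eq_or_ne j k
  · linarith [hW.second_moment_le N j, sq_nonneg σ]
  · linarith [hW.integral_sq_offDiag h, sq_nonneg σ₁]

theorem memLp_two [IsFiniteMeasure P] (N : ℕ) (j k : Fin N) : MemLp (fun ω => W N ω j k) 2 P := by
  obtain rfl | h := eq_or_ne j k
  exacts [hW.memLp_diag N j, (hW.memLp_offDiag N j k h).mono_exponent (by norm_num)]

theorem integrable_pow_four [IsFiniteMeasure P] {N : ℕ} {j k : Fin N} (h : j ≠ k) :
    Integrable (fun ω => W N ω j k ^ 4) P :=
  integrable_pow_of_memLp (hW.memLp_offDiag N j k h)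

theorem variance_diag_le [IsFiniteMeasure P] (N : ℕ) (i : Fin N) :
    variance (fun ω => W N ω i i) P ≤ σ₁ ^ 2 := by
  rw [variance_of_integral_eq_zero (hW.measurable N i i).aemeasurable (hW.mean_diag N i)]
  exact hW.second_moment_le N i

theorem lindebergRow_antitone [IsFiniteMeasure P] (i N : ℕ) :
    Antitone fun ε => lindebergRow P W i ε N := by
  intro ε ε' hε
  unfold lindebergRow
  split_ifs with hi
  · refine mul_le_mul_of_nonneg_left (Finset.sum_le_sum fun j hj => ?_) (by positivity)
    have hint := hW.integrable_pow_four (Finset.ne_of_mem_erase hj).symm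
    refine setIntegral_mono_set (Integrable.integrableOn ?_)
      (Eventually.of_forall fun ω => by positivity) (Eventually.of_forall fun ω hω => ?_)
    · simpa only [Even.pow_abs ⟨2, rfl⟩] using hint
    · exact (mul_le_mul_of_nonneg_right hε (by positivity)).trans hω
  · exact le_rfl

theorem sum_tailMoment_le [IsProbabilityMeasure P] {N : ℕ} (i : Fin N) {e : ℝ} (he : 0 < e) :
    ∑ k, 4 * tailMoment (P.map fun ω => W N ω i k) (e * (N : ℝ) ^ (1 / 4 : ℝ)) 2 /
        (e * (N : ℝ) ^ (1 / 4 : ℝ)) ^ 2 ≤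
      4 * σ₁ ^ 2 / (e * (N : ℝ) ^ (1 / 4 : ℝ)) ^ 2 + 4 * (e⁻¹ ^ 4 * lindebergRow P W i e N) := by
  have hN : (0 : ℝ) < N := by exact_mod_cast i.pos
  set K : ℝ := e * (N : ℝ) ^ (1 / 4 : ℝ) with hKdef
  have hK : 0 < K := by positivity
  have hK4 : K ^ 4 = e ^ 4 * N := by
    rw [hKdef, mul_pow, ← Real.rpow_mul_natCast hN.le]
    norm_num
  rw [← Finset.add_sum_erase _ _ (Finset.mem_univ i)]
  refine add_le_add ?_ ?_
  · have hm := (hW.measurable N i i).aemeasurable (μ := P)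
    have hint : Integrable (fun x => x ^ 2) (P.map fun ω => W N ω i i) :=
      (integrable_map_measure (by fun_prop) hm).2 (integrable_pow_of_memLp (hW.memLp_diag N i))
    gcongr
    refine (tailMoment_le even_two hint).trans ?_
    rw [integral_map hm (by fun_prop)]
    exact hW.second_moment_le N i
  · rw [lindebergRow, dif_pos i.2, Finset.mul_sum, Finset.mul_sum, Finset.mul_sum]
    refine Finset.sum_le_sum fun k hk => ?_
    have hm := hW.measurable N i k
    have hint := hW.integrable_pow_four (Finset.ne_of_mem_erase hk).symm
    have hint' : Integrable (fun x => x ^ (2 + 2)) (P.map fun ω => W N ω i k) :=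
      (integrable_map_measure (by fun_prop) hm.aemeasurable).2 hint
    have htail := (sq_mul_tailMoment_le hK.le even_two hint').trans
      (tailMoment_map_le hm ⟨2, rfl⟩ hint K)
    calc 4 * tailMoment (P.map fun ω => W N ω i k) K 2 / K ^ 2
        = 4 * (K ^ 2 * tailMoment (P.map fun ω => W N ω i k) K 2) / K ^ 4 := by field_simp
      _ ≤ 4 * (∫ ω in {ω | K ≤ |W N ω i k|}, |W N ω i k| ^ 4 ∂P) / K ^ 4 := by gcongr
      _ = _ := by
        rw [hK4]
        field_simp
        rfl

theorem isTruncationLevel_entryFamily [IsProbabilityMeasure P] {K : ℝ} (hK : 0 < K)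
    (hK2 : 2 * (σ ^ 2 + σ₁ ^ 2) ≤ K ^ 2) (q : EntryIndex) :
    IsTruncationLevel (P.map (entryFamily W q)) K := by
  obtain ⟨N, p⟩ := q
  have hm : AEMeasurable (entryFamily W ⟨N, p⟩) P := (hW.measurable_upperEntry N p).aemeasurable
  refine ⟨(memLp_map_measure_iff aestronglyMeasurable_id hm).2 (hW.memLp_two N _ _), ?_, hK, ?_⟩
  · rw [integral_map hm (by fun_prop)]
    exact hW.mean N _ _
  · rw [integral_map hm (by fun_prop)]
    have := hW.integral_sq_le N p.inf p.sup
    linarith!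

end IsRealWigner

section TruncatedMatrix

variable {Ω : Type u} {W : (N : ℕ) → Ω → Matrix (Fin N) (Fin N) ℝ} {K : ℕ → ℝ} {m N : ℕ}

theorem truncatedMatrix_apply (z : Ω × (EntryIndex → ℝ)) (j k : Fin N) :
    truncatedMatrix W K m N z j k = correctOn (entryFamily W) (fun q => K q.1)
      (InFirstRows m) ⟨N, s(j, k)⟩ z :=
  symMat_apply _ j k

theorem abs_truncatedMatrix_le (hK : 0 ≤ K N) {i : Fin N} (hi : (i : ℕ) < m) (k : Fin N)
    (z : Ω × (EntryIndex → ℝ)) : |truncatedMatrix W K m N z i k| ≤ 2 * K N := by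
  have hinf : InFirstRows m ⟨N, s(i, k)⟩ := lt_of_le_of_lt (Fin.le_def.1 inf_le_left) hi
  rw [truncatedMatrix_apply]
  exact abs_correctOn_le (K := fun q : EntryIndex => K q.1) hK hinf z

variable [MeasurableSpace Ω] {P : Measure Ω} {σ σ₁ m₄ : ℝ}

namespace IsRealWigner

variable (hW : IsRealWigner P W σ σ₁ m₄)
include hW

theorem entryFamily_mk (j k : Fin N) : entryFamily W ⟨N, s(j, k)⟩ = fun ω => W N ω j k :=
  funext fun ω => hW.upperEntry_mk ω j k

theorem measurable_entryFamily (q : EntryIndex) : Measurable (entryFamily W q) :=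
  hW.measurable_upperEntry q.1 q.2

theorem truncatedMatrix_of_le {j k : Fin N} (hj : m ≤ j) (hk : m ≤ k)
    (z : Ω × (EntryIndex → ℝ)) : truncatedMatrix W K m N z j k = W N z.1 j k := by
  have hinf : ¬InFirstRows m ⟨N, s(j, k)⟩ := by
    rcases min_choice j k with h | h <;> simp [InFirstRows, h, hj, hk]
  rw [truncatedMatrix_apply, correctOn_of_not hinf, hW.entryFamily_mk]

variable [IsProbabilityMeasure P]
  (hK : ∀ q : EntryIndex, IsTruncationLevel (P.map (entryFamily W q)) (K q.1))
include hK

theorem isRealWigner_truncatedMatrix (m : ℕ) :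
    IsRealWigner (extension P (entryFamily W) fun q => K q.1) (truncatedMatrix W K m) σ σ₁
      (24 * m₄) := by
  have hm := hW.measurable_entryFamily
  have hmeas : ∀ (N : ℕ) (j k : Fin N), Measurable fun z => truncatedMatrix W K m N z j k :=
    fun N j k => by simpa only [truncatedMatrix_apply] using measurable_correctOn hm _
  have hmean : ∀ (N : ℕ) (j k : Fin N), ∫ z, truncatedMatrix W K m N z j k
      ∂(extension P (entryFamily W) fun q => K q.1) = 0 := fun N j k => by
    simpa only [truncatedMatrix_apply] using integral_correctOn hm hK _
  have hsq : ∀ (N : ℕ) (j k : Fin N), ∫ z, truncatedMatrix W K m N z j k ^ 2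
      ∂(extension P (entryFamily W) fun q => K q.1) = ∫ ω, W N ω j k ^ 2 ∂P := fun N j k => by
    simp only [truncatedMatrix_apply, integral_correctOn_sq hm hK, hW.entryFamily_mk]
  have hmemLp : ∀ (q : ENNReal) (N : ℕ) (j k : Fin N), MemLp (fun ω => W N ω j k) q P →
      MemLp (fun z => truncatedMatrix W K m N z j k) q
        (extension P (entryFamily W) fun q => K q.1) := fun q N j k h => by
    rw [← hW.entryFamily_mk] at h
    simpa only [truncatedMatrix_apply] using memLp_correctOn hm hK h
  refine ⟨hmeas, fun N z => symMat_isSymm _, fun N => ?_,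
    fun N j k h => hmemLp 4 N j k (hW.memLp_offDiag N j k h), fun N j k _ => hmean N j k,
    fun N j k h => ?_, fun N j k h => ?_, fun N i => hmemLp 2 N i i (hW.memLp_diag N i),
    fun N i => hmean N i i, fun N i => (hsq N i i).trans_le (hW.second_moment_le N i)⟩
  · have hg : Function.Injective fun p : Sym2 (Fin N) => (⟨N, p⟩ : EntryIndex) :=
      fun _ _ h => eq_of_heq (Sigma.mk.inj h).2
    simp only [truncatedMatrix_apply]
    exact (iIndepFun_correctOn hm hK hg (hW.iIndepFun_upperEntry N)).precomp
      Sym2.sortEquiv.symm.injective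
  · rw [variance_of_integral_eq_zero (hmeas N j k).aemeasurable (hmean N j k), hsq,
      hW.integral_sq_offDiag h]
  · have h4 := hW.memLp_offDiag N j k h
    have hle := hW.fourth_moment_le N j k h
    rw [← hW.entryFamily_mk] at h4
    have hcorrect := integral_correctOn_pow_four_le (p := InFirstRows m)
      hm hK h4
    simp only [hW.entryFamily_mk] at hcorrect
    simp only [truncatedMatrix_apply]
    linarith

theorem measure_truncatedMatrix_ne_le (i k : Fin N) :
    extension P (entryFamily W) (fun q => K q.1)
        {z | truncatedMatrix W K m N z i k ≠ W N z.1 i k} ≤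
      ENNReal.ofReal (4 * tailMoment (P.map fun ω => W N ω i k) (K N) 2 / K N ^ 2) := by
  have hm := hW.measurable_entryFamily
  have hle := measure_correctOn_ne_le (p := InFirstRows m) hm hK
    ⟨N, s(i, k)⟩
  simp only [hW.entryFamily_mk] at hle
  simpa only [truncatedMatrix_apply] using hle

theorem measure_truncatedMatrix_row_ne_le (i : Fin N) {e : ℝ} (he : 0 < e)
    (hKe : K N = e * (N : ℝ) ^ (1 / 4 : ℝ)) :
    extension P (entryFamily W) (fun q => K q.1)
        {z | ∃ k, truncatedMatrix W K m N z i k ≠ W N z.1 i k} ≤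
      ENNReal.ofReal (4 * σ₁ ^ 2 / K N ^ 2 + 4 * (e⁻¹ ^ 4 * lindebergRow P W i e N)) := by
  have hterm : ∀ k, 0 ≤ 4 * tailMoment (P.map fun ω => W N ω i k) (K N) 2 / K N ^ 2 := fun k => by
    have := tailMoment_nonneg (μ := P.map fun ω => W N ω i k) (K := K N) even_two
    positivity
  rw [Set.ofPred_exists]
  calc extension P (entryFamily W) (fun q => K q.1)
        (⋃ k, {z | truncatedMatrix W K m N z i k ≠ W N z.1 i k})
      ≤ ∑ k, extension P (entryFamily W) (fun q => K q.1)
          {z | truncatedMatrix W K m N z i k ≠ W N z.1 i k} := measure_iUnion_fintype_le _ _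
    _ ≤ ∑ k, ENNReal.ofReal (4 * tailMoment (P.map fun ω => W N ω i k) (K N) 2 / K N ^ 2) :=
      Finset.sum_le_sum fun k _ => hW.measure_truncatedMatrix_ne_le hK i k
    _ = ENNReal.ofReal (∑ k, 4 * tailMoment (P.map fun ω => W N ω i k) (K N) 2 / K N ^ 2) :=
      (ENNReal.ofReal_sum_of_nonneg fun k _ => hterm k).symm
    _ ≤ _ := by
      rw [hKe]
      exact ENNReal.ofReal_le_ofReal (hW.sum_tailMoment_le i he)

end IsRealWigner

variable [IsProbabilityMeasure P] {δ : ℕ → ℝ}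

theorem IsRealWigner.measure_truncatedMatrix_rows_eq_compl_le (hW : IsRealWigner P W σ σ₁ m₄)
    (hδ : ∀ N, 0 < δ N)
    (hK : ∀ q : EntryIndex, IsTruncationLevel (P.map (entryFamily W q)) (truncationLevel δ q.1))
    (m N : ℕ) :
    extension P (entryFamily W) (fun q => truncationLevel δ q.1)
        {z | ∀ i k : Fin N, (i : ℕ) < m →
          truncatedMatrix W (truncationLevel δ) m N z i k = W N z.1 i k}ᶜ ≤
      ∑ i ∈ Finset.range m, ENNReal.ofReal (4 * σ₁ ^ 2 / truncationLevel δ N ^ 2 +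
        4 * ((δ N)⁻¹ ^ 4 * lindebergRow P W i (δ N) N)) := by
  let R : ℕ → Set (Ω × (EntryIndex → ℝ)) := fun n =>
    {z | ∃ i : Fin N, i = n ∧ ∃ k, truncatedMatrix W (truncationLevel δ) m N z i k ≠ W N z.1 i k}
  have hsub : {z | ∀ i k : Fin N, (i : ℕ) < m →
      truncatedMatrix W (truncationLevel δ) m N z i k = W N z.1 i k}ᶜ ⊆
        ⋃ n ∈ Finset.range m, R n := fun z hz => by
    simp only [Set.mem_compl_iff, Set.mem_ofPred_eq, not_forall] at hz
    obtain ⟨i, k, hi, hne⟩ := hz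
    exact Set.mem_biUnion (Finset.mem_coe.2 (Finset.mem_range.2 hi)) ⟨i, rfl, k, hne⟩
  refine (measure_mono hsub).trans ((measure_biUnion_finset_le (Finset.range m) R).trans
    (Finset.sum_le_sum fun n _ => ?_))
  by_cases hn : n < N
  · have hrow : R n ⊆ {z | ∃ k, truncatedMatrix W (truncationLevel δ) m N z ⟨n, hn⟩ k ≠
        W N z.1 ⟨n, hn⟩ k} := by
      rintro z ⟨i, rfl, hne⟩
      exact hne
    exact (measure_mono hrow).trans (hW.measure_truncatedMatrix_row_ne_le hK ⟨n, hn⟩ (hδ N)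
      (truncationLevel_of_pos δ (Nat.zero_lt_of_lt hn)))
  · have hempty : R n = ∅ := Set.eq_empty_of_forall_notMem fun z ⟨i, hi, _⟩ => hn (hi ▸ i.2)
    simp [hempty]

theorem IsRealWigner.tendsto_measure_truncatedMatrix_rows_eq (hW : IsRealWigner P W σ σ₁ m₄)
    (hδ : ∀ N, 0 < δ N)
    (hK : ∀ q : EntryIndex, IsTruncationLevel (P.map (entryFamily W q)) (truncationLevel δ q.1))
    (hlevel : Tendsto (truncationLevel δ) atTop atTop)
    (hrow : ∀ i < m, Tendsto (fun N => (δ N)⁻¹ ^ 4 * lindebergRow P W i (δ N) N) atTop (𝓝 0)) :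
    Tendsto (fun N => extension P (entryFamily W) (fun q => truncationLevel δ q.1)
      {z | ∀ i k : Fin N, (i : ℕ) < m →
        truncatedMatrix W (truncationLevel δ) m N z i k = W N z.1 i k}) atTop (𝓝 1) := by
  have hdiag : Tendsto (fun N => 4 * σ₁ ^ 2 / truncationLevel δ N ^ 2) atTop (𝓝 0) :=
    ((tendsto_pow_atTop two_ne_zero).comp hlevel).const_div_atTop _
  have hbound : ∀ i ∈ Finset.range m, Tendsto (fun N => ENNReal.ofReal
      (4 * σ₁ ^ 2 / truncationLevel δ N ^ 2 + 4 * ((δ N)⁻¹ ^ 4 * lindebergRow P W i (δ N) N)))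
      atTop (𝓝 0) := fun i hi => by
    have hsum := hdiag.add ((hrow i (Finset.mem_range.1 hi)).const_mul 4)
    rw [mul_zero, add_zero] at hsum
    simpa only [ENNReal.ofReal_zero] using ENNReal.tendsto_ofReal hsum
  have _ := isProbabilityMeasure_extension hW.measurable_entryFamily hK
  exact tendsto_measure_of_tendsto_compl (tendsto_of_tendsto_of_tendsto_of_le_of_le
    tendsto_const_nhds (by simpa using tendsto_finsetSum _ hbound) (fun N => zero_le)
    (hW.measure_truncatedMatrix_rows_eq_compl_le hδ hK m))

end TruncatedMatrix

theorem proposition4p2_general {σ σ₁ m₄ : ℝ} {Ω : Type u} [MeasurableSpace Ω] {P : Measure Ω}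
    [IsProbabilityMeasure P] {W : (N : ℕ) → Ω → Matrix (Fin N) (Fin N) ℝ}
    (hW : IsRealWigner P W σ σ₁ m₄) (m : ℕ)
    (hL : ∀ i : ℕ, i < m → ∀ ε : ℝ, 0 < ε → Tendsto (lindebergRow P W i ε) atTop (𝓝 0)) :
    ∃ (Ω' : Type u) (_ : MeasurableSpace Ω') (P' : Measure Ω') (_ : IsProbabilityMeasure P')
      (π : Ω' → Ω) (T : (N : ℕ) → Ω' → Matrix (Fin N) (Fin N) ℝ) (ε : ℕ → ℝ),
      MeasurePreserving π P' P ∧ IsRealWigner P' T σ σ₁ (24 * m₄) ∧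
      (∀ N, 0 < ε N) ∧ Tendsto ε atTop (𝓝 0) ∧
      (∀ (N : ℕ) (ω : Ω') (j k : Fin N), m ≤ (j : ℕ) → m ≤ (k : ℕ) →
        T N ω j k = W N (π ω) j k) ∧
      Tendsto (fun N : ℕ => P' {ω | ∀ i k : Fin N, (i : ℕ) < m →
        T N ω i k = W N (π ω) i k}) atTop (𝓝 1) ∧
      (∀ (N : ℕ) (ω : Ω') (i k : Fin N), (i : ℕ) < m →
        |T N ω i k| ≤ ε N * (N : ℝ) ^ (1 / 4 : ℝ)) ∧
      (∀ s : ℝ, 5 / 2 < s → ∀ f : ℝ → ℝ, Continuous f → MemSobolevH s f →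
        ∀ (N : ℕ) (i j : Fin N),
          MemLp (fun ω => matrixFunEntry f (T N ω) i j) 2 P' ∧
          variance (fun ω => matrixFunEntry f (T N ω) i j) P' ≤
            varianceConst σ σ₁ (24 * m₄) s * sobolevNormSq s f / N) := by
  obtain ⟨η, hη, hηlim, hηrow⟩ := exists_tendsto_inv_pow_mul (Finset.range m)
    (lindebergRow_nonneg P W) hW.lindebergRow_antitone (by simpa only [Finset.mem_range] using hL) 4
  obtain ⟨δ, hηδ, hδlim, hge, hlevel⟩ :=
    exists_truncationLevel_ge hηlim (Real.sqrt_nonneg (2 * (σ ^ 2 + σ₁ ^ 2)))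
  have hδ : ∀ N, 0 < δ N := fun N => (hη N).trans_le (hηδ N)
  have hK : ∀ q : EntryIndex,
      IsTruncationLevel (P.map (entryFamily W q)) (truncationLevel δ q.1) := fun q =>
    hW.isTruncationLevel_entryFamily (truncationLevel_pos (hδ _)) (Real.sqrt_le_iff.1 (hge _)).2 q
  have hT := hW.isRealWigner_truncatedMatrix hK m
  have hP' := isProbabilityMeasure_extension hW.measurable_entryFamily hK
  refine ⟨_, _, _, hP', Prod.fst, truncatedMatrix W (truncationLevel δ) m, fun N => 2 * δ N,
    measurePreserving_fst_extension hW.measurable_entryFamily hK, hT,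
    fun N => mul_pos two_pos (hδ N), by simpa using hδlim.const_mul 2,
    fun N z j k hj hk => hW.truncatedMatrix_of_le hj hk z,
    hW.tendsto_measure_truncatedMatrix_rows_eq hδ hK hlevel fun i hi =>
      hηrow δ hηδ i (Finset.mem_range.2 hi),
    fun N z i k hi => ?_, fun s hs f hc hf N i j => hT.variance_matrixFunEntry_le hs hc hf N i j⟩
  rw [mul_assoc, ← truncationLevel_of_pos δ i.pos]
  exact abs_truncatedMatrix_le (truncationLevel_pos (hδ N)).le hi k z

/-- The constant `C s` depends on `s`, `σ`, `σ₁`, `m₄` only. The matrices `T N` live on an extension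
`π : Ω' → Ω` of the given probability space and do not depend on `s` or `f`. -/
theorem proposition4p2 (σ σ₁ m₄ : ℝ) :
    ∃ C : ℝ → ℝ,
      ∀ (Ω : Type u) [MeasurableSpace Ω] (P : Measure Ω) [IsProbabilityMeasure P]
        (W : (N : ℕ) → Ω → Matrix (Fin N) (Fin N) ℝ) (m : ℕ),
        IsRealWigner P W σ σ₁ m₄ → 1 ≤ m →
        (∀ i : ℕ, i < m → ∀ ε : ℝ, 0 < ε → Tendsto (lindebergRow P W i ε) atTop (𝓝 0)) →
        ∃ (Ω' : Type u) (_ : MeasurableSpace Ω') (P' : Measure Ω') (_ : IsProbabilityMeasure P')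
          (π : Ω' → Ω) (T : (N : ℕ) → Ω' → Matrix (Fin N) (Fin N) ℝ) (ε : ℕ → ℝ),
          MeasurePreserving π P' P ∧
          (∃ σ₁' m₄' : ℝ, IsRealWigner P' T σ σ₁' m₄') ∧
          (∀ N, 0 < ε N) ∧ Tendsto ε atTop (𝓝 0) ∧
          -- the entries outside the first `m` rows and columns are unchanged
          (∀ (N : ℕ) (ω : Ω') (j k : Fin N), m ≤ (j : ℕ) → m ≤ (k : ℕ) →
            T N ω j k = W N (π ω) j k) ∧
          -- the first `m` rows are unchanged with probability tending to one
          Tendsto (fun N : ℕ => P' {ω | ∀ i k : Fin N, (i : ℕ) < m →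
            T N ω i k = W N (π ω) i k}) atTop (𝓝 1) ∧
          (∀ (N : ℕ) (i k : Fin N), (i : ℕ) < m → ∫ ω, T N ω i k ∂P' = 0) ∧
          (∀ (N : ℕ) (i k : Fin N), (i : ℕ) < m → i ≠ k →
            variance (fun ω => T N ω i k) P' = σ ^ 2) ∧
          (∃ B : ℝ, ∀ (N : ℕ) (i : Fin N), (i : ℕ) < m →
            variance (fun ω => T N ω i i) P' ≤ B) ∧
          (∃ B : ℝ, ∀ (N : ℕ) (i k : Fin N), (i : ℕ) < m → i ≠ k →
            ∫ ω, (T N ω i k) ^ 4 ∂P' ≤ B) ∧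
          (∀ (N : ℕ) (ω : Ω') (i k : Fin N), (i : ℕ) < m →
            |T N ω i k| ≤ ε N * (N : ℝ) ^ (1 / 4 : ℝ)) ∧
          -- the variance bound
          (∀ s : ℝ, 3 < s → ∀ f : ℝ → ℝ, Continuous f → MemSobolevH s f →
            ∀ (N : ℕ) (i j : Fin N), (i : ℕ) < m →
              MemLp (fun ω => matrixFunEntry f (T N ω) i j) 2 P' ∧
              variance (fun ω => matrixFunEntry f (T N ω) i j) P'
                ≤ C s * sobolevNormSq s f / N) := by
  refine ⟨varianceConst σ σ₁ (24 * m₄), fun Ω _ P _ W m hW _ hL => ?_⟩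
  obtain ⟨Ω', mΩ', P', hP', π, T, ε, hπ, hT, hε, hlim, hout, hrows, hbound, hvar⟩ :=
    proposition4p2_general hW m hL
  exact ⟨Ω', mΩ', P', hP', π, T, ε, hπ, ⟨σ₁, 24 * m₄, hT⟩, hε, hlim, hout, hrows,
    fun N i k _ => hT.mean N i k, fun N i k _ => hT.variance_offDiag N i k,
    ⟨σ₁ ^ 2, fun N i _ => hT.variance_diag_le N i⟩,
    ⟨24 * m₄, fun N i k _ => hT.fourth_moment_le N i k⟩, hbound,
    fun s hs f hc hf N i j _ => hvar s (by linarith) f hc hf N i j⟩
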